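/- Let $m,n\ge 1$, write points of $\mathbb R^{m+n}$ as $(t,x)$ with $t\in\mathbb R^m$, $x\in\mathbb R^n$, and let $\square=-\Delta_t+\Delta_x$. Let $T>0$, $G=(-T,T)^m$, let $\Omega\subset\mathbb R^n$ be non-empty, open and bounded with smooth boundary and outward unit normal $\nu$, and put $\mathfrak U=G\times\Omega$, $\partial\mathfrak U:=G\times\partial\Omega$, with outward unit normal $\mathcal N=(0,\nu)$ on $\partial\mathfrak U$. Fix $p=(t(p),x(p))\in\mathbb R^{m+n}$ and put $$r_p=|x-x(p)|,\qquad f_p=\tfrac14\big(|x-x(p)|^2-|t-t(p)|^2\big),\qquad \mathfrak D_p=\{f_p>0\},\qquad R_+=\sup_{\mathfrak U\cap\mathfrak D_p}r_p .$$ Assume that $T>R_+$ and that the closure of $\mathfrak U\cap\mathfrak D_p$ does not meet the temporal part of the boundary of $\mathfrak U$, i.e. $\overline{\mathfrak U\cap\mathfrak D_p}\subset G\times\mathbb R^n$ (this follows from $T>R_+$ if $t(p)=0$). Let $\mathcal X\in C^\infty(\overline{\mathfrak U};\mathbb R^{m+n})$ vanish on $\mathfrak U\cap\partial\mathfrak D_p$,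 let $V,F\in C^\infty(\overline{\mathfrak U})$, and let $H$ be a real function on $\partial\mathfrak U$. Let $z_1,z_2$ be real functions that are $C^2$ in $\mathfrak U$ and $C^1$ on $G\times\overline\Omega$ (that is, up to $\partial\mathfrak U$), and that both satisfy $$\square z+\nabla_{\mathcal X}z+Vz=F\ \text{ in }\mathfrak U,\qquad z=H\ \text{ on }\partial\mathfrak U .$$ Let $\sigma>0$ and let $\varepsilon>0$ satisfy $\varepsilon R_+<1$. Put $$\Gamma_p^\varepsilon=\partial\mathfrak U\cap\mathfrak D_p\cap\{(1-\varepsilon r_p)\,\mathcal N f_p+\varepsilon f_p\,\mathcal N r_p>0\},\qquad W_p^\varepsilon=\Big(\bigcup_{(t,y)\in\Gamma_p^\varepsilon}\{t\}\times\{y_1\in\mathbb R^n:|y_1-y|<\sigma\}\Big)\cap\mathfrak U\cap\mathfrak D_p .$$ Then: 1. If $(z_1,\nabla_t z_1)=(z_2,\nabla_t z_2)$ on $W_p^\varepsilon$, then $z_1=z_2$ on $\mathfrak U\cap\mathfrak D_p$. 2. If $(z_1,\nabla_x z_1)=(z_2,\nabla_x z_2)$ on $W_p^\varepsilon$, then $z_1=z_2$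 on $\mathfrak U\cap\mathfrak D_p$. -/

import Mathlib

open Set
open scoped ContDiff Gradient Topology

noncomputable section

namespace Ultrahyperbolic

/-- Euclidean space `ℝᵏ`. -/
abbrev E (k : ℕ) : Type := EuclideanSpace ℝ (Fin k)

/-- Space-time `ℝᵐ × ℝⁿ`, with points `q = (t, x)`. -/
abbrev ST (m n : ℕ) : Type := E m × E n

/-- The open hypercube `G = (-T, T)ᵐ`. -/
def cube (m : ℕ) (T : ℝ) : Set (E m) := {t | ∀ i, -T < t i ∧ t i < T}

/-- The cylinder `𝔘 = G × Ω`. -/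
def cyl (m : ℕ) {n : ℕ} (T : ℝ) (Ω : Set (E n)) : Set (ST m n) := cube m T ×ˢ Ω

/-- The lateral boundary `∂𝔘 = G × ∂Ω`. -/
def lateral (m : ℕ) {n : ℕ} (T : ℝ) (Ω : Set (E n)) : Set (ST m n) :=
  cube m T ×ˢ frontier Ω

section Geometry

variable {m n : ℕ}

/-- `r_p = |x - x(p)|`. -/
def rp (p q : ST m n) : ℝ := ‖q.2 - p.2‖

/-- `f_p = (|x - x(p)|² - |t - t(p)|²) / 4`. -/
def fp (p q : ST m n) : ℝ := (‖q.2 - p.2‖ ^ 2 - ‖q.1 - p.1‖ ^ 2) / 4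

/-- The exterior `𝔇_p = {f_p > 0}` of the null cone with vertex `p`. -/
def Dp (p : ST m n) : Set (ST m n) := {q | 0 < fp p q}

/-- `R₊`, the supremum of `r_p` over `𝔘 ∩ 𝔇_p` (a bounded set of reals when `Ω` is bounded;
the value is `0` when `𝔘 ∩ 𝔇_p` is empty). -/
def Rplus (T : ℝ) (Ω : Set (E n)) (p : ST m n) : ℝ := sSup (rp p '' (cyl m T Ω ∩ Dp p))

/-- `φ` is a smooth function near `y` with nonzero gradient at `y`,
and `Ω = {φ < 0}` near `y`. -/
def IsDefiningAt (Ω : Set (E n)) (y : E n) (φ : E n → ℝ) : Prop :=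
  (∃ N ∈ 𝓝 y, ContDiffOn ℝ ∞ φ N ∧ ∀ x ∈ N, (x ∈ Ω ↔ φ x < 0)) ∧ ∇ φ y ≠ 0

/-- `Ω` has smooth boundary: near each boundary point it is a strict sublevel set of a
smooth function with nonzero gradient. -/
def HasSmoothBoundary (Ω : Set (E n)) : Prop := ∀ y ∈ frontier Ω, ∃ φ, IsDefiningAt Ω y φ

/-- `ν` is the outward unit normal of `Ω` at its boundary point `y`. -/
def IsOutwardUnitNormal (Ω : Set (E n)) (y ν : E n) : Prop :=
  ∃ φ, IsDefiningAt Ω y φ ∧ ν = ‖∇ φ y‖⁻¹ • ∇ φ y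

/-- `Γ_p^ε`: the points of `∂𝔘 ∩ 𝔇_p` where `(1 - ε r_p) 𝒩 f_p + ε f_p 𝒩 r_p > 0`.
The outward unit normal of the cylinder on `G × ∂Ω` is `𝒩 = (0, ν)`. -/
def Gam (T : ℝ) (Ω : Set (E n)) (p : ST m n) (ε : ℝ) : Set (ST m n) :=
  {q | q ∈ lateral m T Ω ∩ Dp p ∧ ∃ ν, IsOutwardUnitNormal Ω q.2 ν ∧
    0 < (1 - ε * rp p q) * fderiv ℝ (fp p) q (0, ν) + ε * fp p q * fderiv ℝ (rp p) q (0, ν)}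

/-- The spatial `σ`-neighbourhood of a set: the union over its points `(t, y)` of
`{t} × {y₁ : |y₁ - y| < σ}`. -/
def nbhd (σ : ℝ) (S : Set (ST m n)) : Set (ST m n) :=
  ⋃ s ∈ S, {s.1} ×ˢ Metric.ball s.2 σ

/-- The interior observation region `W_p^ε`. -/
def Wp (T : ℝ) (Ω : Set (E n)) (p : ST m n) (ε σ : ℝ) : Set (ST m n) :=
  nbhd σ (Gam T Ω p ε) ∩ (cyl m T Ω ∩ Dp p)

/-- The time gradient `∇_t z`. -/
def gradT (z : ST m n → ℝ) (q : ST m n) : E m := ∇ (fun t => z (t, q.2)) q.1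

/-- The space gradient `∇_x z`. -/
def gradX (z : ST m n → ℝ) (q : ST m n) : E n := ∇ (fun x => z (q.1, x)) q.2

/-- The ultrahyperbolic operator `□ = -Δ_t + Δ_x`. -/
def box (z : ST m n → ℝ) (q : ST m n) : ℝ :=
  -Laplacian.laplacian (fun t => z (t, q.2)) q.1 + Laplacian.laplacian (fun x => z (q.1, x)) q.2

/-- `z` is a classical solution of `□z + ∇_𝒳 z + V z = F` in `𝔘` with `z = H` on `∂𝔘`; it is
`C²` in `𝔘` and `C¹` up to the lateral boundary. -/
structure IsSolution (T : ℝ) (Ω : Set (E n)) (X : ST m n → ST m n) (V F H : ST m n → ℝ)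
    (z : ST m n → ℝ) : Prop where
  contDiffOn_two : ContDiffOn ℝ 2 z (cyl m T Ω)
  contDiffOn_one : ContDiffOn ℝ 1 z (cube m T ×ˢ closure Ω)
  equation : ∀ q ∈ cyl m T Ω, box z q + fderiv ℝ z q (X q) + V q * z q = F q
  dirichlet : ∀ q ∈ lateral m T Ω, z q = H q

end Geometry

end Ultrahyperbolic

end

/-!
The difference `z` of the two solutions solves the homogeneous equation with zero lateral data and
vanishes on `W_p^ε`. The function `kp = f_p / (1 - ε r_p)` is positive on `𝔇_p` and vanishes on its
boundary, `Γ_p^ε` is the part of `∂𝔘 ∩ 𝔇_p` on which `𝒩 kp > 0`, and `ψ = exp (τ kp)` is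
pseudoconvex for suitable `τ`. For `w = exp (λ ψ) χ z`, with `χ` a cutoff supported in `{kp ≥ c}`,
the multiplier `g(∇ψ, ∇w) + κ w` gives a current whose divergence dominates `λ² w²` where `χ = 1`
and is at least `-C exp (λ exp (2 c τ))²` where `kp ≤ 2c`. As `w = 0` on `∂𝔘`, its outward flux is
`𝒩ψ (𝒩w)² / 2`, which is nonpositive off `Γ_p^ε` and vanishes on `Γ_p^ε` since `z` is zero nearby.
Letting `λ → ∞` in the divergence theorem forces `z = 0` on `{kp > 2c}`.
-/

namespace Ultrahyperbolic

open MeasureTheory Filter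

section Divergence

variable {V : Type*} [NormedAddCommGroup V] [NormedSpace ℝ V]

/-- The divergence of a vector field, as the trace of its derivative. -/
noncomputable def divergence (J : V → V) (x : V) : ℝ := LinearMap.trace ℝ V (fderiv ℝ J x)

/-- The flux of `J` out of `U` is nonpositive at `y`, in the sense of limits from inside `U`; here
`U` is meant to be `{φ < 0}` near `y`, so that `∇φ` points outwards. -/
def FluxNonposAt (U : Set V) (φ : V → ℝ) (J : V → V) (y : V) : Prop :=
  ∀ η > 0, ∀ᶠ x in 𝓝[U] y, fderiv ℝ φ x (J x) ≤ η

/-- The fields on `U` to which the divergence theorem is applied: bounded, with bounded divergence,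
and vanishing outside `K`. No regularity up to the boundary of `U` is required. -/
structure IsAdmissibleField (U K : Set V) (J : V → V) : Prop where
  contDiffOn : ContDiffOn ℝ 1 J U
  exists_norm_le : ∃ C, ∀ x ∈ U, ‖J x‖ ≤ C
  exists_abs_divergence_le : ∃ C, ∀ x ∈ U, |divergence J x| ≤ C
  eq_zero : ∀ x ∈ U \ K, J x = 0

theorem contDiff_of_contDiffAt_tsupport {W : Type*} [NormedAddCommGroup W] [NormedSpace ℝ W]
    {f : V → W} {k : WithTop ℕ∞} (hf : ∀ x ∈ tsupport f, ContDiffAt ℝ k f x) : ContDiff ℝ k f := by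
  refine contDiff_iff_contDiffAt.2 fun x => ?_
  by_cases hx : x ∈ tsupport f
  · exact hf x hx
  · exact contDiffAt_const.congr_of_eventuallyEq (notMem_tsupport_iff_eventuallyEq.1 hx)

theorem divergence_congr {J J' : V → V} {x : V} (h : J =ᶠ[𝓝 x] J') :
    divergence J x = divergence J' x := by
  rw [divergence, h.fderiv_eq, divergence]

theorem divergence_eq_zero {J : V → V} {x : V} (h : J =ᶠ[𝓝 x] 0) : divergence J x = 0 := by
  rw [divergence_congr h, divergence, fderiv_zero, Pi.zero_apply,
    ContinuousLinearMap.toLinearMap_zero, map_zero]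

theorem divergence_sum {ι : Type*} {s : Finset ι} {J : ι → V → V} {x : V}
    (hJ : ∀ i ∈ s, DifferentiableAt ℝ (J i) x) :
    divergence (fun y => ∑ i ∈ s, J i y) x = ∑ i ∈ s, divergence (J i) x := by
  simp only [divergence, fderiv_fun_sum hJ, ContinuousLinearMap.toLinearMap_sum, map_sum]

theorem IsAdmissibleField.eventuallyEq_zero {U K : Set V} {J : V → V}
    (hJ : IsAdmissibleField U K J) (hU : IsOpen U) (hK : IsClosed K) {x : V} (hx : x ∈ U \ K) :
    J =ᶠ[𝓝 x] 0 :=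
  mem_of_superset ((hU.sdiff hK).mem_nhds hx) hJ.eq_zero

/-- A smooth step from `0` on `(-∞, 1]` to `1` on `[2, ∞)`. -/
noncomputable def ramp (y : ℝ) : ℝ := Real.smoothTransition (y - 1)

theorem contDiff_ramp : ContDiff ℝ ∞ ramp :=
  Real.smoothTransition.contDiff.comp (contDiff_id.sub contDiff_const)

theorem ramp_eq_zero {y : ℝ} (hy : y ≤ 1) : ramp y = 0 :=
  Real.smoothTransition.zero_of_nonpos (by linarith)

theorem ramp_eq_one {y : ℝ} (hy : 2 ≤ y) : ramp y = 1 :=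
  Real.smoothTransition.one_of_one_le (by linarith)

theorem ramp_nonneg (y : ℝ) : 0 ≤ ramp y := Real.smoothTransition.nonneg _

theorem ramp_le_one (y : ℝ) : ramp y ≤ 1 := Real.smoothTransition.le_one _

theorem deriv_ramp_nonneg (y : ℝ) : 0 ≤ deriv ramp y :=
  Monotone.deriv_nonneg fun _ _ h => Real.smoothTransition.monotone (by linarith)

theorem deriv_ramp_eq_zero {y : ℝ} (hy : 2 < y) : deriv ramp y = 0 := by
  have h : ramp =ᶠ[𝓝 y] fun _ => 1 := by
    filter_upwards [lt_mem_nhds hy] with a ha using ramp_eq_one ha.le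
  rw [h.deriv_eq, deriv_const]

theorem hasFDerivAt_ramp_neg_div {φ : V → ℝ} {x : V} (hφ : DifferentiableAt ℝ φ x) (δ : ℝ) :
    HasFDerivAt (fun y => ramp (-φ y / δ))
      (-(deriv ramp (-φ x / δ) / δ) • fderiv ℝ φ x) x := by
  have h := ((contDiff_ramp.differentiable (by simp) _).hasDerivAt).comp_hasFDerivAt x
    (hφ.hasFDerivAt.fun_neg.mul_const δ⁻¹)
  simp only [← div_eq_mul_inv] at h
  refine h.congr_fderiv ?_
  rw [smul_smul, smul_neg, neg_smul, ← div_eq_mul_inv]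

variable [FiniteDimensional ℝ V]

theorem divergence_smul {f : V → ℝ} {J : V → V} {x : V} (hf : DifferentiableAt ℝ f x)
    (hJ : DifferentiableAt ℝ J x) :
    divergence (fun y => f y • J y) x = f x * divergence J x + fderiv ℝ f x (J x) := by
  rw [divergence, fderiv_fun_smul hf hJ, ContinuousLinearMap.toLinearMap_add, map_add,
    ContinuousLinearMap.toLinearMap_smul, map_smul, smul_eq_mul]
  exact congrArg _ (LinearMap.trace_smulRight (fderiv ℝ f x : V →ₗ[ℝ] ℝ) (J x))

theorem divergence_smul_const {f : V → ℝ} {x : V} (hf : DifferentiableAt ℝ f x) (v : V) :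
    divergence (fun y => f y • v) x = fderiv ℝ f x v := by
  rw [divergence_smul hf (differentiableAt_const v), divergence, fderiv_fun_const, Pi.zero_apply,
    ContinuousLinearMap.toLinearMap_zero, map_zero, mul_zero, zero_add]

theorem continuousOn_divergence {U : Set V} (hU : IsOpen U) {J : V → V}
    (hJ : ContDiffOn ℝ 1 J U) : ContinuousOn (divergence J) U :=
  (LinearMap.continuous_of_finiteDimensional (LinearMap.trace ℝ V ∘ₗ
    (ContinuousLinearMap.coeLM ℝ : (V →L[ℝ] V) →ₗ[ℝ] V →ₗ[ℝ] V))).comp_continuousOn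
    (hJ.continuousOn_fderiv_of_isOpen hU le_rfl)

theorem IsAdmissibleField.smul {U K : Set V} {J : V → V} (hJ : IsAdmissibleField U K J)
    (hU : IsOpen U) {θ : V → ℝ} (hθ : ContDiff ℝ 1 θ) (hc : HasCompactSupport θ) :
    IsAdmissibleField U (K ∩ tsupport θ) fun x => θ x • J x := by
  obtain ⟨C, hC⟩ := hJ.exists_norm_le
  obtain ⟨D, hD⟩ := hJ.exists_abs_divergence_le
  obtain ⟨A, hA⟩ := hc.exists_bound_of_continuous hθ.continuous
  obtain ⟨B, hB⟩ := (hc.fderiv ℝ).exists_bound_of_continuous (hθ.continuous_fderiv one_ne_zero)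
  refine ⟨hθ.contDiffOn.smul hJ.contDiffOn, ⟨A * C, fun x hx => ?_⟩,
    ⟨A * D + B * C, fun x hx => ?_⟩, fun x hx => ?_⟩
  · rw [norm_smul]
    exact mul_le_mul (hA x) (hC x hx) (norm_nonneg _) ((norm_nonneg _).trans (hA x))
  · rw [divergence_smul (hθ.differentiable one_ne_zero x)
      ((hJ.contDiffOn.contDiffAt (hU.mem_nhds hx)).differentiableAt one_ne_zero)]
    refine (abs_add_le _ _).trans (add_le_add ?_ ?_)
    · rw [abs_mul]
      exact mul_le_mul (hA x) (hD x hx) (abs_nonneg _) ((norm_nonneg _).trans (hA x))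
    · exact (ContinuousLinearMap.le_opNorm _ _).trans
        (mul_le_mul (hB x) (hC x hx) (norm_nonneg _) ((norm_nonneg _).trans (hB x)))
  · by_cases hxK : x ∈ K
    · rw [image_eq_zero_of_notMem_tsupport fun h => hx.2 ⟨hxK, h⟩, zero_smul]
    · rw [hJ.eq_zero x ⟨hx.1, hxK⟩, smul_zero]

variable [MeasurableSpace V] [BorelSpace V] {μ : Measure V}

theorem IsAdmissibleField.integrableOn_divergence [IsFiniteMeasureOnCompacts μ] {U K : Set V}
    {J : V → V} (hJ : IsAdmissibleField U K J) (hU : IsOpen U) (hK : IsCompact K) :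
    IntegrableOn (divergence J) U μ := by
  obtain ⟨C, hC⟩ := hJ.exists_abs_divergence_le
  have hUK : IntegrableOn (divergence J) (U ∩ K) μ :=
    IntegrableOn.of_bound ((measure_mono inter_subset_right).trans_lt hK.measure_lt_top)
      (((continuousOn_divergence hU hJ.contDiffOn).mono inter_subset_left).aestronglyMeasurable
        (hU.measurableSet.inter hK.measurableSet)) C
      (ae_restrict_of_forall_mem (hU.measurableSet.inter hK.measurableSet) fun x hx => hC x hx.1)
  refine hUK.of_forall_sdiff_eq_zero hU.measurableSet fun x hx => divergence_eq_zero ?_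
  exact hJ.eventuallyEq_zero hU hK.isClosed ⟨hx.1, fun h => hx.2 ⟨hx.1, h⟩⟩

theorem integrable_divergence [IsFiniteMeasureOnCompacts μ] {J : V → V} (hJ : ContDiff ℝ 1 J)
    (hc : HasCompactSupport J) : Integrable (divergence J) μ :=
  (continuousOn_univ.1 (continuousOn_divergence isOpen_univ
    hJ.contDiffOn)).integrable_of_hasCompactSupport
    ((hc.fderiv ℝ).comp_left (g := fun L : V →L[ℝ] V => LinearMap.trace ℝ V L)
      (by rw [ContinuousLinearMap.toLinearMap_zero, map_zero]))

variable [μ.IsAddHaarMeasure]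

theorem integral_fderiv_eq_zero {f : V → ℝ} (hf : ContDiff ℝ 1 f) (hc : HasCompactSupport f)
    (v : V) : ∫ x, fderiv ℝ f x v ∂μ = 0 := by
  have hint : Integrable (fun x => fderiv ℝ f x v) μ :=
    ((hf.continuous_fderiv one_ne_zero).clm_apply
      continuous_const).integrable_of_hasCompactSupport (hc.fderiv_apply ℝ v)
  simpa using integral_mul_fderiv_eq_neg_fderiv_mul_of_integrable (μ := μ)
    (f := fun _ : V => (1 : ℝ)) (g := f) (v := v) (by simp) (by simpa using hint)
    (by simpa using hf.continuous.integrable_of_hasCompactSupport hc)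
    (fun _ _ => differentiableAt_const _) (fun x _ => hf.differentiable one_ne_zero x)

theorem integral_divergence_eq_zero {J : V → V} (hJ : ContDiff ℝ 1 J) (hc : HasCompactSupport J) :
    ∫ x, divergence J x ∂μ = 0 := by
  let b := Module.finBasis ℝ V
  let c i : V →L[ℝ] ℝ := (b.coord i).toContinuousLinearMap
  have hcJ i : ContDiff ℝ 1 fun x => c i (J x) := (c i).contDiff.comp hJ
  have hcc i : HasCompactSupport fun x => c i (J x) := hc.comp_left (map_zero (c i))
  have hdiv x : divergence J x = ∑ i, fderiv ℝ (fun y => c i (J y)) x (b i) := by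
    have hsum : J = fun y => ∑ i, c i (J y) • b i := funext fun y => (b.sum_repr (J y)).symm
    have hd i : DifferentiableAt ℝ (fun y => c i (J y)) x := (hcJ i).differentiable one_ne_zero x
    conv_lhs => rw [hsum]
    rw [divergence_sum fun i _ => (hd i).smul_const (b i)]
    exact Finset.sum_congr rfl fun i _ => divergence_smul_const (hd i) (b i)
  simp_rw [hdiv]
  rw [integral_finsetSum _ fun i _ => (((hcJ i).continuous_fderiv one_ne_zero).clm_apply
    continuous_const).integrable_of_hasCompactSupport ((hcc i).fderiv_apply ℝ _)]
  exact Finset.sum_eq_zero fun i _ => integral_fderiv_eq_zero (hcJ i) (hcc i) _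

end Divergence

section BoundaryLayer

variable {V : Type*} [NormedAddCommGroup V] [NormedSpace ℝ V] {U K N : Set V} {φ : V → ℝ}
  {J : V → V} {θ : V → ℝ}

/-- The field `J` cut off to the points of `U` at which `φ < -δ`. -/
noncomputable def truncate (U : Set V) (φ : V → ℝ) (δ : ℝ) (J : V → V) : V → V :=
  U.indicator fun x => ramp (-φ x / δ) • J x

theorem truncate_eventuallyEq_zero (hN : IsOpen N) (hK : IsClosed K) (hKN : K ⊆ N)
    (hφ : ContDiffOn ℝ 1 φ N) (hφU : ∀ x ∈ N, (x ∈ U ↔ φ x < 0))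
    (hJK : ∀ x ∈ U \ K, J x = 0) {δ : ℝ} (hδ : 0 < δ) {x : V} (hx : x ∉ U) :
    truncate U φ δ J =ᶠ[𝓝 x] 0 := by
  suffices h : ∀ᶠ y in 𝓝 x, y ∈ U → ramp (-φ y / δ) • J y = 0 from
    h.mono fun y hy => indicator_apply_eq_zero.2 hy
  by_cases hxK : x ∈ K
  · have hφx : 0 ≤ φ x := not_lt.1 fun h => hx ((hφU x (hKN hxK)).2 h)
    have hφc : ContinuousAt φ x := hφ.continuousOn.continuousAt (hN.mem_nhds (hKN hxK))
    filter_upwards [hφc.eventually_const_lt (by linarith : -δ < φ x)] with y hy _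
    rw [ramp_eq_zero (by rw [div_le_one hδ]; linarith), zero_smul]
  · filter_upwards [hK.isOpen_compl.mem_nhds hxK] with y hyK hyU
    rw [hJK y ⟨hyU, hyK⟩, smul_zero]

theorem hasCompactSupport_truncate (hK : IsCompact K) (hJK : ∀ x ∈ U \ K, J x = 0) {δ : ℝ} :
    HasCompactSupport (truncate U φ δ J) :=
  .of_support_subset_isCompact hK fun x hx => by
    by_contra hxK
    exact hx (indicator_apply_eq_zero.2 fun hxU => by rw [hJK x ⟨hxU, hxK⟩, smul_zero])

theorem contDiff_truncate (hU : IsOpen U) (hN : IsOpen N) (hK : IsClosed K) (hKN : K ⊆ N)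
    (hφ : ContDiffOn ℝ 1 φ N) (hφU : ∀ x ∈ N, (x ∈ U ↔ φ x < 0))
    (hJ : IsAdmissibleField U K J) {δ : ℝ} (hδ : 0 < δ) : ContDiff ℝ 1 (truncate U φ δ J) := by
  refine contDiff_iff_contDiffAt.2 fun x => ?_
  by_cases hx : x ∈ U
  swap
  · exact contDiffAt_const.congr_of_eventuallyEq
      (truncate_eventuallyEq_zero hN hK hKN hφ hφU hJ.eq_zero hδ hx)
  refine ContDiffAt.congr_of_eventuallyEq (f := fun y => ramp (-φ y / δ) • J y) ?_ ?_
  · by_cases hxK : x ∈ K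
    · have hφx : ContDiffAt ℝ 1 φ x := hφ.contDiffAt (hN.mem_nhds (hKN hxK))
      exact ((contDiff_ramp.of_le (by simp)).contDiffAt.comp x (hφx.neg.div_const δ)).smul
        (hJ.contDiffOn.contDiffAt (hU.mem_nhds hx))
    · refine contDiffAt_const (c := 0) |>.congr_of_eventuallyEq ?_
      filter_upwards [hJ.eventuallyEq_zero hU hK ⟨hx, hxK⟩] with y hy
        using by rw [hy, Pi.zero_apply, smul_zero]
  · filter_upwards [hU.mem_nhds hx] with y hy using indicator_of_mem hy _

theorem divergence_truncate [FiniteDimensional ℝ V] (hU : IsOpen U) (hN : IsOpen N)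
    (hK : IsClosed K) (hKN : K ⊆ N) (hφ : ContDiffOn ℝ 1 φ N) (hJ : IsAdmissibleField U K J) (δ : ℝ)
    {x : V} (hx : x ∈ U) :
    divergence (truncate U φ δ J) x =
      ramp (-φ x / δ) * divergence J x - deriv ramp (-φ x / δ) / δ * fderiv ℝ φ x (J x) := by
  have heq : truncate U φ δ J =ᶠ[𝓝 x] fun y => ramp (-φ y / δ) • J y := by
    filter_upwards [hU.mem_nhds hx] with y hy using indicator_of_mem hy _
  rw [divergence_congr heq]
  by_cases hxK : x ∈ K
  · have hφx : DifferentiableAt ℝ φ x :=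
      (hφ.contDiffAt (hN.mem_nhds (hKN hxK))).differentiableAt one_ne_zero
    have hd := hasFDerivAt_ramp_neg_div hφx δ
    rw [divergence_smul hd.differentiableAt
      ((hJ.contDiffOn.contDiffAt (hU.mem_nhds hx)).differentiableAt one_ne_zero), hd.fderiv,
      smul_apply, smul_eq_mul, neg_mul, sub_eq_add_neg]
  · have hJ0 := hJ.eventuallyEq_zero hU hK ⟨hx, hxK⟩
    have h0 : (fun y => ramp (-φ y / δ) • J y) =ᶠ[𝓝 x] 0 := by
      filter_upwards [hJ0] with y hy using by rw [hy, Pi.zero_apply, smul_zero]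
    rw [divergence_eq_zero h0, divergence_eq_zero hJ0, hJ0.eq_of_nhds, Pi.zero_apply, map_zero,
      mul_zero, mul_zero, sub_zero]

theorem continuousOn_ramp_mul_divergence [FiniteDimensional ℝ V] (hU : IsOpen U) (hN : IsOpen N)
    (hK : IsClosed K) (hKN : K ⊆ N) (hφ : ContinuousOn φ N) (hJ : IsAdmissibleField U K J)
    (δ : ℝ) : ContinuousOn (fun x => ramp (-φ x / δ) * divergence J x) U := by
  refine continuousOn_of_forall_continuousAt fun x hx => ?_
  by_cases hxK : x ∈ K
  · exact (contDiff_ramp.continuous.continuousAt.comp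
      ((hφ.continuousAt (hN.mem_nhds (hKN hxK))).neg.div_const δ)).mul
      ((continuousOn_divergence hU hJ.contDiffOn).continuousAt (hU.mem_nhds hx))
  · refine continuousAt_const.congr (f := fun _ => (0 : ℝ)) ?_
    filter_upwards [(hU.sdiff hK).mem_nhds ⟨hx, hxK⟩] with y hy
    rw [divergence_eq_zero (hJ.eventuallyEq_zero hU hK hy), mul_zero]

theorem layer_mul_flux_le (hJK : ∀ x ∈ U \ K, J x = 0) (hθ0 : ∀ x, 0 ≤ θ x)
    (hθK : ∀ x ∈ K, θ x = 1) {δ η : ℝ} (hδ : 0 < δ) (hη : 0 ≤ η)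
    (hflux : ∀ x ∈ K, x ∈ U → -(2 * δ) ≤ φ x → fderiv ℝ φ x (J x) ≤ η) {x : V} (hx : x ∈ U) :
    deriv ramp (-φ x / δ) / δ * fderiv ℝ φ x (J x)
      ≤ η * (θ x * (deriv ramp (-φ x / δ) / δ)) := by
  have hramp : 0 ≤ deriv ramp (-φ x / δ) / δ := div_nonneg (deriv_ramp_nonneg _) hδ.le
  by_cases hxK : x ∈ K
  · rw [hθK x hxK, one_mul, mul_comm η]
    rcases le_or_gt (-(2 * δ)) (φ x) with hle | hlt
    · exact mul_le_mul_of_nonneg_left (hflux x hxK hx hle) hramp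
    · rw [deriv_ramp_eq_zero (by rw [lt_div_iff₀ hδ]; linarith), zero_div, zero_mul, zero_mul]
  · rw [hJK x ⟨hx, hxK⟩, map_zero, mul_zero]
    exact mul_nonneg hη (mul_nonneg (hθ0 x) hramp)

theorem eventually_forall_flux_le (hN : IsOpen N) (hK : IsCompact K) (hKN : K ⊆ N)
    (hφ : ContinuousOn φ N) (hφU : ∀ x ∈ N, (x ∈ U ↔ φ x < 0))
    (hflux : ∀ y ∈ K, φ y = 0 → FluxNonposAt U φ J y) {η : ℝ} (hη : 0 < η) :
    ∀ᶠ δ in 𝓝[>] (0 : ℝ), ∀ x ∈ K, x ∈ U → -(2 * δ) ≤ φ x → fderiv ℝ φ x (J x) ≤ η := by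
  refine nhdsWithin_le_nhds (hK.eventually_forall_of_forall_eventually fun y hy => ?_)
  have hφc : ContinuousAt φ y := hφ.continuousAt (hN.mem_nhds (hKN hy))
  rw [nhds_prod_eq]
  rcases eq_or_ne (φ y) 0 with h0 | hne
  · have h := eventually_nhdsWithin_iff.1 (hflux y hy h0 η hη)
    filter_upwards [h.prod_inr (𝓝 0)] with z hz hzU _ using hz hzU
  · have hδ : ∀ᶠ δ : ℝ in 𝓝 0, 2 * δ < |φ y| / 2 :=
      (continuous_const_mul 2).continuousAt.eventually_lt_const (by simpa using hne)
    have hφy : ∀ᶠ x in 𝓝 y, |φ y| / 2 < |φ x| :=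
      hφc.abs.eventually_const_lt (half_lt_self (abs_pos.2 hne))
    filter_upwards [hδ.prod_mk (hφy.and (hN.mem_nhds (hKN hy)))] with z ⟨hz, hz', hzN⟩ hzU hzφ
    rw [abs_of_neg ((hφU _ hzN).1 hzU)] at hz'
    linarith

theorem integrable_layer {Y : Type*} [TopologicalSpace Y] [MeasurableSpace Y] [BorelSpace Y]
    {μ : Measure Y} [IsFiniteMeasureOnCompacts μ] {N : Set Y} {φ θ : Y → ℝ} (hN : IsOpen N)
    (hφ : ContinuousOn φ N) (hθ : Continuous θ)
    (hc : HasCompactSupport θ) (hθN : tsupport θ ⊆ N) (δ : ℝ) :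
    Integrable (fun x => θ x * (deriv ramp (-φ x / δ) / δ)) μ := by
  refine Continuous.integrable_of_hasCompactSupport (continuous_iff_continuousAt.2 fun x => ?_)
    hc.mul_right
  by_cases hx : x ∈ tsupport θ
  · exact hθ.continuousAt.mul ((((contDiff_ramp.continuous_deriv (by simp)).comp_continuousOn
      (hφ.neg.div_const δ)).div_const δ).continuousAt (hN.mem_nhds (hθN hx)))
  · refine continuousAt_const.congr (f := fun _ => (0 : ℝ)) ?_
    filter_upwards [notMem_tsupport_iff_eventuallyEq.1 hx] with y hy
    rw [hy, Pi.zero_apply, zero_mul]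

theorem exists_contDiff_one_on_tsupport_subset [FiniteDimensional ℝ V] (hN : IsOpen N)
    (hK : IsCompact K) (hKN : K ⊆ N) :
    ∃ θ : V → ℝ, ContDiff ℝ 1 θ ∧ (∀ x, 0 ≤ θ x) ∧ (∀ x ∈ K, θ x = 1) ∧ HasCompactSupport θ ∧
      tsupport θ ⊆ N := by
  obtain ⟨L, hL, hKL, hLN⟩ := exists_compact_between hK hN hKN
  obtain ⟨θ, hθK, hθ0, hθI⟩ := exists_contMDiffMap_one_nhds_of_subset_interior
    (modelWithCornersSelf ℝ V) (n := 1) hK.isClosed hKL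
  have hsub : tsupport (θ : V → ℝ) ⊆ L :=
    closure_minimal (fun x hx => by_contra fun h => hx (hθ0 x h)) hL.isClosed
  exact ⟨θ, θ.contMDiff.contDiff, fun x => (hθI x).1, fun x hx => hθK.self_of_nhdsSet x hx,
    .of_support_subset_isCompact hL ((subset_tsupport _).trans hsub), hsub.trans hLN⟩

theorem FluxNonposAt.smul {f : V → ℝ} {y : V} (h : FluxNonposAt U φ J y)
    (hf : ∀ x, f x ∈ Icc 0 1) : FluxNonposAt U φ (fun x => f x • J x) y := fun η hη => by
  filter_upwards [h η hη] with x hx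
  rw [map_smul, smul_eq_mul]
  exact (mul_le_mul_of_nonneg_left hx (hf x).1).trans (mul_le_of_le_one_left hη.le (hf x).2)

theorem exists_partition_of_unity_subordinate [FiniteDimensional ℝ V] (hK : IsCompact K)
    {N : V → Set V} (hN : ∀ x ∈ K, IsOpen (N x)) (hxN : ∀ x ∈ K, x ∈ N x) :
    ∃ (s : Finset K) (f : s → V → ℝ), (∀ i, ContDiff ℝ 1 (f i) ∧ (∀ x, f i x ∈ Icc 0 1) ∧
      HasCompactSupport (f i) ∧ tsupport (f i) ⊆ N (i : K)) ∧
      ∀ x ∈ K, ∑ i, f i x = 1 := by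
  have hcov : K ⊆ ⋃ x : K, N x ∩ Metric.ball (x : V) 1 := fun x hx =>
    mem_iUnion.2 ⟨⟨x, hx⟩, hxN x hx, Metric.mem_ball_self one_pos⟩
  have hopen (x : K) : IsOpen (N x ∩ Metric.ball (x : V) 1) := (hN x x.2).inter Metric.isOpen_ball
  obtain ⟨t, ht⟩ := hK.elim_finite_subcover _ hopen hcov
  obtain ⟨f, hf⟩ := SmoothPartitionOfUnity.exists_isSubordinate (modelWithCornersSelf ℝ V)
    hK.isClosed (fun x : t => N (x : K) ∩ Metric.ball ((x : K) : V) 1) (fun x => hopen x)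
    fun x hx => by
      obtain ⟨i, hi, hxi⟩ := mem_iUnion₂.1 (ht hx)
      exact mem_iUnion.2 ⟨⟨i, hi⟩, hxi⟩
  refine ⟨t, fun i => f i, fun i => ⟨(f i).contMDiff.contDiff.of_le (by simp),
    fun x => ⟨f.nonneg i x, f.le_one i x⟩,
    .of_support_subset_isCompact (isCompact_closedBall ((i : K) : V) 1) ((subset_tsupport _).trans
      ((hf i).trans (inter_subset_right.trans Metric.ball_subset_closedBall))),
    (hf i).trans inter_subset_left⟩, fun x hx => ?_⟩
  rw [← finsum_eq_sum_of_fintype]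
  exact f.sum_eq_one hx

variable [MeasurableSpace V] [BorelSpace V] [FiniteDimensional ℝ V] {μ : Measure V}
  [μ.IsAddHaarMeasure]

/- The layer is integrated by applying the divergence theorem to `θ • ramp (-φ / δ)` in a fixed
direction `v` transversal to the level sets of `φ`. -/
theorem exists_integral_layer_le (hN : IsOpen N) (hφ : ContDiffOn ℝ 1 φ N) (hθ : ContDiff ℝ 1 θ)
    (hθ0 : ∀ x, 0 ≤ θ x) (hc : HasCompactSupport θ) (hθN : tsupport θ ⊆ N) {v : V} {c : ℝ}
    (hc0 : 0 < c) (hv : ∀ x ∈ N, c ≤ fderiv ℝ φ x v) :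
    ∃ M, ∀ δ > 0, ∫ x, θ x * (deriv ramp (-φ x / δ) / δ) ∂μ ≤ M := by
  have integrable_fderiv {f : V → ℝ} (hf : ContDiff ℝ 1 f) (hfc : HasCompactSupport f) :
      Integrable (fun x => fderiv ℝ f x v) μ := ((hf.continuous_fderiv one_ne_zero).clm_apply
    continuous_const).integrable_of_hasCompactSupport (hfc.fderiv_apply ℝ v)
  refine ⟨(∫ x, |fderiv ℝ θ x v| ∂μ) / c, fun δ hδ => ?_⟩
  set F : V → ℝ := fun x => ramp (-φ x / δ) * θ x with hF
  have hφθ : ∀ x ∈ tsupport θ, ContDiffAt ℝ 1 φ x := fun x hx =>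
    hφ.contDiffAt (hN.mem_nhds (hθN hx))
  have hFc : HasCompactSupport F := hc.mul_left
  have hFd : ContDiff ℝ 1 F := contDiff_of_contDiffAt_tsupport fun x hx =>
    ((contDiff_ramp.of_le (by simp)).contDiffAt.comp x
      ((hφθ x (tsupport_mul_subset_right hx)).neg.div_const δ)).mul hθ.contDiffAt
  have hpoint x : c * (θ x * (deriv ramp (-φ x / δ) / δ))
      ≤ |fderiv ℝ θ x v| - fderiv ℝ F x v := by
    by_cases hx : x ∈ tsupport θ
    · have hd := ((hasFDerivAt_ramp_neg_div ((hφθ x hx).differentiableAt one_ne_zero) δ).fun_mul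
        (hθ.differentiable one_ne_zero x).hasFDerivAt).fderiv
      have hramp : ramp (-φ x / δ) * fderiv ℝ θ x v ≤ |fderiv ℝ θ x v| :=
        (mul_le_mul_of_nonneg_left (le_abs_self _) (ramp_nonneg _)).trans
          (mul_le_of_le_one_left (abs_nonneg _) (ramp_le_one _))
      have hlayer : 0 ≤ θ x * (deriv ramp (-φ x / δ) / δ) :=
        mul_nonneg (hθ0 x) (div_nonneg (deriv_ramp_nonneg _) hδ.le)
      have hslope := mul_le_mul_of_nonneg_left (hv x (hθN hx)) hlayer
      rw [hF, hd]
      simp only [add_apply, smul_apply, smul_eq_mul]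
      linarith
    · have hFx : F =ᶠ[𝓝 x] 0 := notMem_tsupport_iff_eventuallyEq.1 fun h =>
        hx (tsupport_mul_subset_right h)
      rw [image_eq_zero_of_notMem_tsupport hx, hFx.fderiv_eq, fderiv_zero]
      simp
  rw [le_div_iff₀ hc0, mul_comm, ← integral_const_mul]
  calc ∫ x, c * (θ x * (deriv ramp (-φ x / δ) / δ)) ∂μ
      ≤ ∫ x, (|fderiv ℝ θ x v| - fderiv ℝ F x v) ∂μ :=
        integral_mono ((integrable_layer hN hφ.continuousOn hθ.continuous hc hθN δ).const_mul c)
          ((integrable_fderiv hθ hc).abs.sub (integrable_fderiv hFd hFc)) hpoint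
    _ = ∫ x, |fderiv ℝ θ x v| ∂μ := by
        rw [integral_sub (integrable_fderiv hθ hc).abs (integrable_fderiv hFd hFc),
          integral_fderiv_eq_zero hFd hFc, sub_zero]

theorem norm_ramp_mul_le (s d : ℝ) : ‖ramp s * d‖ ≤ ‖d‖ := by
  rw [norm_mul, Real.norm_of_nonneg (ramp_nonneg s)]
  exact mul_le_of_le_one_left (norm_nonneg d) (ramp_le_one s)

theorem integrable_divergence_truncate (hU : IsOpen U) (hN : IsOpen N) (hK : IsCompact K)
    (hKN : K ⊆ N) (hφ : ContDiffOn ℝ 1 φ N) (hφU : ∀ x ∈ N, (x ∈ U ↔ φ x < 0))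
    (hJ : IsAdmissibleField U K J) {δ : ℝ} (hδ : 0 < δ) :
    Integrable (divergence (truncate U φ δ J)) μ :=
  integrable_divergence (contDiff_truncate hU hN hK.isClosed hKN hφ hφU hJ hδ)
    (hasCompactSupport_truncate hK hJ.eq_zero)

theorem setIntegral_divergence_truncate (hU : IsOpen U) (hN : IsOpen N) (hK : IsCompact K)
    (hKN : K ⊆ N) (hφ : ContDiffOn ℝ 1 φ N) (hφU : ∀ x ∈ N, (x ∈ U ↔ φ x < 0))
    (hJ : IsAdmissibleField U K J) {δ : ℝ} (hδ : 0 < δ) :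
    ∫ x in U, divergence (truncate U φ δ J) x ∂μ = 0 := by
  rw [setIntegral_eq_integral_of_forall_compl_eq_zero fun x hx => divergence_eq_zero
    (truncate_eventuallyEq_zero hN hK.isClosed hKN hφ hφU hJ.eq_zero hδ hx),
    integral_divergence_eq_zero (contDiff_truncate hU hN hK.isClosed hKN hφ hφU hJ hδ)
      (hasCompactSupport_truncate hK hJ.eq_zero)]

theorem setIntegral_ramp_mul_divergence_le (hU : IsOpen U) (hN : IsOpen N) (hK : IsCompact K)
    (hKN : K ⊆ N) (hφ : ContDiffOn ℝ 1 φ N) (hφU : ∀ x ∈ N, (x ∈ U ↔ φ x < 0))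
    (hJ : IsAdmissibleField U K J) (hθ : Continuous θ) (hθ0 : ∀ x, 0 ≤ θ x)
    (hθK : ∀ x ∈ K, θ x = 1) (hc : HasCompactSupport θ) (hθN : tsupport θ ⊆ N) {δ η : ℝ}
    (hδ : 0 < δ) (hη : 0 ≤ η)
    (hflux : ∀ x ∈ K, x ∈ U → -(2 * δ) ≤ φ x → fderiv ℝ φ x (J x) ≤ η) :
    ∫ x in U, ramp (-φ x / δ) * divergence J x ∂μ
      ≤ η * ∫ x, θ x * (deriv ramp (-φ x / δ) / δ) ∂μ := by
  have hlayer0 x : 0 ≤ θ x * (deriv ramp (-φ x / δ) / δ) :=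
    mul_nonneg (hθ0 x) (div_nonneg (deriv_ramp_nonneg _) hδ.le)
  have hlayer := integrable_layer (μ := μ) hN hφ.continuousOn hθ hc hθN δ
  have htrunc := integrable_divergence_truncate (μ := μ) hU hN hK hKN hφ hφU hJ hδ
  have hramp : IntegrableOn (fun x => ramp (-φ x / δ) * divergence J x) U μ :=
    Integrable.mono (hJ.integrableOn_divergence hU hK)
      ((continuousOn_ramp_mul_divergence hU hN hK.isClosed hKN hφ.continuousOn hJ
        δ).aestronglyMeasurable hU.measurableSet)
      (ae_of_all _ fun x => norm_ramp_mul_le _ _)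
  have hpoint x (hx : x ∈ U) : ramp (-φ x / δ) * divergence J x
      ≤ divergence (truncate U φ δ J) x + η * (θ x * (deriv ramp (-φ x / δ) / δ)) := by
    rw [divergence_truncate hU hN hK.isClosed hKN hφ hJ δ hx]
    linarith [layer_mul_flux_le hJ.eq_zero hθ0 hθK hδ hη hflux hx]
  calc ∫ x in U, ramp (-φ x / δ) * divergence J x ∂μ
      ≤ ∫ x in U, (divergence (truncate U φ δ J) x
          + η * (θ x * (deriv ramp (-φ x / δ) / δ))) ∂μ :=
        setIntegral_mono_on hramp (htrunc.add (hlayer.const_mul η)).integrableOn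
          hU.measurableSet hpoint
    _ = η * ∫ x in U, θ x * (deriv ramp (-φ x / δ) / δ) ∂μ := by
        rw [integral_add htrunc.integrableOn (hlayer.const_mul η).integrableOn,
          setIntegral_divergence_truncate hU hN hK hKN hφ hφU hJ hδ, zero_add, integral_const_mul]
    _ ≤ η * ∫ x, θ x * (deriv ramp (-φ x / δ) / δ) ∂μ :=
        mul_le_mul_of_nonneg_left (setIntegral_le_integral hlayer (ae_of_all _ hlayer0)) hη

theorem tendsto_setIntegral_ramp_mul_divergence (hU : IsOpen U) (hN : IsOpen N) (hK : IsCompact K)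
    (hKN : K ⊆ N) (hφ : ContinuousOn φ N) (hφU : ∀ x ∈ N, (x ∈ U ↔ φ x < 0))
    (hJ : IsAdmissibleField U K J) :
    Tendsto (fun δ => ∫ x in U, ramp (-φ x / δ) * divergence J x ∂μ) (𝓝[>] 0)
      (𝓝 (∫ x in U, divergence J x ∂μ)) := by
  refine tendsto_integral_filter_of_dominated_convergence (fun x => ‖divergence J x‖)
    (Eventually.of_forall fun δ => (continuousOn_ramp_mul_divergence hU hN hK.isClosed hKN hφ hJ
      δ).aestronglyMeasurable hU.measurableSet)
    (Eventually.of_forall fun δ => ae_of_all _ fun x => norm_ramp_mul_le _ _)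
    (hJ.integrableOn_divergence hU hK).norm
    (ae_restrict_of_forall_mem hU.measurableSet fun x hx => tendsto_const_nhds.congr' ?_)
  by_cases hxK : x ∈ K
  · have hneg : 0 < -φ x := neg_pos.2 ((hφU x (hKN hxK)).1 hx)
    filter_upwards [Ioo_mem_nhdsGT (half_pos hneg)] with δ hδ
    rw [ramp_eq_one, one_mul]
    rw [le_div_iff₀ hδ.1]
    linarith [hδ.2]
  · simp only [divergence_eq_zero (hJ.eventuallyEq_zero hU hK.isClosed ⟨hx, hxK⟩), mul_zero,
      EventuallyEq.rfl]

theorem setIntegral_divergence_nonpos_of_defining (hU : IsOpen U) (hN : IsOpen N)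
    (hK : IsCompact K) (hKN : K ⊆ N) (hφ : ContDiffOn ℝ 1 φ N)
    (hφU : ∀ x ∈ N, (x ∈ U ↔ φ x < 0)) {v : V} {c : ℝ} (hc0 : 0 < c)
    (hv : ∀ x ∈ N, c ≤ fderiv ℝ φ x v) (hJ : IsAdmissibleField U K J)
    (hflux : ∀ y ∈ K, φ y = 0 → FluxNonposAt U φ J y) :
    ∫ x in U, divergence J x ∂μ ≤ 0 := by
  obtain ⟨θ, hθ, hθ0, hθK, hθc, hθN⟩ := exists_contDiff_one_on_tsupport_subset hN hK hKN
  obtain ⟨M, hlayer⟩ := exists_integral_layer_le (μ := μ) hN hφ hθ hθ0 hθc hθN hc0 hv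
  have hle η (hη : 0 < η) : ∫ x in U, divergence J x ∂μ ≤ η * M := by
    refine le_of_tendsto
      (tendsto_setIntegral_ramp_mul_divergence hU hN hK hKN hφ.continuousOn hφU hJ) ?_
    filter_upwards [self_mem_nhdsWithin,
      eventually_forall_flux_le hN hK hKN hφ.continuousOn hφU hflux hη] with δ hδ hδη
    exact (setIntegral_ramp_mul_divergence_le hU hN hK hKN hφ hφU hJ hθ.continuous hθ0 hθK hθc hθN
      hδ hη.le hδη).trans (mul_le_mul_of_nonneg_left (hlayer δ hδ) hη.le)
  have hlim : Tendsto (fun η => η * M) (𝓝[>] 0) (𝓝 0) := by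
    simpa only [zero_mul] using
      ((continuous_mul_const M).tendsto 0).mono_left nhdsWithin_le_nhds
  exact ge_of_tendsto hlim (eventually_mem_nhdsWithin.mono hle)

theorem setIntegral_divergence_eq_zero_of_subset (hU : IsOpen U) (hK : IsCompact K) (hKU : K ⊆ U)
    (hJ : IsAdmissibleField U K J) : ∫ x in U, divergence J x ∂μ = 0 := by
  have hdiv x (hx : x ∈ U) : divergence J x = divergence (truncate U (fun _ => -2) 1 J) x := by
    rw [divergence_truncate hU hU hK.isClosed hKU contDiffOn_const hJ 1 hx, neg_neg, div_one,
      ramp_eq_one le_rfl, fderiv_fun_const, Pi.zero_apply, zero_apply, mul_zero, sub_zero, one_mul]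
  rw [setIntegral_congr_fun hU.measurableSet hdiv]
  exact setIntegral_divergence_truncate hU hU hK hKU contDiffOn_const
    (fun x hx => by simpa using hx) hJ one_pos

theorem exists_nhds_setIntegral_divergence_smul_nonpos (hU : IsOpen U) (hK : IsCompact K)
    (hJ : IsAdmissibleField U K J) {x : V}
    (hbd : x ∉ U → ∃ φ, ∃ N ∈ 𝓝 x, ContDiffOn ℝ 1 φ N ∧ (∀ y ∈ N, (y ∈ U ↔ φ y < 0)) ∧
      fderiv ℝ φ x ≠ 0 ∧ ∀ y ∈ N, y ∈ K → φ y = 0 → FluxNonposAt U φ J y) :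
    ∃ N, IsOpen N ∧ x ∈ N ∧ ∀ f : V → ℝ, ContDiff ℝ 1 f → (∀ y, f y ∈ Icc 0 1) →
      HasCompactSupport f → tsupport f ⊆ N →
      ∫ y in U, divergence (fun z => f z • J z) y ∂μ ≤ 0 := by
  by_cases hxU : x ∈ U
  · exact ⟨U, hU, hxU, fun f hf _ hc hfU =>
      (setIntegral_divergence_eq_zero_of_subset hU (hK.inter_right (isClosed_tsupport f))
        (inter_subset_right.trans hfU) (hJ.smul hU hf hc)).le⟩
  obtain ⟨φ, N₀, hN₀, hφ, hφU, hφ0, hflux⟩ := hbd hxU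
  obtain ⟨v, hv⟩ := ContinuousLinearMap.exists_ne_zero hφ0
  have hfd : ContinuousAt (fun y => fderiv ℝ φ y ((fderiv ℝ φ x v)⁻¹ • v)) x :=
    ((hφ.contDiffAt hN₀).fderiv_right (m := 0) (by simp)).continuousAt.clm_apply
      continuousAt_const
  have hslope : ∀ᶠ y in 𝓝 x, 1 / 2 < fderiv ℝ φ y ((fderiv ℝ φ x v)⁻¹ • v) :=
    hfd.eventually_const_lt (by
      simp only [map_smul, smul_eq_mul, inv_mul_cancel₀ hv, one_half_lt_one])
  obtain ⟨N, hNsub, hN, hxN⟩ := mem_nhds_iff.1 (inter_mem hN₀ hslope)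
  refine ⟨N, hN, hxN, fun f hf hfI hc hfN => ?_⟩
  exact setIntegral_divergence_nonpos_of_defining hU hN (hK.inter_right (isClosed_tsupport f))
    (inter_subset_right.trans hfN) (hφ.mono fun y hy => (hNsub hy).1)
    (fun y hy => hφU y (hNsub hy).1) one_half_pos (fun y hy => (hNsub hy).2.le) (hJ.smul hU hf hc)
    fun y hy hy0 => (hflux y (hNsub (hfN hy.2)).1 hy.1 hy0).smul hfI

/- Only a limiting sign condition on the flux is available at the boundary, so the usual divergence
theorem is replaced by truncation near the boundary and a partition of unity. -/
theorem setIntegral_divergence_nonpos (hU : IsOpen U) (hK : IsCompact K)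
    (hJ : IsAdmissibleField U K J)
    (hbd : ∀ x ∈ K \ U, ∃ φ, ∃ N ∈ 𝓝 x, ContDiffOn ℝ 1 φ N ∧ (∀ y ∈ N, (y ∈ U ↔ φ y < 0)) ∧
      fderiv ℝ φ x ≠ 0 ∧ ∀ y ∈ N, y ∈ K → φ y = 0 → FluxNonposAt U φ J y) :
    ∫ x in U, divergence J x ∂μ ≤ 0 := by
  choose! N hN hxN hle using fun x (hx : x ∈ K) =>
    exists_nhds_setIntegral_divergence_smul_nonpos (μ := μ) hU hK hJ fun hxU => hbd x ⟨hx, hxU⟩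
  obtain ⟨s, f, hf, hsum⟩ := exists_partition_of_unity_subordinate hK hN hxN
  have hsmul i := hJ.smul hU (hf i).1 (hf i).2.2.1
  have hdecomp x (hx : x ∈ U) : J x = ∑ i, f i x • J x := by
    by_cases hxK : x ∈ K
    · rw [← Finset.sum_smul, hsum x hxK, one_smul]
    · simp only [hJ.eq_zero x ⟨hx, hxK⟩, smul_zero, Finset.sum_const_zero]
  have hdiv x (hx : x ∈ U) :
      divergence J x = ∑ i, divergence (fun y => f i y • J y) x := by
    rw [divergence_congr (mem_of_superset (hU.mem_nhds hx) hdecomp), divergence_sum fun i _ =>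
      ((hsmul i).contDiffOn.contDiffAt (hU.mem_nhds hx)).differentiableAt one_ne_zero]
  rw [setIntegral_congr_fun hU.measurableSet hdiv, integral_finsetSum _ fun i _ =>
    (hsmul i).integrableOn_divergence hU (hK.inter_right (isClosed_tsupport _))]
  exact Finset.sum_nonpos fun i _ =>
    hle i (i : K).2 (f i) (hf i).1 (hf i).2.1 (hf i).2.2.1 (hf i).2.2.2

end BoundaryLayer

section Current

variable {V : Type*} [NormedAddCommGroup V] [NormedSpace ℝ V]
  {S : (V →L[ℝ] ℝ) →L[ℝ] V} {a b ψ κ u w : V → ℝ} {q : V}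

/-- `S`, a linear map from covectors to vectors, is symmetric, as the musical isomorphism of a
(possibly indefinite) metric is. -/
def IsSymmSharp (S : (V →L[ℝ] ℝ) →L[ℝ] V) : Prop := ∀ α β : V →L[ℝ] ℝ, α (S β) = β (S α)

/-- The gradient of `a` for the metric whose musical isomorphism from covectors to vectors
is `S`. -/
noncomputable def grad (S : (V →L[ℝ] ℝ) →L[ℝ] V) (a : V → ℝ) (q : V) : V := S (fderiv ℝ a q)

/-- The pairing `g(∇a, ∇b)` for the metric with musical isomorphism `S`. -/
noncomputable def gradPairing (S : (V →L[ℝ] ℝ) →L[ℝ] V) (a b : V → ℝ) (q : V) : ℝ :=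
  fderiv ℝ a q (grad S b q)

/-- The wave operator `div ∇a` for the metric with musical isomorphism `S`. -/
noncomputable def waveOp (S : (V →L[ℝ] ℝ) →L[ℝ] V) (a : V → ℝ) (q : V) : ℝ :=
  divergence (grad S a) q

/-- The quadratic form of the Hessian of `a` at `q`. -/
noncomputable def hessian (a : V → ℝ) (q v : V) : ℝ := fderiv ℝ (fderiv ℝ a) q v v

/-- The current of the multiplier `g(∇ψ, ∇w) + κ w` for the operator `□ + λ² g(∇ψ, ∇ψ)`. -/
noncomputable def current (S : (V →L[ℝ] ℝ) →L[ℝ] V) (ψ κ : V → ℝ) (lam : ℝ) (w : V → ℝ)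
    (q : V) : V :=
  (gradPairing S ψ w q + κ q * w q) • grad S w q
    + (2⁻¹ * (lam ^ 2 * (gradPairing S ψ ψ q * w q ^ 2) - gradPairing S w w q)) • grad S ψ q
    - (2⁻¹ * w q ^ 2) • grad S κ q

theorem gradPairing_comm (hS : IsSymmSharp S) (a b : V → ℝ) (q : V) :
    gradPairing S a b q = gradPairing S b a q :=
  hS _ _

theorem grad_congr (h : a =ᶠ[𝓝 q] b) : grad S a =ᶠ[𝓝 q] grad S b := by
  filter_upwards [h.eventuallyEq_nhds] with x hx
  rw [grad, grad, hx.fderiv_eq]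

theorem waveOp_congr (h : a =ᶠ[𝓝 q] b) : waveOp S a q = waveOp S b q :=
  divergence_congr (grad_congr h)

theorem grad_mul (ha : DifferentiableAt ℝ a q) (hb : DifferentiableAt ℝ b q) :
    grad S (fun x => a x * b x) q = a q • grad S b q + b q • grad S a q := by
  simp only [grad, fderiv_fun_mul ha hb, map_add, map_smul]

theorem fderiv_exp_mul (lam : ℝ) (hψ : DifferentiableAt ℝ ψ q) :
    fderiv ℝ (fun x => Real.exp (lam * ψ x)) q
      = (lam * Real.exp (lam * ψ q)) • fderiv ℝ ψ q := by
  rw [fderiv_exp (hψ.const_mul lam), fderiv_const_mul hψ, smul_smul, mul_comm]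

theorem grad_exp_mul (lam : ℝ) (hψ : DifferentiableAt ℝ ψ q) :
    grad S (fun x => Real.exp (lam * ψ x)) q = (lam * Real.exp (lam * ψ q)) • grad S ψ q := by
  rw [grad, fderiv_exp_mul lam hψ, map_smul, grad]

theorem differentiableAt_fderiv (ha : ContDiffAt ℝ 2 a q) : DifferentiableAt ℝ (fderiv ℝ a) q :=
  (ha.fderiv_right (m := 1) (by norm_num)).differentiableAt one_ne_zero

theorem differentiableAt_grad (ha : ContDiffAt ℝ 2 a q) : DifferentiableAt ℝ (grad S a) q :=
  S.differentiableAt.comp q (differentiableAt_fderiv ha)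

theorem fderiv_gradPairing (hS : IsSymmSharp S) (ha : ContDiffAt ℝ 2 a q)
    (hb : ContDiffAt ℝ 2 b q) (v : V) :
    fderiv ℝ (gradPairing S a b) q v = fderiv ℝ (fderiv ℝ a) q v (grad S b q)
      + fderiv ℝ (fderiv ℝ b) q v (grad S a q) := by
  have hgrad : fderiv ℝ (grad S b) q v = S (fderiv ℝ (fderiv ℝ b) q v) := by
    change fderiv ℝ (S ∘ fderiv ℝ b) q v = _
    rw [fderiv_comp q S.differentiableAt (differentiableAt_fderiv hb), S.fderiv]
    rfl
  change fderiv ℝ (fun x => fderiv ℝ a x (grad S b x)) q v = _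
  rw [fderiv_clm_apply (differentiableAt_fderiv ha) (differentiableAt_grad hb)]
  rw [add_apply, ContinuousLinearMap.comp_apply, ContinuousLinearMap.flip_apply, hgrad,
    hS (fderiv ℝ a q)]
  exact add_comm _ _

theorem differentiableAt_gradPairing (ha : ContDiffAt ℝ 2 a q) (hb : ContDiffAt ℝ 2 b q) :
    DifferentiableAt ℝ (gradPairing S a b) q :=
  (differentiableAt_fderiv ha).clm_apply (differentiableAt_grad hb)

theorem contDiffOn_grad {O : Set V} (hO : IsOpen O) {k l : WithTop ℕ∞} (ha : ContDiffOn ℝ l a O)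
    (hkl : k + 1 ≤ l) : ContDiffOn ℝ k (grad S a) O :=
  S.contDiff.comp_contDiffOn (ha.fderiv_of_isOpen hO hkl)

theorem contDiffOn_gradPairing {O : Set V} (hO : IsOpen O) {k l : WithTop ℕ∞}
    (ha : ContDiffOn ℝ l a O) (hb : ContDiffOn ℝ l b O) (hkl : k + 1 ≤ l) :
    ContDiffOn ℝ k (gradPairing S a b) O :=
  (ha.fderiv_of_isOpen hO hkl).clm_apply (contDiffOn_grad hO hb hkl)

theorem contDiffOn_waveOp [FiniteDimensional ℝ V] {O : Set V} (hO : IsOpen O)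
    {k l : WithTop ℕ∞} (ha : ContDiffOn ℝ l a O) (hkl : k + 1 + 1 ≤ l) :
    ContDiffOn ℝ k (waveOp S a) O :=
  (LinearMap.toContinuousLinearMap
    (LinearMap.trace ℝ V ∘ₗ ContinuousLinearMap.coeLM ℝ)).contDiff.comp_contDiffOn
    ((contDiffOn_grad hO ha hkl).fderiv_of_isOpen hO le_rfl)

theorem continuousOn_hessian {O : Set V} (hO : IsOpen O) (ha : ContDiffOn ℝ 2 a O) {X : Type*}
    [TopologicalSpace X] {A : Set X} {f v : X → V} (hf : ContinuousOn f A) (hfA : MapsTo f A O)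
    (hv : ContinuousOn v A) : ContinuousOn (fun x => hessian a (f x) (v x)) A := by
  have hfd : ContDiffOn ℝ 1 (fderiv ℝ a) O := ha.fderiv_of_isOpen hO (by norm_num)
  exact (((hfd.continuousOn_fderiv_of_isOpen hO le_rfl).comp hf hfA).clm_apply hv).clm_apply hv

theorem hessian_smul (a : V → ℝ) (q v : V) (t : ℝ) :
    hessian a q (t • v) = t ^ 2 * hessian a q v := by
  simp only [hessian, map_smul, smul_apply, smul_eq_mul]
  ring

theorem divergence_add {J J' : V → V} (hJ : DifferentiableAt ℝ J q)
    (hJ' : DifferentiableAt ℝ J' q) :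
    divergence (fun x => J x + J' x) q = divergence J q + divergence J' q := by
  simp only [divergence, fderiv_fun_add hJ hJ', ContinuousLinearMap.toLinearMap_add, map_add]

theorem divergence_sub {J J' : V → V} (hJ : DifferentiableAt ℝ J q)
    (hJ' : DifferentiableAt ℝ J' q) :
    divergence (fun x => J x - J' x) q = divergence J q - divergence J' q := by
  simp only [divergence, fderiv_fun_sub hJ hJ', ContinuousLinearMap.toLinearMap_sub, map_sub]

theorem waveOp_sub (ha : ContDiffAt ℝ 2 a q) (hb : ContDiffAt ℝ 2 b q) :
    waveOp S (fun x => a x - b x) q = waveOp S a q - waveOp S b q := by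
  have hgrad : grad S (fun x => a x - b x) =ᶠ[𝓝 q] fun x => grad S a x - grad S b x := by
    filter_upwards [ha.eventually (by simp), hb.eventually (by simp)] with x hax hbx
    rw [grad, fderiv_fun_sub (hax.differentiableAt two_ne_zero)
      (hbx.differentiableAt two_ne_zero), map_sub, grad, grad]
  rw [waveOp, divergence_congr hgrad,
    divergence_sub (differentiableAt_grad ha) (differentiableAt_grad hb), waveOp, waveOp]

theorem gradPairing_multiplier (hS : IsSymmSharp S) (hψ : ContDiffAt ℝ 2 ψ q)
    (hκ : DifferentiableAt ℝ κ q) (hw : ContDiffAt ℝ 2 w q) :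
    gradPairing S (fun x => gradPairing S ψ w x + κ x * w x) w q
      = hessian ψ q (grad S w q) + fderiv ℝ (fderiv ℝ w) q (grad S w q) (grad S ψ q)
        + κ q * gradPairing S w w q + w q * gradPairing S κ w q := by
  have dw := hw.differentiableAt two_ne_zero
  rw [gradPairing, fderiv_fun_add (differentiableAt_gradPairing hψ hw) (hκ.fun_mul dw),
    fderiv_fun_mul hκ dw]
  simp only [add_apply, smul_apply, smul_eq_mul, fderiv_gradPairing hS hψ hw, hessian,
    gradPairing]
  ring

theorem gradPairing_energy (hS : IsSymmSharp S) (lam : ℝ) (hψ : ContDiffAt ℝ 2 ψ q)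
    (hw : ContDiffAt ℝ 2 w q) :
    gradPairing S (fun x =>
        2⁻¹ * (lam ^ 2 * (gradPairing S ψ ψ x * w x ^ 2) - gradPairing S w w x)) ψ q
      = lam ^ 2 * (hessian ψ q (grad S ψ q) * w q ^ 2
          + gradPairing S ψ ψ q * w q * gradPairing S ψ w q)
        - fderiv ℝ (fderiv ℝ w) q (grad S ψ q) (grad S w q) := by
  have dw := hw.differentiableAt two_ne_zero
  have dw2 := dw.fun_pow 2
  have dψψ := differentiableAt_gradPairing (S := S) hψ hψ
  have dww := differentiableAt_gradPairing (S := S) hw hw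
  have dψψw := (dψψ.fun_mul dw2).const_mul (lam ^ 2)
  rw [gradPairing, fderiv_const_mul (dψψw.fun_sub dww), fderiv_fun_sub dψψw dww,
    fderiv_const_mul (dψψ.fun_mul dw2), fderiv_fun_mul dψψ dw2, fderiv_fun_pow 2 dw]
  simp only [add_apply, sub_apply, smul_apply, smul_eq_mul, fderiv_gradPairing hS hψ hψ,
    fderiv_gradPairing hS hw hw, gradPairing_comm hS ψ w, hessian]
  simp only [gradPairing]
  ring

theorem gradPairing_half_sq (hw : DifferentiableAt ℝ w q) :
    gradPairing S (fun x => 2⁻¹ * w x ^ 2) κ q = w q * gradPairing S w κ q := by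
  rw [gradPairing, fderiv_const_mul (hw.fun_pow 2), fderiv_fun_pow 2 hw]
  simp only [smul_apply, smul_eq_mul, gradPairing]
  ring

variable [FiniteDimensional ℝ V]

theorem divergence_smul_grad {f : V → ℝ} (hf : DifferentiableAt ℝ f q)
    (ha : ContDiffAt ℝ 2 a q) :
    divergence (fun x => f x • grad S a x) q = f q * waveOp S a q + gradPairing S f a q :=
  divergence_smul hf (differentiableAt_grad ha)

theorem waveOp_mul (hS : IsSymmSharp S) (ha : ContDiffAt ℝ 2 a q)
    (hb : ContDiffAt ℝ 2 b q) :
    waveOp S (fun x => a x * b x) q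
      = a q * waveOp S b q + 2 * gradPairing S a b q + b q * waveOp S a q := by
  have hgrad : grad S (fun x => a x * b x) =ᶠ[𝓝 q]
      fun x => a x • grad S b x + b x • grad S a x := by
    filter_upwards [ha.eventually (by simp), hb.eventually (by simp)] with x hax hbx
    exact grad_mul (hax.differentiableAt two_ne_zero) (hbx.differentiableAt two_ne_zero)
  have da := ha.differentiableAt two_ne_zero
  have db := hb.differentiableAt two_ne_zero
  rw [waveOp, divergence_congr hgrad, divergence_add (da.fun_smul (differentiableAt_grad hb))
    (db.fun_smul (differentiableAt_grad ha)), divergence_smul_grad da hb,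
    divergence_smul_grad db ha, gradPairing_comm hS b a]
  ring

theorem waveOp_exp_mul (lam : ℝ) (hψ : ContDiffAt ℝ 2 ψ q) :
    waveOp S (fun x => Real.exp (lam * ψ x)) q
      = lam * Real.exp (lam * ψ q) * (waveOp S ψ q + lam * gradPairing S ψ ψ q) := by
  have dψ := hψ.differentiableAt two_ne_zero
  have hgrad : grad S (fun x => Real.exp (lam * ψ x)) =ᶠ[𝓝 q]
      fun x => (lam * Real.exp (lam * ψ x)) • grad S ψ x := by
    filter_upwards [hψ.eventually (by simp)] with x hx
    exact grad_exp_mul lam (hx.differentiableAt two_ne_zero)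
  have dE : DifferentiableAt ℝ (fun x => Real.exp (lam * ψ x)) q := (dψ.const_mul lam).exp
  rw [waveOp, divergence_congr hgrad, divergence_smul_grad (dE.const_mul lam) hψ, gradPairing,
    fderiv_const_mul dE, fderiv_exp_mul lam dψ]
  simp only [smul_apply, smul_eq_mul, gradPairing]
  ring

theorem waveOp_conj (hS : IsSymmSharp S) (lam : ℝ) (hψ : ContDiffAt ℝ 2 ψ q)
    (hu : ContDiffAt ℝ 2 u q) :
    waveOp S (fun x => Real.exp (lam * ψ x) * u x) q
      = Real.exp (lam * ψ q) * waveOp S u q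
        + 2 * lam * gradPairing S ψ (fun x => Real.exp (lam * ψ x) * u x) q
        + (lam * waveOp S ψ q - lam ^ 2 * gradPairing S ψ ψ q)
          * (Real.exp (lam * ψ q) * u q) := by
  have dψ := hψ.differentiableAt two_ne_zero
  have hE : ContDiffAt ℝ 2 (fun x => Real.exp (lam * ψ x)) q := (contDiffAt_const.mul hψ).exp
  rw [waveOp_mul hS hE hu, waveOp_exp_mul lam hψ, gradPairing, fderiv_exp_mul lam dψ, gradPairing,
    gradPairing, grad_mul (hE.differentiableAt two_ne_zero) (hu.differentiableAt two_ne_zero),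
    grad_exp_mul lam dψ]
  simp only [map_add, map_smul, smul_apply, smul_eq_mul]
  ring

/- The second derivatives of `w` cancel by the symmetry of its Hessian; only those of `ψ`
survive. -/
theorem divergence_current (hS : IsSymmSharp S) (lam : ℝ) (hψ : ContDiffAt ℝ 2 ψ q)
    (hκ : ContDiffAt ℝ 2 κ q) (hw : ContDiffAt ℝ 2 w q) :
    divergence (current S ψ κ lam w) q
      = (waveOp S w q + lam ^ 2 * gradPairing S ψ ψ q * w q)
          * (gradPairing S ψ w q + κ q * w q)
        + hessian ψ q (grad S w q)
        - (waveOp S ψ q / 2 - κ q) * gradPairing S w w q - waveOp S κ q / 2 * w q ^ 2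
        + lam ^ 2 * (hessian ψ q (grad S ψ q)
          + (waveOp S ψ q / 2 - κ q) * gradPairing S ψ ψ q) * w q ^ 2 := by
  have dw := hw.differentiableAt two_ne_zero
  have dκ := hκ.differentiableAt two_ne_zero
  have hsymm : fderiv ℝ (fderiv ℝ w) q (grad S ψ q) (grad S w q)
      = fderiv ℝ (fderiv ℝ w) q (grad S w q) (grad S ψ q) :=
    (hw.isSymmSndFDerivAt (by simp)).eq _ _
  have d₁ := (differentiableAt_gradPairing (S := S) hψ hw).fun_add (dκ.fun_mul dw)
  have d₂ := ((((differentiableAt_gradPairing (S := S) hψ hψ).fun_mul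
    (dw.fun_pow 2)).const_mul (lam ^ 2)).fun_sub
      (differentiableAt_gradPairing (S := S) hw hw)).const_mul 2⁻¹
  have d₃ := (dw.fun_pow 2).const_mul 2⁻¹
  have e₁ := d₁.fun_smul (differentiableAt_grad (S := S) hw)
  have e₂ := d₂.fun_smul (differentiableAt_grad (S := S) hψ)
  unfold current
  rw [divergence_sub (e₁.fun_add e₂) (d₃.fun_smul (differentiableAt_grad hκ)),
    divergence_add e₁ e₂, divergence_smul_grad d₁ hw, divergence_smul_grad d₂ hψ,
    divergence_smul_grad d₃ hκ, gradPairing_multiplier hS hψ dκ hw,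
    gradPairing_energy hS lam hψ hw, gradPairing_half_sq dw, gradPairing_comm hS κ w, hsymm]
  ring

end Current

section Carleman

theorem exists_pos_le_of_isCompact {X : Type*} [TopologicalSpace X] {K : Set X} (hK : IsCompact K)
    {f : X → ℝ} (hf : ContinuousOn f K) (hpos : ∀ x ∈ K, 0 < f x) : ∃ c > 0, ∀ x ∈ K, c ≤ f x := by
  rcases K.eq_empty_or_nonempty with rfl | hne
  · exact ⟨1, one_pos, by simp⟩
  · obtain ⟨x, hx, hmin⟩ := hK.exists_isMinOn hne hf
    exact ⟨f x, hpos x hx, fun y hy => hmin hy⟩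

theorem exists_pos_le_add_mul {X : Type*} [TopologicalSpace X] [T2Space X] {K : Set X}
    (hK : IsCompact K) {f g : X → ℝ} (hf : ContinuousOn f K) (hg : ContinuousOn g K)
    (hg0 : ∀ x ∈ K, 0 ≤ g x) (hpos : ∀ x ∈ K, g x = 0 → 0 < f x) :
    ∃ c > 0, ∃ Λ ≥ 0, ∀ x ∈ K, c ≤ f x + Λ * g x := by
  obtain ⟨B, hB⟩ := hK.exists_bound_of_continuousOn hf
  have hR : IsCompact (K ∩ f ⁻¹' Iic 0) := hK.of_isClosed_subset
    (hf.preimage_isClosed_of_isClosed hK.isClosed isClosed_Iic) inter_subset_left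
  obtain ⟨b, hb, hbR⟩ := exists_pos_le_of_isCompact hR (hg.mono inter_subset_left)
    fun x hx => (hg0 x hx.1).lt_of_ne' fun h => (hpos x hx.1 h).not_ge hx.2
  have hΛ : 0 ≤ (|B| + 1) / b := by positivity
  obtain ⟨c, hc, hcK⟩ := exists_pos_le_of_isCompact hK
    (f := fun x => f x + (|B| + 1) / b * g x) (hf.add (continuousOn_const.mul hg)) fun x hx => by
      rcases le_or_gt (f x) 0 with hfx | hfx
      · have hfB : -|B| ≤ f x := (abs_le.1 ((hB x hx).trans (le_abs_self B))).1
        have hgb : |B| + 1 ≤ (|B| + 1) / b * g x := by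
          rw [div_mul_eq_mul_div, le_div_iff₀ hb]
          exact mul_le_mul_of_nonneg_left (hbR x ⟨hx, hfx⟩) (by positivity)
        linarith
      · have := mul_nonneg hΛ (hg0 x hx)
        linarith
  exact ⟨c, hc, _, hΛ, hcK⟩

theorem exists_quadratic_lower_bound {X W : Type*} [TopologicalSpace X] [T2Space X]
    [NormedAddCommGroup W] [NormedSpace ℝ W] [ProperSpace W] {K : Set X} (hK : IsCompact K)
    {Q l : X → W → ℝ} (hQc : ContinuousOn (fun z : X × W => Q z.1 z.2) (K ×ˢ univ))
    (hlc : ContinuousOn (fun z : X × W => l z.1 z.2) (K ×ˢ univ))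
    (hQ : ∀ x t y, Q x (t • y) = t ^ 2 * Q x y) (hl : ∀ x t y, l x (t • y) = t * l x y)
    (hpos : ∀ x ∈ K, ∀ y, y ≠ 0 → l x y = 0 → 0 < Q x y) :
    ∃ c > 0, ∃ Λ ≥ 0, ∀ x ∈ K, ∀ y, c * ‖y‖ ^ 2 ≤ Q x y + Λ * l x y ^ 2 := by
  have hsub : K ×ˢ Metric.sphere (0 : W) 1 ⊆ K ×ˢ univ := prod_mono_right (subset_univ _)
  obtain ⟨c, hc, Λ, hΛ, hcK⟩ := exists_pos_le_add_mul (hK.prod (isCompact_sphere (0 : W) 1))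
    (f := fun z => Q z.1 z.2) (g := fun z => l z.1 z.2 ^ 2) (hQc.mono hsub)
    ((hlc.mono hsub).pow 2) (fun _ _ => sq_nonneg _) fun z hz hlz =>
      hpos z.1 hz.1 z.2 (Metric.ne_of_mem_sphere hz.2 one_ne_zero)
        ((pow_eq_zero_iff two_ne_zero).1 hlz)
  refine ⟨c, hc, Λ, hΛ, fun x hx y => ?_⟩
  rcases eq_or_ne y 0 with rfl | hy
  · have hQ0 : Q x 0 = 0 := by simpa using hQ x 0 0
    have hl0 : l x 0 = 0 := by simpa using hl x 0 0
    simp [hQ0, hl0]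
  have hsphere : ‖y‖⁻¹ • y ∈ Metric.sphere (0 : W) 1 := by simp [norm_smul, hy]
  have hunit := hcK (x, ‖y‖⁻¹ • y) ⟨hx, hsphere⟩
  simp only [hQ, hl] at hunit
  calc c * ‖y‖ ^ 2 ≤ (‖y‖⁻¹ ^ 2 * Q x y + Λ * (‖y‖⁻¹ * l x y) ^ 2) * ‖y‖ ^ 2 := by gcongr
    _ = Q x y + Λ * l x y ^ 2 := by
      have := norm_ne_zero_iff.2 hy
      field_simp

variable {V : Type*} [NormedAddCommGroup V] [NormedSpace ℝ V]
  {S : (V →L[ℝ] ℝ) →L[ℝ] V} {O K : Set V} {ψ μ : V → ℝ}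

/-- `ψ` is strongly pseudoconvex on `K` for the metric with musical isomorphism `S`: up to the
multiple `μ` of the metric, its Hessian is positive on `∇ψ` and on the vectors tangent to its
level sets. -/
structure IsPseudoconvexOn (S : (V →L[ℝ] ℝ) →L[ℝ] V) (ψ μ : V → ℝ) (K : Set V) : Prop where
  normal_pos : ∀ q ∈ K, 0 < hessian ψ q (grad S ψ q) + μ q * gradPairing S ψ ψ q
  tangential_pos : ∀ q ∈ K, ∀ α : V →L[ℝ] ℝ, α ≠ 0 → fderiv ℝ ψ q (S α) = 0 →
    0 < hessian ψ q (S α) - μ q * α (S α)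

theorem IsPseudoconvexOn.exists_normal_lower_bound (h : IsPseudoconvexOn S ψ μ K) (hO : IsOpen O)
    (hK : IsCompact K) (hKO : K ⊆ O) (hψ : ContDiffOn ℝ 2 ψ O) (hμ : ContinuousOn μ O) :
    ∃ c > 0, ∀ q ∈ K, c ≤ hessian ψ q (grad S ψ q) + μ q * gradPairing S ψ ψ q :=
  exists_pos_le_of_isCompact hK
    ((continuousOn_hessian hO hψ continuousOn_id hKO
      ((contDiffOn_grad (k := 0) hO hψ (by norm_num)).continuousOn.mono hKO)).add
      ((hμ.mono hKO).mul
        ((contDiffOn_gradPairing (k := 0) hO hψ hψ (by norm_num)).continuousOn.mono hKO)))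
    h.normal_pos

theorem sq_exp_mul_norm_fderiv_le {u : V → ℝ} {q : V} (lam : ℝ) (hψ : DifferentiableAt ℝ ψ q)
    (hu : DifferentiableAt ℝ u q) :
    Real.exp (lam * ψ q) ^ 2 * ‖fderiv ℝ u q‖ ^ 2
      ≤ 2 * ‖fderiv ℝ (fun x => Real.exp (lam * ψ x) * u x) q‖ ^ 2
        + 2 * (lam ^ 2 * ‖fderiv ℝ ψ q‖ ^ 2 * (Real.exp (lam * ψ q) * u q) ^ 2) := by
  have hE : DifferentiableAt ℝ (fun x => Real.exp (lam * ψ x)) q := (hψ.const_mul lam).exp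
  have hdu : Real.exp (lam * ψ q) • fderiv ℝ u q
      = fderiv ℝ (fun x => Real.exp (lam * ψ x) * u x) q
        - (lam * (Real.exp (lam * ψ q) * u q)) • fderiv ℝ ψ q := by
    rw [fderiv_fun_mul hE hu, fderiv_exp_mul lam hψ]
    module
  have hnorm := norm_sub_le (fderiv ℝ (fun x => Real.exp (lam * ψ x) * u x) q)
    ((lam * (Real.exp (lam * ψ q) * u q)) • fderiv ℝ ψ q)
  rw [← hdu, norm_smul, norm_smul, Real.norm_eq_abs, Real.norm_eq_abs] at hnorm
  have hsq := (pow_le_pow_left₀ (by positivity) hnorm 2).trans (add_sq_le)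
  rw [mul_pow, mul_pow, sq_abs, sq_abs] at hsq
  linarith

variable [FiniteDimensional ℝ V]

theorem IsPseudoconvexOn.exists_tangential_lower_bound (h : IsPseudoconvexOn S ψ μ K)
    (hO : IsOpen O) (hK : IsCompact K) (hKO : K ⊆ O) (hψ : ContDiffOn ℝ 2 ψ O)
    (hμ : ContinuousOn μ O) :
    ∃ c > 0, ∃ Λ ≥ 0, ∀ q ∈ K, ∀ α : V →L[ℝ] ℝ,
      c * ‖α‖ ^ 2 ≤ hessian ψ q (S α) - μ q * α (S α) + Λ * fderiv ℝ ψ q (S α) ^ 2 := by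
  have hfst : ContinuousOn (fun z : V × (V →L[ℝ] ℝ) => z.1) (K ×ˢ univ) :=
    continuous_fst.continuousOn
  have hsnd : ContinuousOn (fun z : V × (V →L[ℝ] ℝ) => z.2) (K ×ˢ univ) :=
    continuous_snd.continuousOn
  have hmaps : MapsTo (fun z : V × (V →L[ℝ] ℝ) => z.1) (K ×ˢ univ) O := fun z hz => hKO hz.1
  have hSsnd := S.continuous.comp_continuousOn hsnd
  have hdψ := (hψ.continuousOn_fderiv_of_isOpen hO (by norm_num)).comp hfst hmaps
  refine exists_quadratic_lower_bound hK
    (Q := fun q α => hessian ψ q (S α) - μ q * α (S α)) (l := fun q α => fderiv ℝ ψ q (S α))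
    ((continuousOn_hessian hO hψ hfst hmaps hSsnd).sub
      ((hμ.comp hfst hmaps).mul (hsnd.clm_apply hSsnd)))
    (hdψ.clm_apply hSsnd) (fun q t α => ?_) (fun q t α => ?_) h.tangential_pos
  · simp only [map_smul, hessian_smul, smul_apply, smul_eq_mul]
    ring
  · simp only [map_smul, smul_eq_mul]

theorem mul_multiplier_lower_bound {lam P M μ C w : ℝ} (hlam : 0 < lam) (hμ : μ ^ 2 ≤ C) :
    lam * M ^ 2 - P ^ 2 / lam - 4 * lam * (C * w ^ 2) ≤ (P + 2 * lam * (M + μ * w)) * M := by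
  have hP : 0 ≤ (P / lam + M / 2) ^ 2 * lam := by positivity
  have hPexp : (P / lam + M / 2) ^ 2 * lam = P ^ 2 / lam + P * M + lam * M ^ 2 / 4 := by
    field_simp
    ring
  have hμw : μ ^ 2 * w ^ 2 ≤ C * w ^ 2 := mul_le_mul_of_nonneg_right hμ (sq_nonneg w)
  have hsq : 0 ≤ lam * (M / 2 + 2 * μ * w) ^ 2 := by positivity
  have hM : 0 ≤ lam * M ^ 2 := by positivity
  nlinarith [mul_le_mul_of_nonneg_left hμw hlam.le]

/-- The lower bound for the divergence of the current, as an inequality between numbers: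
`M` is the multiplier, `P` the conjugated operator applied to `w`, and `g = g(∇ψ, ∇w)`. -/
theorem carleman_algebra {c C Λ lam P M μ κ w s Q Z D g : ℝ} (hΛ : 0 ≤ Λ) (hlam1 : 1 ≤ lam)
    (hlamΛ : 2 * Λ ≤ lam) (hlamC : (4 + 2 * Λ + 1) * C ≤ lam * (c / 2)) (hC : 0 ≤ C)
    (hμ : μ ^ 2 ≤ C) (hκ : κ ^ 2 ≤ C) (hD : D ≤ C) (hZ : c ≤ Z) (hM : M = g + κ * w)
    (hQ : c * s ≤ Q + Λ * g ^ 2) :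
    c * s + lam ^ 2 * (c / 2) * w ^ 2 - P ^ 2 / lam
      ≤ (P + 2 * lam * (M + μ * w)) * M + Q - D * w ^ 2 + lam ^ 2 * Z * w ^ 2 := by
  have hlam : 0 < lam := by linarith
  have hw2 := sq_nonneg w
  have hPM := mul_multiplier_lower_bound (P := P) (M := M) (w := w) hlam hμ
  have hg : g ^ 2 ≤ 2 * M ^ 2 + 2 * (C * w ^ 2) := by
    have hκw : κ ^ 2 * w ^ 2 ≤ C * w ^ 2 := mul_le_mul_of_nonneg_right hκ hw2
    have hgM : g = M - κ * w := by linarith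
    rw [hgM]
    nlinarith [sq_nonneg (M + κ * w)]
  have hΛg : Λ * g ^ 2 ≤ Λ * (2 * M ^ 2 + 2 * (C * w ^ 2)) := mul_le_mul_of_nonneg_left hg hΛ
  have hΛM : 2 * Λ * M ^ 2 ≤ lam * M ^ 2 := mul_le_mul_of_nonneg_right hlamΛ (sq_nonneg M)
  have hDw : D * w ^ 2 ≤ C * w ^ 2 := mul_le_mul_of_nonneg_right hD hw2
  have hZw : lam ^ 2 * c * w ^ 2 ≤ lam ^ 2 * Z * w ^ 2 := by gcongr
  have hlow : 4 * lam * C + 2 * Λ * C + C ≤ lam ^ 2 * (c / 2) := by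
    nlinarith [mul_le_mul_of_nonneg_left hlamC hlam.le,
      mul_nonneg (sub_nonneg.2 hlam1) (by positivity : 0 ≤ 2 * Λ * C + C)]
  have hloww := mul_le_mul_of_nonneg_right hlow hw2
  linarith

theorem IsPseudoconvexOn.exists_divergence_current_ge (h : IsPseudoconvexOn S ψ μ K)
    (hS : IsSymmSharp S) (hO : IsOpen O) (hK : IsCompact K) (hKO : K ⊆ O)
    (hψ : ContDiffOn ℝ 4 ψ O) (hμ : ContDiffOn ℝ 2 μ O) :
    ∃ c > 0, ∃ lam₀ ≥ 1, ∀ lam ≥ lam₀, ∀ q ∈ K, ∀ w : V → ℝ, ContDiffAt ℝ 2 w q → ∀ P,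
      waveOp S w q = P + 2 * lam * gradPairing S ψ w q
        + (lam * waveOp S ψ q - lam ^ 2 * gradPairing S ψ ψ q) * w q →
      c * ‖fderiv ℝ w q‖ ^ 2 + lam ^ 2 * (c / 2) * w q ^ 2 - P ^ 2 / lam
        ≤ divergence (current S ψ (fun x => waveOp S ψ x / 2 - μ x) lam w) q := by
  have hψ2 : ContDiffOn ℝ 2 ψ O := hψ.of_le (by norm_num)
  set κ : V → ℝ := fun x => waveOp S ψ x / 2 - μ x with hκdef
  have hκ : ContDiffOn ℝ 2 κ O := ((contDiffOn_waveOp hO hψ (by norm_num)).div_const 2).sub hμ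
  have hκc := hκ.continuousOn.mono hKO
  have hμc := hμ.continuousOn.mono hKO
  have hDc := ((contDiffOn_waveOp (S := S) (k := 0) hO hκ (by norm_num)).continuousOn.mono
    hKO).div_const 2
  obtain ⟨c₁, hc₁, hcZ⟩ := h.exists_normal_lower_bound hO hK hKO hψ2 hμ.continuousOn
  obtain ⟨c₂, hc₂, Λ, hΛ, hcQ⟩ := h.exists_tangential_lower_bound hO hK hKO hψ2 hμ.continuousOn
  obtain ⟨C, hC⟩ := hK.exists_bound_of_continuousOn (((hμc.pow 2).prodMk (hκc.pow 2)).prodMk hDc)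
  have hc : 0 < min c₁ c₂ := lt_min hc₁ hc₂
  refine ⟨min c₁ c₂, hc, max 1 (max (2 * Λ) ((4 + 2 * Λ + 1) * C / (min c₁ c₂ / 2))),
    le_max_left _ _, fun lam hlam q hq w hw P hP => ?_⟩
  obtain ⟨hlam1, hlamΛ, hlamC⟩ := by simpa only [ge_iff_le, max_le_iff] using hlam
  obtain ⟨⟨hμC, hκC⟩, hDC⟩ := by simpa only [Prod.norm_def, max_le_iff] using hC q hq
  have hψq := hψ2.contDiffAt (hO.mem_nhds (hKO hq))
  have hκq := hκ.contDiffAt (hO.mem_nhds (hKO hq))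
  have hμκ : waveOp S ψ q / 2 = κ q + μ q := by simp [hκdef]
  have halg := carleman_algebra (P := P) (w := w q) (g := gradPairing S ψ w q) hΛ hlam1 hlamΛ
    ((div_le_iff₀ (by positivity)).1 hlamC) ((norm_nonneg _).trans hDC)
    ((le_abs_self _).trans hμC) ((le_abs_self _).trans hκC) ((le_abs_self _).trans hDC)
    ((min_le_left _ _).trans (hcZ q hq)) rfl
    ((mul_le_mul_of_nonneg_right (min_le_right _ _) (sq_nonneg _)).trans (hcQ q hq (fderiv ℝ w q)))
  rw [divergence_current hS lam hψq hκq hw, hP]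
  refine halg.trans_eq ?_
  rw [show waveOp S ψ q = 2 * (κ q + μ q) by linarith]
  simp only [gradPairing, grad]
  ring

theorem IsPseudoconvexOn.exists_carleman (h : IsPseudoconvexOn S ψ μ K) (hS : IsSymmSharp S)
    (hO : IsOpen O) (hK : IsCompact K) (hKO : K ⊆ O) (hψ : ContDiffOn ℝ 4 ψ O)
    (hμ : ContDiffOn ℝ 2 μ O) :
    ∃ c > 0, ∃ lam₀ ≥ 1, ∀ lam ≥ lam₀, ∀ q ∈ K, ∀ u : V → ℝ, ContDiffAt ℝ 2 u q →
      Real.exp (lam * ψ q) ^ 2 *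
          (c * (‖fderiv ℝ u q‖ ^ 2 + lam ^ 2 * u q ^ 2) - waveOp S u q ^ 2 / lam)
        ≤ divergence (current S ψ (fun x => waveOp S ψ x / 2 - μ x) lam
            (fun x => Real.exp (lam * ψ x) * u x)) q := by
  obtain ⟨c, hc, lam₀, hlam₀, hcur⟩ := h.exists_divergence_current_ge hS hO hK hKO hψ hμ
  obtain ⟨C, hC⟩ := hK.exists_bound_of_continuousOn
    ((hψ.continuousOn_fderiv_of_isOpen hO (by norm_num)).mono hKO)
  have hC1 : 0 < 2 * (2 * C ^ 2 + 1) := by positivity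
  refine ⟨c / (2 * (2 * C ^ 2 + 1)), by positivity, lam₀, hlam₀, fun lam hlam q hq u hu => ?_⟩
  have hψq : ContDiffAt ℝ 2 ψ q := (hψ.contDiffAt (hO.mem_nhds (hKO hq))).of_le (by norm_num)
  have hgrad := sq_exp_mul_norm_fderiv_le lam (hψq.differentiableAt two_ne_zero)
    (hu.differentiableAt two_ne_zero)
  refine le_trans ?_ (hcur lam hlam q hq _ ((contDiffAt_const.mul hψq).exp.mul hu) _
    (waveOp_conj hS lam hψq hu))
  set E := Real.exp (lam * ψ q)
  set s := ‖fderiv ℝ (fun x => Real.exp (lam * ψ x) * u x) q‖ ^ 2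
  have hs : 0 ≤ s := sq_nonneg _
  have hψC : lam ^ 2 * ‖fderiv ℝ ψ q‖ ^ 2 * (E * u q) ^ 2 ≤ lam ^ 2 * C ^ 2 * (E * u q) ^ 2 := by
    gcongr
    exact hC q hq
  have hmain : c / (2 * (2 * C ^ 2 + 1)) * (E ^ 2 * ‖fderiv ℝ u q‖ ^ 2 + lam ^ 2 * (E * u q) ^ 2)
      ≤ c * s + lam ^ 2 * (c / 2) * (E * u q) ^ 2 := by
    rw [div_mul_eq_mul_div, div_le_iff₀ hC1]
    nlinarith [mul_le_mul_of_nonneg_left (hgrad.trans (add_le_add_right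
      (mul_le_mul_of_nonneg_left hψC two_pos.le) _)) hc.le, mul_nonneg hc.le
      (mul_nonneg (sq_nonneg C) hs)]
  calc E ^ 2 * (c / (2 * (2 * C ^ 2 + 1)) * (‖fderiv ℝ u q‖ ^ 2 + lam ^ 2 * u q ^ 2)
        - waveOp S u q ^ 2 / lam)
      = c / (2 * (2 * C ^ 2 + 1)) * (E ^ 2 * ‖fderiv ℝ u q‖ ^ 2 + lam ^ 2 * (E * u q) ^ 2)
        - (E * waveOp S u q) ^ 2 / lam := by ring
    _ ≤ _ := sub_le_sub_right hmain _

end Carleman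

section Hessian

variable {V : Type*} [NormedAddCommGroup V] [NormedSpace ℝ V] {a b : V → ℝ} {q : V}

theorem hessian_eq_fderiv (ha : ContDiffAt ℝ 2 a q) {v : V}
    (h : (fun x => fderiv ℝ a x v) =ᶠ[𝓝 q] b) : hessian a q v = fderiv ℝ b q v := by
  rw [← h.fderiv_eq, fderiv_clm_apply (differentiableAt_fderiv ha) (differentiableAt_const v)]
  simp [hessian]

theorem hessian_congr (h : a =ᶠ[𝓝 q] b) : hessian a q = hessian b q := by
  funext v
  rw [hessian, hessian, h.fderiv.fderiv_eq]

theorem hessian_mul (ha : ContDiffAt ℝ 2 a q) (hb : ContDiffAt ℝ 2 b q) (v : V) :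
    hessian (fun x => a x * b x) q v
      = a q * hessian b q v + 2 * (fderiv ℝ a q v * fderiv ℝ b q v) + b q * hessian a q v := by
  have da := ha.differentiableAt two_ne_zero
  have db := hb.differentiableAt two_ne_zero
  have da' : DifferentiableAt ℝ (fun x => fderiv ℝ a x v) q :=
    (differentiableAt_fderiv ha).clm_apply (differentiableAt_const v)
  have db' : DifferentiableAt ℝ (fun x => fderiv ℝ b x v) q :=
    (differentiableAt_fderiv hb).clm_apply (differentiableAt_const v)
  have h : (fun x => fderiv ℝ (fun x => a x * b x) x v)
      =ᶠ[𝓝 q] fun x => a x * fderiv ℝ b x v + b x * fderiv ℝ a x v := by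
    filter_upwards [ha.eventually (by simp), hb.eventually (by simp)] with x hax hbx
    rw [fderiv_fun_mul (hax.differentiableAt two_ne_zero) (hbx.differentiableAt two_ne_zero)]
    rfl
  rw [hessian_eq_fderiv (ha.mul hb) h, fderiv_fun_add (da.fun_mul db') (db.fun_mul da'),
    fderiv_fun_mul da db', fderiv_fun_mul db da', hessian_eq_fderiv ha .rfl,
    hessian_eq_fderiv hb .rfl]
  simp only [add_apply, smul_apply, smul_eq_mul]
  ring

theorem hessian_const_sub (c : ℝ) (a : V → ℝ) (q v : V) :
    hessian (fun x => c - a x) q v = -hessian a q v := by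
  have h : fderiv ℝ (fun x => c - a x) = -fderiv ℝ a := funext fun x => fderiv_const_sub c
  rw [hessian, h, fderiv_neg]
  rfl

theorem hessian_const_mul (c : ℝ) (ha : ContDiffAt ℝ 2 a q) (v : V) :
    hessian (fun x => c * a x) q v = c * hessian a q v := by
  simpa [hessian] using hessian_mul (contDiffAt_const (c := c)) ha v

theorem hessian_exp_mul (τ : ℝ) (ha : ContDiffAt ℝ 2 a q) (v : V) :
    hessian (fun x => Real.exp (τ * a x)) q v
      = τ * Real.exp (τ * a q) * (hessian a q v + τ * fderiv ℝ a q v ^ 2) := by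
  have hexp : ContDiffAt ℝ 2 (fun x => Real.exp (τ * a x)) q := (contDiffAt_const.mul ha).exp
  have da := ha.differentiableAt two_ne_zero
  have da' : DifferentiableAt ℝ (fun x => fderiv ℝ a x v) q :=
    (differentiableAt_fderiv ha).clm_apply (differentiableAt_const v)
  have h : (fun x => fderiv ℝ (fun x => Real.exp (τ * a x)) x v)
      =ᶠ[𝓝 q] fun x => τ * Real.exp (τ * a x) * fderiv ℝ a x v := by
    filter_upwards [ha.eventually (by simp)] with x hx
    rw [fderiv_exp_mul τ (hx.differentiableAt two_ne_zero)]
    rfl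
  have dexp := hexp.differentiableAt two_ne_zero
  rw [hessian_eq_fderiv hexp h, fderiv_fun_mul (dexp.const_mul τ) da', fderiv_const_mul dexp,
    fderiv_exp_mul τ da, hessian_eq_fderiv ha .rfl]
  simp only [add_apply, smul_apply, smul_eq_mul]
  ring

theorem hessian_comp {F : Type*} [NormedAddCommGroup F] [NormedSpace ℝ F] {A : F →L[ℝ] V}
    {h : F → V} {x : F} (hh : ∀ x, HasFDerivAt h A x) (ha : ContDiffAt ℝ 2 a (h x)) (v : F) :
    hessian (fun y => a (h y)) x v = hessian a (h x) (A v) := by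
  have hfd : fderiv ℝ (fun y => a (h y)) =ᶠ[𝓝 x] fun y => (fderiv ℝ a (h y)).comp A := by
    filter_upwards [(hh x).continuousAt.eventually (ha.eventually (by simp))] with y hy
    exact ((hy.differentiableAt two_ne_zero).hasFDerivAt.comp y (hh y)).fderiv
  have hcomp := ((differentiableAt_fderiv ha).hasFDerivAt.comp x (hh x)).clm_comp
    (hasFDerivAt_const A x)
  simp [hessian, (hcomp.congr_of_eventuallyEq hfd).fderiv]

end Hessian

section Minkowski

variable {m n : ℕ}

/-- The map from covectors to vectors of the metric `-|dt|² + |dx|²` of signature `(m, n)`. -/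
noncomputable def minkowskiSharp (m n : ℕ) : (ST m n →L[ℝ] ℝ) →L[ℝ] ST m n :=
  LinearMap.toContinuousLinearMap
    { toFun := fun α =>
        (-(InnerProductSpace.toDual ℝ (E m)).symm (α.comp (.inl ℝ (E m) (E n))),
          (InnerProductSpace.toDual ℝ (E n)).symm (α.comp (.inr ℝ (E m) (E n))))
      map_add' := fun α β => by
        simp only [ContinuousLinearMap.add_comp, map_add, neg_add, Prod.mk_add_mk]
      map_smul' := fun c α => by
        simp [ContinuousLinearMap.smul_comp] }

theorem apply_eq_minkowski_inner (α : ST m n →L[ℝ] ℝ) (w : ST m n) :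
    α w = inner ℝ (minkowskiSharp m n α).2 w.2 - inner ℝ (minkowskiSharp m n α).1 w.1 := by
  have hw : w = (w.1, 0) + (0, w.2) := by simp
  conv_lhs => rw [hw, map_add]
  simp [minkowskiSharp, add_comm]

theorem isSymmSharp_minkowskiSharp : IsSymmSharp (minkowskiSharp m n) := fun α β => by
  rw [apply_eq_minkowski_inner α, apply_eq_minkowski_inner β, real_inner_comm,
    real_inner_comm (minkowskiSharp m n α).1]

theorem laplacian_eq_sum_hessian {k : ℕ} (g : E k → ℝ) (x : E k) :
    Laplacian.laplacian g x = ∑ i, hessian g x (EuclideanSpace.basisFun (Fin k) ℝ i) := by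
  rw [InnerProductSpace.laplacian_eq_iteratedFDeriv_orthonormalBasis g
    (EuclideanSpace.basisFun (Fin k) ℝ)]
  exact Finset.sum_congr rfl fun i _ => iteratedFDeriv_two_apply ..

theorem toDual_symm_apply_coord {k : ℕ} (β : E k →L[ℝ] ℝ) (i : Fin k) :
    (InnerProductSpace.toDual ℝ (E k)).symm β i = β (EuclideanSpace.single i 1) := by
  rw [← InnerProductSpace.toDual_symm_apply, EuclideanSpace.inner_single_right]
  simp

theorem box_eq_waveOp {z : ST m n → ℝ} {q : ST m n} (hz : ContDiffAt ℝ 2 z q) :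
    box z q = waveOp (minkowskiSharp m n) z q := by
  let bm := EuclideanSpace.basisFun (Fin m) ℝ
  let bn := EuclideanSpace.basisFun (Fin n) ℝ
  have hgrad : fderiv ℝ (grad (minkowskiSharp m n) z) q
      = (minkowskiSharp m n).comp (fderiv ℝ (fderiv ℝ z) q) :=
    ((minkowskiSharp m n).hasFDerivAt.comp q (differentiableAt_fderiv hz).hasFDerivAt).fderiv
  rw [box, laplacian_eq_sum_hessian, laplacian_eq_sum_hessian, waveOp, divergence, hgrad,
    LinearMap.trace_eq_matrix_trace ℝ (bm.toBasis.prod bn.toBasis), Matrix.trace,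
    Fintype.sum_sum_type, ← Finset.sum_neg_distrib]
  congr 1 <;> refine Finset.sum_congr rfl fun i _ => ?_
  · rw [hessian_comp (fun t => hasFDerivAt_prodMk_left t q.2) hz]
    simp [LinearMap.toMatrix_apply, minkowskiSharp, hessian, bm, toDual_symm_apply_coord]
  · rw [hessian_comp (fun x => hasFDerivAt_prodMk_right q.1 x) hz]
    simp [LinearMap.toMatrix_apply, minkowskiSharp, hessian, bn, toDual_symm_apply_coord]

end Minkowski

section Weight

variable {m n : ℕ} {ε : ℝ} {p q : ST m n}

/-- The function `f_p / (1 - ε r_p)`, whose positive level sets are pseudoconvex. -/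
noncomputable def kp (ε : ℝ) (p q : ST m n) : ℝ := fp p q / (1 - ε * rp p q)

/-- The open region `{0 < r_p < 1 / ε}` on which `kp ε p` is smooth. -/
def regular (ε : ℝ) (p : ST m n) : Set (ST m n) := {q | 0 < rp p q ∧ ε * rp p q < 1}

theorem continuous_rp (p : ST m n) : Continuous (rp p) := by
  unfold rp
  fun_prop

theorem contDiff_fp (p : ST m n) : ContDiff ℝ ∞ (fp p) :=
  (((contDiff_snd.sub contDiff_const).norm_sq ℝ).sub
    ((contDiff_fst.sub contDiff_const).norm_sq ℝ)).div_const 4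

theorem isOpen_regular (ε : ℝ) (p : ST m n) : IsOpen (regular ε p) :=
  (isOpen_lt continuous_const (continuous_rp p)).inter
    (isOpen_lt (continuous_const.mul (continuous_rp p)) continuous_const)

theorem contDiffOn_rp (ε : ℝ) (p : ST m n) : ContDiffOn ℝ ∞ (rp p) (regular ε p) := fun _ hq =>
  ((contDiffAt_snd.sub (contDiffAt_const (c := p.2))).norm ℝ
    (norm_pos_iff.1 hq.1)).contDiffWithinAt

theorem contDiffOn_kp (ε : ℝ) (p : ST m n) : ContDiffOn ℝ ∞ (kp ε p) (regular ε p) :=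
  (contDiff_fp p).contDiffOn.div (contDiffOn_const.sub (contDiffOn_const.mul (contDiffOn_rp ε p)))
    fun _ hq => (sub_pos.2 hq.2).ne'

theorem contDiffAt_rp (hq : q ∈ regular ε p) : ContDiffAt ℝ ∞ (rp p) q :=
  (contDiffOn_rp ε p).contDiffAt ((isOpen_regular ε p).mem_nhds hq)

theorem contDiffAt_kp (hq : q ∈ regular ε p) : ContDiffAt ℝ ∞ (kp ε p) q :=
  (contDiffOn_kp ε p).contDiffAt ((isOpen_regular ε p).mem_nhds hq)

theorem kp_mul (hq : q ∈ regular ε p) : (1 - ε * rp p q) * kp ε p q = fp p q :=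
  mul_div_cancel₀ _ (sub_pos.2 hq.2).ne'

theorem kp_mul_eventuallyEq (hq : q ∈ regular ε p) :
    (fun x => (1 - ε * rp p x) * kp ε p x) =ᶠ[𝓝 q] fp p := by
  filter_upwards [(isOpen_regular ε p).mem_nhds hq] with x hx using kp_mul hx

theorem kp_pos (hq : q ∈ regular ε p) (hf : 0 < fp p q) : 0 < kp ε p q :=
  div_pos hf (sub_pos.2 hq.2)

theorem hasFDerivAt_norm_sq_comp_sub {V F : Type*} [NormedAddCommGroup V] [NormedSpace ℝ V]
    [NormedAddCommGroup F] [InnerProductSpace ℝ F] (L : V →L[ℝ] F) (c : F) (x : V) :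
    HasFDerivAt (fun x => ‖L x - c‖ ^ 2) (2 • (innerSL ℝ (L x - c)).comp L) x :=
  (L.hasFDerivAt.sub_const c).norm_sq

theorem hasFDerivAt_inner_comp_sub {V F : Type*} [NormedAddCommGroup V] [NormedSpace ℝ V]
    [NormedAddCommGroup F] [InnerProductSpace ℝ F] (L : V →L[ℝ] F) (c w : F) (x : V) :
    HasFDerivAt (fun x => inner ℝ (L x - c) w) ((innerSL ℝ w).comp L) x := by
  simp_rw [fun x => real_inner_comm w (L x - c)]
  exact (innerSL ℝ w).hasFDerivAt.comp x (L.hasFDerivAt.sub_const c)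

theorem fderiv_fp (p q v : ST m n) :
    fderiv ℝ (fp p) q v = (inner ℝ (q.2 - p.2) v.2 - inner ℝ (q.1 - p.1) v.1) / 2 := by
  have h : HasFDerivAt (fp p) _ q :=
    ((hasFDerivAt_norm_sq_comp_sub (.snd ℝ (E m) (E n)) p.2 q).sub
      (hasFDerivAt_norm_sq_comp_sub (.fst ℝ (E m) (E n)) p.1 q)).mul_const (4 : ℝ)⁻¹
  rw [h.fderiv]
  simp only [ContinuousLinearMap.coe_snd', ContinuousLinearMap.coe_fst', smul_apply, sub_apply,
    ContinuousLinearMap.comp_apply, coe_innerSL_apply, nsmul_eq_mul, Nat.cast_ofNat, smul_eq_mul]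
  ring

theorem hessian_fp (p q v : ST m n) : hessian (fp p) q v = (‖v.2‖ ^ 2 - ‖v.1‖ ^ 2) / 2 := by
  have h : HasFDerivAt
      (fun x : ST m n => (inner ℝ (x.2 - p.2) v.2 - inner ℝ (x.1 - p.1) v.1) / 2) _ q :=
    ((hasFDerivAt_inner_comp_sub (.snd ℝ (E m) (E n)) p.2 v.2 q).sub
      (hasFDerivAt_inner_comp_sub (.fst ℝ (E m) (E n)) p.1 v.1 q)).mul_const (2 : ℝ)⁻¹
  rw [hessian_eq_fderiv ((contDiff_fp p).contDiffAt.of_le (by norm_cast))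
    (Eventually.of_forall fun x => fderiv_fp p x v), h.fderiv]
  simp only [smul_apply, sub_apply, ContinuousLinearMap.comp_apply, ContinuousLinearMap.coe_snd',
    coe_innerSL_apply, inner_self_eq_norm_sq_to_K, Real.ringHom_apply,
    ContinuousLinearMap.coe_fst', smul_eq_mul]
  ring

theorem rp_mul_fderiv_rp (hq : q ∈ regular ε p) (v : ST m n) :
    rp p q * fderiv ℝ (rp p) q v = inner ℝ (q.2 - p.2) v.2 := by
  have hsq : fderiv ℝ (fun x => rp p x ^ 2) q v = 2 * inner ℝ (q.2 - p.2) v.2 := by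
    have h : HasFDerivAt (fun x => rp p x ^ 2) _ q :=
      hasFDerivAt_norm_sq_comp_sub (.snd ℝ (E m) (E n)) p.2 q
    rw [h.fderiv]
    simp [-map_sub]
  rw [fderiv_fun_pow 2 ((contDiffAt_rp hq).differentiableAt (by simp))] at hsq
  simp only [smul_apply, smul_eq_mul] at hsq
  norm_num at hsq
  linarith

theorem rp_mul_hessian_rp (hq : q ∈ regular ε p) (v : ST m n) :
    rp p q * hessian (rp p) q v = ‖v.2‖ ^ 2 - fderiv ℝ (rp p) q v ^ 2 := by
  have hr := (contDiffAt_rp hq).of_le (m := 2) (by norm_cast)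
  have hmul : (fun x => rp p x * fderiv ℝ (rp p) x v)
      =ᶠ[𝓝 q] fun x => inner ℝ (x.2 - p.2) v.2 := by
    filter_upwards [(isOpen_regular ε p).mem_nhds hq] with x hx using rp_mul_fderiv_rp hx v
  have hinner : HasFDerivAt (fun x : ST m n => inner ℝ (x.2 - p.2) v.2) _ q :=
    hasFDerivAt_inner_comp_sub (.snd ℝ (E m) (E n)) p.2 v.2 q
  have hd : fderiv ℝ (fun x => rp p x * fderiv ℝ (rp p) x v) q v = ‖v.2‖ ^ 2 := by
    rw [hmul.fderiv_eq, hinner.fderiv]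
    simp
  rw [fderiv_fun_mul (hr.differentiableAt two_ne_zero)
    ((differentiableAt_fderiv hr).clm_apply (differentiableAt_const v))] at hd
  simp only [add_apply, smul_apply, smul_eq_mul, ← hessian_eq_fderiv hr .rfl] at hd
  linarith

theorem fderiv_kp (hq : q ∈ regular ε p) (v : ST m n) :
    (1 - ε * rp p q) * fderiv ℝ (kp ε p) q v
      = fderiv ℝ (fp p) q v + ε * kp ε p q * fderiv ℝ (rp p) q v := by
  have dr := (contDiffAt_rp hq).differentiableAt (by simp)
  rw [← (kp_mul_eventuallyEq hq).fderiv_eq,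
    fderiv_fun_mul (by fun_prop) ((contDiffAt_kp hq).differentiableAt (by simp)),
    fderiv_const_sub, fderiv_const_mul dr]
  simp only [smul_neg, add_apply, smul_apply, smul_eq_mul, neg_apply]
  ring

theorem hessian_kp (hq : q ∈ regular ε p) (v : ST m n) :
    (1 - ε * rp p q) * hessian (kp ε p) q v
      = hessian (fp p) q v + ε * kp ε p q * hessian (rp p) q v
        + 2 * ε * (fderiv ℝ (kp ε p) q v * fderiv ℝ (rp p) q v) := by
  have hr := (contDiffAt_rp hq).of_le (m := 2) (by norm_cast)
  have hk := (contDiffAt_kp hq).of_le (m := 2) (by norm_cast)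
  have hmul : ContDiffAt ℝ 2 (fun x => ε * rp p x) q := contDiffAt_const.mul hr
  have dr := hr.differentiableAt two_ne_zero
  rw [← hessian_congr (kp_mul_eventuallyEq hq), hessian_mul (contDiffAt_const.sub hmul) hk,
    hessian_const_sub, hessian_const_mul ε hr, fderiv_const_sub, fderiv_const_mul dr]
  simp only [neg_apply, smul_apply, smul_eq_mul, neg_mul, mul_neg]
  ring

end Weight

section Pseudoconvexity

variable {m n : ℕ} {ε δ : ℝ} {p q : ST m n}

theorem minkowskiSharp_eq {α : ST m n →L[ℝ] ℝ} {u : ST m n}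
    (h : ∀ w, α w = inner ℝ u.2 w.2 - inner ℝ u.1 w.1) : minkowskiSharp m n α = u := by
  have hw : ∀ w : ST m n, inner ℝ ((minkowskiSharp m n α).2 - u.2) w.2
      = inner ℝ ((minkowskiSharp m n α).1 - u.1) w.1 := fun w => by
    rw [inner_sub_left, inner_sub_left]
    linarith [h w, apply_eq_minkowski_inner α w]
  refine Prod.ext (sub_eq_zero.1 ?_) (sub_eq_zero.1 ?_)
  · rw [← inner_self_eq_zero (𝕜 := ℝ), ← hw (_, 0), inner_zero_right]
  · rw [← inner_self_eq_zero (𝕜 := ℝ), hw (0, _), inner_zero_right]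

theorem apply_minkowskiSharp_self (α : ST m n →L[ℝ] ℝ) :
    α (minkowskiSharp m n α)
      = ‖(minkowskiSharp m n α).2‖ ^ 2 - ‖(minkowskiSharp m n α).1‖ ^ 2 := by
  rw [apply_eq_minkowski_inner, real_inner_self_eq_norm_sq, real_inner_self_eq_norm_sq]

theorem minkowskiSharp_ne_zero {α : ST m n →L[ℝ] ℝ} (hα : α ≠ 0) : minkowskiSharp m n α ≠ 0 :=
  fun h => hα (by ext w <;> simp [apply_eq_minkowski_inner α, h])

theorem grad_fp (p q : ST m n) : grad (minkowskiSharp m n) (fp p) q = (2⁻¹ : ℝ) • (q - p) :=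
  minkowskiSharp_eq fun w => by
    simp only [fderiv_fp, Prod.smul_fst, Prod.smul_snd, Prod.fst_sub, Prod.snd_sub,
      real_inner_smul_left]
    ring

theorem grad_rp (hq : q ∈ regular ε p) :
    grad (minkowskiSharp m n) (rp p) q = (0, (rp p q)⁻¹ • (q.2 - p.2)) :=
  minkowskiSharp_eq fun w => by
    rw [real_inner_smul_left, ← rp_mul_fderiv_rp hq, inv_mul_cancel_left₀ hq.1.ne',
      inner_zero_left, sub_zero]

theorem gradPairing_kp_self (hq : q ∈ regular ε p) :
    (1 - ε * rp p q) ^ 2 * gradPairing (minkowskiSharp m n) (kp ε p) (kp ε p) q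
      = fp p q + ε * kp ε p q * rp p q + (ε * kp ε p q) ^ 2 := by
  have hr := hq.1.ne'
  have hdk : (1 - ε * rp p q) • fderiv ℝ (kp ε p) q
      = fderiv ℝ (fp p) q + (ε * kp ε p q) • fderiv ℝ (rp p) q :=
    ContinuousLinearMap.ext fun v => fderiv_kp hq v
  have hgk : (1 - ε * rp p q) • grad (minkowskiSharp m n) (kp ε p) q
      = (2⁻¹ : ℝ) • (q - p) + (ε * kp ε p q) • (0, (rp p q)⁻¹ • (q.2 - p.2)) := by
    rw [← grad_fp, ← grad_rp hq, grad, grad, grad, ← map_smul, hdk, map_add, map_smul]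
  have hff : fderiv ℝ (fp p) q (q - p) = 2 * fp p q := by
    simp only [fderiv_fp, Prod.fst_sub, Prod.snd_sub, real_inner_self_eq_norm_sq, fp]
    ring
  have hfr : fderiv ℝ (fp p) q (0, q.2 - p.2) = rp p q ^ 2 / 2 := by
    simp only [fderiv_fp, inner_zero_right, real_inner_self_eq_norm_sq, rp, sub_zero]
  have hrf : fderiv ℝ (rp p) q (q - p) = rp p q := mul_left_cancel₀ hr <| by
    rw [rp_mul_fderiv_rp hq, Prod.snd_sub, real_inner_self_eq_norm_sq, rp, sq]
  have hrr : fderiv ℝ (rp p) q (0, q.2 - p.2) = rp p q := mul_left_cancel₀ hr <| by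
    rw [rp_mul_fderiv_rp hq, real_inner_self_eq_norm_sq, rp, sq]
  have hsmul : ((0 : E m), (rp p q)⁻¹ • (q.2 - p.2)) = (rp p q)⁻¹ • (0, q.2 - p.2) := by simp
  calc (1 - ε * rp p q) ^ 2 * gradPairing (minkowskiSharp m n) (kp ε p) (kp ε p) q
      = ((1 - ε * rp p q) • fderiv ℝ (kp ε p) q)
          ((1 - ε * rp p q) • grad (minkowskiSharp m n) (kp ε p) q) := by
        simp only [gradPairing, map_smul, smul_apply, smul_eq_mul]
        ring
    _ = _ := by
        rw [hdk, hgk, hsmul]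
        simp only [map_add, map_smul, add_apply, smul_apply, smul_eq_mul, hff, hfr, hrf, hrr]
        field_simp
        ring

theorem gradPairing_kp_self_pos (hε : 0 < ε) (hq : q ∈ regular ε p) (hf : 0 < fp p q) :
    0 < gradPairing (minkowskiSharp m n) (kp ε p) (kp ε p) q := by
  have hk := kp_pos hq hf
  have hr := hq.1
  refine pos_of_mul_pos_right ?_ (sq_nonneg (1 - ε * rp p q))
  rw [gradPairing_kp_self hq]
  positivity

theorem fderiv_rp_sq_le (hq : q ∈ regular ε p) (v : ST m n) :
    fderiv ℝ (rp p) q v ^ 2 ≤ ‖v.2‖ ^ 2 := by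
  refine sq_le_sq.2 ?_
  rw [abs_norm]
  refine le_of_mul_le_mul_left ?_ hq.1
  calc rp p q * |fderiv ℝ (rp p) q v| = |inner ℝ (q.2 - p.2) v.2| := by
        rw [← rp_mul_fderiv_rp hq, abs_mul, abs_of_pos hq.1]
    _ ≤ rp p q * ‖v.2‖ := abs_real_inner_le_norm _ _

theorem inner_time_eq_of_fderiv_kp_eq_zero (hq : q ∈ regular ε p) {v : ST m n}
    (hv : fderiv ℝ (kp ε p) q v = 0) :
    inner ℝ (q.1 - p.1) v.1 = (rp p q + 2 * (ε * kp ε p q)) * fderiv ℝ (rp p) q v := by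
  have h := fderiv_kp hq v
  rw [hv, fderiv_fp, ← rp_mul_fderiv_rp hq] at h
  linarith

theorem norm_time_lt_rp (hf : 0 < fp p q) : ‖q.1 - p.1‖ < rp p q := by
  refine lt_of_pow_lt_pow_left₀ 2 (norm_nonneg _) ?_
  have : 0 < (rp p q ^ 2 - ‖q.1 - p.1‖ ^ 2) / 4 := hf
  linarith

theorem abs_fderiv_rp_lt_of_tangent (hε : 0 < ε) (hq : q ∈ regular ε p) (hf : 0 < fp p q)
    {v : ST m n} (hv : fderiv ℝ (kp ε p) q v = 0) (hv₁ : v.1 ≠ 0) :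
    |fderiv ℝ (rp p) q v| < ‖v.1‖ := by
  have hk := mul_pos hε (kp_pos hq hf)
  refine lt_of_mul_lt_mul_left ?_ hq.1.le
  calc rp p q * |fderiv ℝ (rp p) q v|
      ≤ (rp p q + 2 * (ε * kp ε p q)) * |fderiv ℝ (rp p) q v| := by gcongr; linarith
    _ = |inner ℝ (q.1 - p.1) v.1| := by
        rw [inner_time_eq_of_fderiv_kp_eq_zero hq hv, abs_mul,
          abs_of_pos (add_pos hq.1 (mul_pos two_pos hk))]
    _ ≤ ‖q.1 - p.1‖ * ‖v.1‖ := abs_real_inner_le_norm _ _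
    _ < rp p q * ‖v.1‖ := by
        gcongr
        exact norm_time_lt_rp hf

theorem hessian_kp_of_tangent (hq : q ∈ regular ε p) {v : ST m n}
    (hv : fderiv ℝ (kp ε p) q v = 0) (δ : ℝ) :
    (1 - ε * rp p q) * hessian (kp ε p) q v
      = (1 / 2 + δ) * (‖v.2‖ ^ 2 - ‖v.1‖ ^ 2)
        + ((ε * kp ε p q / rp p q - δ) * (‖v.2‖ ^ 2 - fderiv ℝ (rp p) q v ^ 2)
          + δ * (‖v.1‖ ^ 2 - fderiv ℝ (rp p) q v ^ 2)) := by
  have hr := hq.1.ne'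
  have hrr : hessian (rp p) q v = (‖v.2‖ ^ 2 - fderiv ℝ (rp p) q v ^ 2) / rp p q :=
    (eq_div_iff hr).2 (by rw [mul_comm, rp_mul_hessian_rp hq])
  rw [hessian_kp hq, hessian_fp, hv, hrr]
  ring

theorem hessian_kp_gt_of_tangent (hε : 0 < ε) (hq : q ∈ regular ε p) (hf : 0 < fp p q)
    (hδ : 0 < δ) (hδk : δ < ε * kp ε p q / rp p q) {v : ST m n} (hv₀ : v ≠ 0)
    (hv : fderiv ℝ (kp ε p) q v = 0) :
    (1 / 2 + δ) / (1 - ε * rp p q) * (‖v.2‖ ^ 2 - ‖v.1‖ ^ 2) < hessian (kp ε p) q v := by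
  have hspace : 0 ≤ ‖v.2‖ ^ 2 - fderiv ℝ (rp p) q v ^ 2 := sub_nonneg.2 (fderiv_rp_sq_le hq v)
  have hpos : 0 < (ε * kp ε p q / rp p q - δ) * (‖v.2‖ ^ 2 - fderiv ℝ (rp p) q v ^ 2)
      + δ * (‖v.1‖ ^ 2 - fderiv ℝ (rp p) q v ^ 2) := by
    rcases eq_or_ne v.1 0 with hv₁ | hv₁
    · have hv₂ : v.2 ≠ 0 := fun h => hv₀ (Prod.ext hv₁ h)
      have hradial : fderiv ℝ (rp p) q v = 0 := by
        have h := inner_time_eq_of_fderiv_kp_eq_zero hq hv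
        rw [hv₁, inner_zero_right, zero_eq_mul] at h
        exact h.resolve_left (by linarith [hq.1, mul_pos hε (kp_pos hq hf)])
      rw [hradial, hv₁]
      have := mul_pos (sub_pos.2 hδk) (pow_pos (norm_pos_iff.2 hv₂) 2)
      simpa using this
    · have htime := sq_lt_sq.2 ((abs_fderiv_rp_lt_of_tangent hε hq hf hv hv₁).trans_eq
        (abs_norm v.1).symm)
      exact add_pos_of_nonneg_of_pos (mul_nonneg (sub_pos.2 hδk).le hspace)
        (mul_pos hδ (sub_pos.2 htime))
  rw [div_mul_eq_mul_div, div_lt_iff₀ (sub_pos.2 hq.2), mul_comm (hessian _ _ _),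
    hessian_kp_of_tangent hq hv δ]
  linarith

/-- The Carleman weight: the exponential, with a large parameter `τ`, makes the Hessian of `kp`
positive also in the direction normal to its level sets. -/
noncomputable def weight (τ ε : ℝ) (p : ST m n) : ST m n → ℝ := fun q => Real.exp (τ * kp ε p q)

theorem contDiffOn_weight (τ ε : ℝ) (p : ST m n) : ContDiffOn ℝ ∞ (weight τ ε p) (regular ε p) :=
  (contDiffOn_const.mul (contDiffOn_kp ε p)).exp

theorem isPseudoconvexOn_weight {τ : ℝ} {K : Set (ST m n)} (hε : 0 < ε) (hδ : 0 < δ) (hτ : 0 < τ)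
    (hKr : K ⊆ regular ε p) (hKf : ∀ q ∈ K, 0 < fp p q)
    (hδk : ∀ q ∈ K, δ < ε * kp ε p q / rp p q)
    (hnormal : ∀ q ∈ K, 0 < hessian (kp ε p) q (grad (minkowskiSharp m n) (kp ε p) q)
      + τ * gradPairing (minkowskiSharp m n) (kp ε p) (kp ε p) q ^ 2) :
    IsPseudoconvexOn (minkowskiSharp m n) (weight τ ε p)
      (fun x => τ * Real.exp (τ * kp ε p x) * ((1 / 2 + δ) / (1 - ε * rp p x))) K where
  normal_pos q hq := by
    have hk := (contDiffAt_kp (hKr hq)).of_le (m := 2) (by norm_cast)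
    have dk := hk.differentiableAt two_ne_zero
    have hg := gradPairing_kp_self_pos hε (hKr hq) (hKf q hq)
    have hρ := sub_pos.2 (hKr hq).2
    have hpos := hnormal q hq
    unfold weight
    rw [hessian_exp_mul τ hk, gradPairing, fderiv_exp_mul τ dk, grad_exp_mul τ dk, hessian_smul]
    simp only [map_smul, smul_apply, smul_eq_mul]
    rw [← gradPairing]
    set x := τ * Real.exp (τ * kp ε p q)
    calc (0 : ℝ) < x ^ 3 * (hessian (kp ε p) q (grad (minkowskiSharp m n) (kp ε p) q)
            + τ * gradPairing (minkowskiSharp m n) (kp ε p) (kp ε p) q ^ 2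
            + (1 / 2 + δ) / (1 - ε * rp p q)
              * gradPairing (minkowskiSharp m n) (kp ε p) (kp ε p) q) := by positivity
      _ = _ := by ring
  tangential_pos q hq α hα htan := by
    have hk := (contDiffAt_kp (hKr hq)).of_le (m := 2) (by norm_cast)
    unfold weight at htan ⊢
    rw [fderiv_exp_mul τ (hk.differentiableAt two_ne_zero)] at htan
    have hdk : fderiv ℝ (kp ε p) q (minkowskiSharp m n α) = 0 :=
      (mul_eq_zero.1 htan).resolve_left (by positivity)
    have h := hessian_kp_gt_of_tangent hε (hKr hq) (hKf q hq) hδ (hδk q hq)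
      (minkowskiSharp_ne_zero hα) hdk
    have hx : 0 < τ * Real.exp (τ * kp ε p q) := by positivity
    rw [hessian_exp_mul τ hk, hdk, apply_minkowskiSharp_self, mul_assoc _ _ (‖_‖ ^ 2 - _),
      ← mul_sub]
    exact mul_pos hx (by linarith)

theorem exists_isPseudoconvexOn_weight {K : Set (ST m n)} (hε : 0 < ε) (hK : IsCompact K)
    (hKr : K ⊆ regular ε p) (hKf : ∀ q ∈ K, 0 < fp p q) :
    ∃ τ > 0, ∃ μ, ContDiffOn ℝ ∞ μ (regular ε p) ∧
      IsPseudoconvexOn (minkowskiSharp m n) (weight τ ε p) μ K := by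
  have hO := isOpen_regular ε p
  have hk := contDiffOn_kp ε p
  have hg := (contDiffOn_gradPairing (S := minkowskiSharp m n) (k := 0) hO hk hk
    (by norm_cast)).continuousOn.mono hKr
  have hH : ContinuousOn
      (fun q => hessian (kp ε p) q (grad (minkowskiSharp m n) (kp ε p) q)) K :=
    continuousOn_hessian hO (hk.of_le (by norm_cast)) continuousOn_id hKr
      ((contDiffOn_grad (k := 0) hO hk (by norm_cast)).continuousOn.mono hKr)
  have hδc : ContinuousOn (fun q => ε * kp ε p q / rp p q) K :=
    ((continuousOn_const.mul hk.continuousOn).mono hKr).div (continuous_rp p).continuousOn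
      fun q hq => (hKr hq).1.ne'
  obtain ⟨b, hb, hgb⟩ := exists_pos_le_of_isCompact hK hg fun q hq =>
    gradPairing_kp_self_pos hε (hKr hq) (hKf q hq)
  obtain ⟨d, hd, hdk⟩ := exists_pos_le_of_isCompact hK hδc fun q hq =>
    div_pos (mul_pos hε (kp_pos (hKr hq) (hKf q hq))) (hKr hq).1
  obtain ⟨C, hC⟩ := hK.exists_bound_of_continuousOn hH
  have hτ : 0 < (|C| + 1) / b ^ 2 := by positivity
  refine ⟨(|C| + 1) / b ^ 2, hτ, _, ?_, isPseudoconvexOn_weight hε (half_pos hd) hτ hKr hKf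
    (fun q hq => (half_lt_self hd).trans_le (hdk q hq)) fun q hq => ?_⟩
  · exact (contDiffOn_const.mul (contDiffOn_const.mul hk).exp).mul
      (contDiffOn_const.div (contDiffOn_const.sub (contDiffOn_const.mul (contDiffOn_rp ε p)))
        fun q hq => (sub_pos.2 hq.2).ne')
  · have hlow : |C| + 1
        ≤ (|C| + 1) / b ^ 2 * gradPairing (minkowskiSharp m n) (kp ε p) (kp ε p) q ^ 2 := by
      rw [div_mul_eq_mul_div, le_div_iff₀ (by positivity)]
      gcongr
      exact hgb q hq
    have := (abs_le.1 (hC q hq)).1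
    linarith [le_abs_self C]

end Pseudoconvexity

section LevelSet

variable {V : Type*} [NormedAddCommGroup V] [NormedSpace ℝ V]

theorem exists_curve_mem_levelSet [CompleteSpace V] {Φ : V → ℝ} {Φ' : V →L[ℝ] ℝ} {q v : V}
    (hΦ : HasStrictFDerivAt Φ Φ' q) (hne : Φ' ≠ 0) (hv : Φ' v = 0) :
    ∃ γ : ℝ → V, γ 0 = q ∧ HasDerivAt γ v 0 ∧ ∀ᶠ s in 𝓝 (0 : ℝ), Φ (γ s) = Φ q := by
  have hsurj : Φ'.range = ⊤ :=
    LinearMap.range_eq_top.2 (LinearMap.surjective (by exact_mod_cast hne))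
  let line : ℝ →L[ℝ] Φ'.ker := ContinuousLinearMap.toSpanSingleton ℝ ⟨v, hv⟩
  have hline : Tendsto line (𝓝 0) (𝓝 0) := by simpa using line.continuous.tendsto 0
  refine ⟨fun s => hΦ.implicitFunction Φ Φ' hsurj (Φ q) (line s), ?_, ?_, ?_⟩
  · simp
  · have himp : HasFDerivAt (hΦ.implicitFunction Φ Φ' hsurj (Φ q)) Φ'.ker.subtypeL (line 0) := by
      simpa using (hΦ.to_implicitFunction hsurj).hasFDerivAt
    simpa [line, Function.comp_def] using himp.comp_hasDerivAt (0 : ℝ) line.hasDerivAt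
  · exact (tendsto_const_nhds.prodMk_nhds hline).eventually (hΦ.map_implicitFunction_eq hsurj)

theorem exists_eq_smul_of_eqOn_levelSet [CompleteSpace V] {Φ z : V → ℝ} {Φ' L : V →L[ℝ] ℝ}
    {A : Set V} {q : V} (hΦ : HasStrictFDerivAt Φ Φ' q) (hne : Φ' ≠ 0)
    (hz : HasFDerivWithinAt z L A q) (hA : ∀ᶠ x in 𝓝 q, Φ x = Φ q → x ∈ A ∧ z x = z q) :
    ∃ r : ℝ, L = r • Φ' := by
  have htangent v (hv : Φ' v = 0) : L v = 0 := by
    obtain ⟨γ, hγ0, hγ, hγΦ⟩ := exists_curve_mem_levelSet hΦ hne hv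
    have hγA : ∀ᶠ s in 𝓝 (0 : ℝ), γ s ∈ A ∧ z (γ s) = z q := by
      have hγq : Tendsto γ (𝓝 0) (𝓝 q) := hγ0 ▸ hγ.continuousAt
      filter_upwards [hγΦ, hγq.eventually hA] with s hs hsA using hsA hs
    have hderiv : HasDerivAt (z ∘ γ) (L v) 0 :=
      (hγ0.symm ▸ hz).comp_hasDerivAt_of_eq (0 : ℝ) hγ (hγA.mono fun _ h => h.1) rfl
    exact hderiv.unique ((hasDerivAt_const (0 : ℝ) (z q)).congr_of_eventuallyEq
      (hγA.mono fun _ h => h.2))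
  obtain ⟨e, he⟩ : ∃ e, Φ' e = 1 := (Φ'.toLinearMap.surjective (by exact_mod_cast hne)) 1
  refine ⟨L e, ContinuousLinearMap.ext fun v => ?_⟩
  have h := htangent (v - Φ' v • e) (by simp [he])
  simpa [sub_eq_zero, mul_comm] using h

end LevelSet

section Flux

variable {V : Type*} [NormedAddCommGroup V] [NormedSpace ℝ V] {S : (V →L[ℝ] ℝ) →L[ℝ] V}
  {U : Set V} {ψ κ w z Φ : V → ℝ} {q : V}

theorem current_eq_zero (hw : w =ᶠ[𝓝 q] 0) (lam : ℝ) : current S ψ κ lam w q = 0 := by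
  have hw' : fderiv ℝ w q = 0 := by rw [hw.fderiv_eq]; simp
  simp [current, gradPairing, grad, hw.eq_of_nhds, hw']

theorem fluxNonposAt_current_of_eventuallyEq_zero (hU : IsOpen U) (hw : ∀ᶠ x in 𝓝[U] q, w x = 0)
    (lam : ℝ) : FluxNonposAt U Φ (current S ψ κ lam w) q := by
  intro η hη
  filter_upwards [eventually_eventually_nhdsWithin.2 hw, self_mem_nhdsWithin] with x hx hxU
  rw [hU.nhdsWithin_eq hxU] at hx
  rw [current_eq_zero hx, map_zero]
  exact hη.le

theorem tendsto_current (hψ : ContDiffAt ℝ 1 ψ q) (hκ : ContDiffAt ℝ 1 κ q) {r : ℝ}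
    (hw : Tendsto w (𝓝[U] q) (𝓝 0))
    (hdw : Tendsto (fderiv ℝ w) (𝓝[U] q) (𝓝 (r • fderiv ℝ Φ q))) (lam : ℝ) :
    Tendsto (current S ψ κ lam w) (𝓝[U] q)
      (𝓝 (r ^ 2 • (gradPairing S ψ Φ q • grad S Φ q
        - (2⁻¹ * gradPairing S Φ Φ q) • grad S ψ q))) := by
  have hlim {a : V → ℝ} (ha : ContDiffAt ℝ 1 a q) :
      Tendsto (fderiv ℝ a) (𝓝[U] q) (𝓝 (fderiv ℝ a q)) :=
    ((ha.continuousAt_fderiv (by simp)).tendsto).mono_left nhdsWithin_le_nhds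
  have hκ0 : Tendsto κ (𝓝[U] q) (𝓝 (κ q)) := hκ.continuousAt.tendsto.mono_left nhdsWithin_le_nhds
  have hgrad {a : V → ℝ} {α : V →L[ℝ] ℝ} (ha : Tendsto (fderiv ℝ a) (𝓝[U] q) (𝓝 α)) :
      Tendsto (grad S a) (𝓝[U] q) (𝓝 (S α)) := (S.continuous.tendsto _).comp ha
  have hpair {a b : V → ℝ} {α β : V →L[ℝ] ℝ} (ha : Tendsto (fderiv ℝ a) (𝓝[U] q) (𝓝 α))
      (hb : Tendsto (fderiv ℝ b) (𝓝[U] q) (𝓝 β)) :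
      Tendsto (gradPairing S a b) (𝓝[U] q) (𝓝 (α (S β))) :=
    (isBoundedBilinearMap_apply.continuous.tendsto (α, S β)).comp (ha.prodMk_nhds (hgrad hb))
  have hcurrent := ((((hpair (hlim hψ) hdw).add (hκ0.mul hw)).smul
    (hgrad hdw)).add ((((((hpair (hlim hψ) (hlim hψ)).mul (hw.pow 2)).const_mul (lam ^ 2)).sub
      (hpair hdw hdw)).const_mul 2⁻¹).smul (hgrad (hlim hψ)))).sub
      (((hw.pow 2).const_mul 2⁻¹).smul (hgrad (hlim hκ)))
  refine (congrArg (Tendsto (current S ψ κ lam w) (𝓝[U] q) <| 𝓝 ·) ?_).mpr hcurrent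
  simp only [gradPairing, grad, map_smul, smul_apply, smul_eq_mul]
  module

theorem fluxNonposAt_current (hS : IsSymmSharp S) (hψ : ContDiffAt ℝ 1 ψ q)
    (hκ : ContDiffAt ℝ 1 κ q) (hΦ : ContDiffAt ℝ 1 Φ q) {r : ℝ}
    (hw : Tendsto w (𝓝[U] q) (𝓝 0))
    (hdw : Tendsto (fderiv ℝ w) (𝓝[U] q) (𝓝 (r • fderiv ℝ Φ q)))
    (hΦΦ : 0 ≤ gradPairing S Φ Φ q) (hψΦ : gradPairing S ψ Φ q ≤ 0) (lam : ℝ) :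
    FluxNonposAt U Φ (current S ψ κ lam w) q := by
  have hΦ' : Tendsto (fderiv ℝ Φ) (𝓝[U] q) (𝓝 (fderiv ℝ Φ q)) :=
    ((hΦ.continuousAt_fderiv (by simp)).tendsto).mono_left nhdsWithin_le_nhds
  have hflux := (isBoundedBilinearMap_apply.continuous.tendsto (_, _)).comp
    (hΦ'.prodMk_nhds (tendsto_current (S := S) hψ hκ hw hdw lam))
  have hlimit : fderiv ℝ Φ q (r ^ 2 • (gradPairing S ψ Φ q • grad S Φ q
      - (2⁻¹ * gradPairing S Φ Φ q) • grad S ψ q))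
      = r ^ 2 / 2 * gradPairing S Φ Φ q * gradPairing S ψ Φ q := by
    have hcomm : fderiv ℝ Φ q (grad S ψ q) = gradPairing S ψ Φ q := gradPairing_comm hS ..
    have hself : fderiv ℝ Φ q (grad S Φ q) = gradPairing S Φ Φ q := rfl
    simp only [map_smul, map_sub, smul_eq_mul, hcomm, hself]
    ring
  intro η hη
  refine hflux.eventually_le_const (lt_of_le_of_lt ?_ hη)
  rw [hlimit]
  exact mul_nonpos_of_nonneg_of_nonpos (by positivity) hψΦ

theorem tendsto_fderiv_mul {a : V → ℝ} {L : V →L[ℝ] ℝ} (hU : IsOpen U)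
    (ha : ContDiffAt ℝ 1 a q) (hz : DifferentiableOn ℝ z U) (hz0 : Tendsto z (𝓝[U] q) (𝓝 0))
    (hdz : Tendsto (fderiv ℝ z) (𝓝[U] q) (𝓝 L)) :
    Tendsto (fderiv ℝ fun x => a x * z x) (𝓝[U] q) (𝓝 (a q • L)) := by
  have hle : 𝓝[U] q ≤ 𝓝 q := nhdsWithin_le_nhds
  have ha' := (ha.continuousAt_fderiv (by simp)).tendsto.mono_left hle
  have hlim := ((ha.continuousAt.tendsto.mono_left hle).smul hdz).add (hz0.smul ha')
  rw [zero_smul, add_zero] at hlim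
  refine hlim.congr' ?_
  filter_upwards [hle ((ha.eventually (by simp)).mono fun x hx => hx.differentiableAt (by simp)),
    self_mem_nhdsWithin] with x hx hxU
  exact (fderiv_fun_mul hx (hz.differentiableAt (hU.mem_nhds hxU))).symm

end Flux

section Boundary

variable {m n : ℕ} {T : ℝ} {Ω : Set (E n)} {φ : E n → ℝ} {y : E n} {z : ST m n → ℝ} {q : ST m n}

theorem isOpen_cube (m : ℕ) (T : ℝ) : IsOpen (cube m T) := by
  simp only [cube, Set.ofPred_forall]
  exact isOpen_iInter_of_finite fun i =>
    (isOpen_lt (f := fun _ : E m => -T) (g := fun t => t i) (by fun_prop) (by fun_prop)).inter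
      (isOpen_lt (f := fun t : E m => t i) (g := fun _ => T) (by fun_prop) (by fun_prop))

theorem isOpen_cyl (m : ℕ) (T : ℝ) (hΩ : IsOpen Ω) : IsOpen (cyl m T Ω) :=
  (isOpen_cube m T).prod hΩ

theorem cyl_subset_cube_prod_closure : cyl m T Ω ⊆ cube m T ×ˢ closure Ω :=
  prod_mono_right subset_closure

theorem IsDefiningAt.contDiffAt (hφ : IsDefiningAt Ω y φ) : ContDiffAt ℝ ∞ φ y :=
  have ⟨⟨_, hN, hcd, _⟩, _⟩ := hφ
  hcd.contDiffAt hN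

theorem IsDefiningAt.mem_iff (hφ : IsDefiningAt Ω y φ) : y ∈ Ω ↔ φ y < 0 :=
  have ⟨⟨_, hN, _, hiff⟩, _⟩ := hφ
  hiff y (mem_of_mem_nhds hN)

theorem IsDefiningAt.fderiv_ne_zero (hφ : IsDefiningAt Ω y φ) : fderiv ℝ φ y ≠ 0 :=
  fun h => hφ.2 (by simp [gradient, h])

theorem IsDefiningAt.eventually (hφ : IsDefiningAt Ω y φ) :
    ∀ᶠ x in 𝓝 y, IsDefiningAt Ω x φ := by
  have hgrad : ∀ᶠ x in 𝓝 y, fderiv ℝ φ x ≠ 0 :=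
    (hφ.contDiffAt.continuousAt_fderiv (by simp)).eventually_ne hφ.fderiv_ne_zero
  obtain ⟨⟨N, hN, hcd, hiff⟩, -⟩ := hφ
  filter_upwards [eventually_mem_nhds_iff.2 hN, hgrad] with x hxN hx
  exact ⟨⟨N, hxN, hcd, hiff⟩, by simpa [gradient] using hx⟩

theorem IsDefiningAt.mem_frontier_iff (hΩ : IsOpen Ω) (hφ : IsDefiningAt Ω y φ) :
    y ∈ frontier Ω ↔ φ y = 0 := by
  rw [hΩ.frontier_eq, Set.mem_sdiff, hφ.mem_iff, not_lt]
  refine ⟨fun ⟨hcl, h0⟩ => h0.antisymm' (not_lt.1 fun hpos => ?_), fun h0 => ⟨?_, h0.ge⟩⟩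
  · have hout : ∀ᶠ x in 𝓝 y, x ∉ Ω := by
      filter_upwards [hφ.eventually, hφ.contDiffAt.continuousAt.eventually_const_lt hpos]
        with x hx hx0 using hx.mem_iff.not.2 hx0.le.not_gt
    exact (mem_closure_iff_frequently.1 hcl) hout
  · refine mem_closure_iff_frequently.2 fun hout => hφ.fderiv_ne_zero ?_
    have hmin : IsLocalMin φ y := by
      filter_upwards [hout, hφ.eventually] with x hx hxφ
      exact h0.le.trans (not_lt.1 (hxφ.mem_iff.not.1 hx))
    exact hmin.fderiv_eq_zero

theorem IsDefiningAt.fderiv_comp_snd (hφ : IsDefiningAt Ω q.2 φ) (v : ST m n) :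
    fderiv ℝ (fun x : ST m n => φ x.2) q v = inner ℝ (∇ φ q.2) v.2 := by
  have h : HasFDerivAt (fun x : ST m n => φ x.2) _ q :=
    (hφ.contDiffAt.differentiableAt (by simp)).hasFDerivAt.comp q hasFDerivAt_snd
  simp [h.fderiv, gradient]

theorem IsDefiningAt.contDiffAt_comp_snd (hφ : IsDefiningAt Ω q.2 φ) :
    ContDiffAt ℝ ∞ (fun x : ST m n => φ x.2) q :=
  hφ.contDiffAt.comp q contDiffAt_snd

theorem IsDefiningAt.fderiv_comp_snd_ne_zero (hφ : IsDefiningAt Ω q.2 φ) :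
    fderiv ℝ (fun x : ST m n => φ x.2) q ≠ 0 := fun h => hφ.2 <| by
  simpa [h, eq_comm (a := (0 : ℝ))] using hφ.fderiv_comp_snd (0, ∇ φ q.2)

theorem IsDefiningAt.grad_comp_snd (hφ : IsDefiningAt Ω q.2 φ) :
    grad (minkowskiSharp m n) (fun x => φ x.2) q = (0, ∇ φ q.2) :=
  minkowskiSharp_eq fun w => by simp [hφ.fderiv_comp_snd]

theorem exists_tendsto_fderiv (hΩ : IsOpen Ω) (hz : ContDiffOn ℝ 1 z (cube m T ×ˢ closure Ω))
    (hq : q ∈ cube m T ×ˢ closure Ω) :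
    ∃ L : ST m n →L[ℝ] ℝ, HasFDerivWithinAt z L (cube m T ×ˢ closure Ω) q ∧
      Tendsto (fderiv ℝ z) (𝓝[cyl m T Ω] q) (𝓝 L) := by
  have hsucc := hz q hq
  rw [← zero_add (1 : WithTop ℕ∞), contDiffWithinAt_succ_iff_hasFDerivWithinAt' (by simp)] at hsucc
  obtain ⟨u, hu, -, -, z', hz', hcont⟩ := hsucc
  rw [insert_eq_of_mem hq] at hu
  refine ⟨z' q, hz' q (mem_of_mem_nhdsWithin hq hu), ?_⟩
  refine (hcont.continuousWithinAt.mono cyl_subset_cube_prod_closure).congr' ?_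
  filter_upwards [nhdsWithin_mono _ cyl_subset_cube_prod_closure hu, self_mem_nhdsWithin]
    with x hx hxU
  exact ((hz' x hx).hasFDerivAt (mem_of_superset ((isOpen_cyl m T hΩ).mem_nhds hxU)
    cyl_subset_cube_prod_closure)).fderiv.symm

theorem exists_tendsto_fderiv_smul (hΩ : IsOpen Ω)
    (hz : ContDiffOn ℝ 1 z (cube m T ×ˢ closure Ω)) (hz0 : ∀ x ∈ lateral m T Ω, z x = 0)
    (hq : q ∈ lateral m T Ω) (hφ : IsDefiningAt Ω q.2 φ) :
    ∃ r : ℝ, Tendsto (fderiv ℝ z) (𝓝[cyl m T Ω] q)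
      (𝓝 (r • fderiv ℝ (fun x : ST m n => φ x.2) q)) := by
  obtain ⟨L, hL, hlim⟩ := exists_tendsto_fderiv hΩ hz ⟨hq.1, frontier_subset_closure hq.2⟩
  have hlateral : ∀ᶠ x in 𝓝 q, φ x.2 = φ q.2 → x ∈ cube m T ×ˢ closure Ω ∧ z x = z q := by
    filter_upwards [continuous_fst.continuousAt.eventually ((isOpen_cube m T).mem_nhds hq.1),
      continuous_snd.continuousAt.eventually hφ.eventually] with x hx1 hx2 hx0
    rw [(hφ.mem_frontier_iff hΩ).1 hq.2] at hx0
    have hxΩ := (hx2.mem_frontier_iff hΩ).2 hx0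
    exact ⟨⟨hx1, frontier_subset_closure hxΩ⟩, (hz0 x ⟨hx1, hxΩ⟩).trans (hz0 q hq).symm⟩
  obtain ⟨r, rfl⟩ := exists_eq_smul_of_eqOn_levelSet
    (hφ.contDiffAt_comp_snd.hasStrictFDerivAt (by simp)) hφ.fderiv_comp_snd_ne_zero hL hlateral
  exact ⟨r, hlim⟩

end Boundary

section Bounds

open Asymptotics

theorem isBigO_one_mul {X : Type*} {l : Filter X} {f g : X → ℝ} (hf : f =O[l] (1 : X → ℝ))
    (hg : g =O[l] (1 : X → ℝ)) : (fun x => f x * g x) =O[l] (1 : X → ℝ) := by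
  simpa only [mul_one, Pi.one_apply] using! hf.mul hg

theorem isBigO_one_smul {X W : Type*} {l : Filter X} [NormedAddCommGroup W] [NormedSpace ℝ W]
    {f : X → ℝ} {g : X → W} (hf : f =O[l] (1 : X → ℝ)) (hg : g =O[l] (1 : X → ℝ)) :
    (fun x => f x • g x) =O[l] (1 : X → ℝ) := by
  simpa only [smul_eq_mul, mul_one, Pi.one_apply] using! hf.smul hg

theorem isBigO_one_of_continuousOn {X W : Type*} [TopologicalSpace X] [NormedAddCommGroup W]
    {f : X → W} {A K : Set X} (hK : IsCompact K) (hf : ContinuousOn f K) (hA : A ⊆ K) :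
    f =O[𝓟 A] (1 : X → ℝ) :=
  (hf.isBigO_principal hK (by simp : ‖(1 : ℝ)‖ ≠ 0)).mono (principal_mono.2 hA)

theorem isBigO_one_of_forall_exists_tendsto {X W : Type*} [TopologicalSpace X]
    [NormedAddCommGroup W] {f : X → W} {K U : Set X} (hK : IsCompact K)
    (hf : ∀ q ∈ K, ∃ L, Tendsto f (𝓝[U] q) (𝓝 L)) : f =O[𝓟 (U ∩ K)] (1 : X → ℝ) := by
  refine hK.induction_on (p := fun s => f =O[𝓟 (U ∩ s)] (1 : X → ℝ)) (by simp)
    (fun s t hst ht => ht.mono (principal_mono.2 (inter_subset_inter_right U hst)))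
    (fun s t hs ht => ?_) fun q hq => ?_
  · rw [inter_union_distrib_left, ← sup_principal]
    exact hs.sup ht
  · obtain ⟨L, hL⟩ := hf q hq
    obtain ⟨C, hC⟩ := (hL.isBigO_one ℝ).bound
    refine ⟨_, nhdsWithin_le_nhds (eventually_nhdsWithin_iff.1 hC), IsBigO.of_bound C ?_⟩
    exact eventually_principal.2 fun x hx => hx.2 hx.1

variable {V : Type*} [NormedAddCommGroup V] [NormedSpace ℝ V] {S : (V →L[ℝ] ℝ) →L[ℝ] V}
  {ψ κ w a b : V → ℝ} {A K O U : Set V}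

/-- `w`, `dw` and `□w` are bounded on `A`. The other second derivatives of `w` are not controlled,
as for a solution that is merely `C¹` up to the boundary. -/
structure IsWaveBounded (S : (V →L[ℝ] ℝ) →L[ℝ] V) (w : V → ℝ) (A : Set V) : Prop where
  isBigO : w =O[𝓟 A] (1 : V → ℝ)
  isBigO_fderiv : fderiv ℝ w =O[𝓟 A] (1 : V → ℝ)
  isBigO_waveOp : waveOp S w =O[𝓟 A] (1 : V → ℝ)

theorem IsWaveBounded.mono {A' : Set V} (h : IsWaveBounded S w A) (hA : A' ⊆ A) :
    IsWaveBounded S w A' where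
  isBigO := h.isBigO.mono (principal_mono.2 hA)
  isBigO_fderiv := h.isBigO_fderiv.mono (principal_mono.2 hA)
  isBigO_waveOp := h.isBigO_waveOp.mono (principal_mono.2 hA)

theorem isBigO_one_clm_apply {l : Filter V} {W : Type*} [NormedAddCommGroup W] [NormedSpace ℝ W]
    {f : V → V →L[ℝ] W} {g : V → V} (hf : f =O[l] (1 : V → ℝ)) (hg : g =O[l] (1 : V → ℝ)) :
    (fun x => f x (g x)) =O[l] (1 : V → ℝ) :=
  (isBigO_of_le l fun x => by simpa using (f x).le_opNorm (g x)).trans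
    (isBigO_one_mul hf.norm_left hg.norm_left)

theorem isBigO_grad {l : Filter V} (ha : fderiv ℝ a =O[l] (1 : V → ℝ)) :
    grad S a =O[l] (1 : V → ℝ) :=
  (S.isBigO_comp _ l).trans ha

theorem isBigO_gradPairing {l : Filter V} (ha : fderiv ℝ a =O[l] (1 : V → ℝ))
    (hb : fderiv ℝ b =O[l] (1 : V → ℝ)) : gradPairing S a b =O[l] (1 : V → ℝ) :=
  isBigO_one_clm_apply ha (isBigO_grad hb)

theorem IsWaveBounded.of_contDiffOn [FiniteDimensional ℝ V] (hO : IsOpen O) (hK : IsCompact K)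
    (hKO : K ⊆ O) (ha : ContDiffOn ℝ 2 a O) (hA : A ⊆ K) : IsWaveBounded S a A where
  isBigO := isBigO_one_of_continuousOn hK (ha.continuousOn.mono hKO) hA
  isBigO_fderiv :=
    isBigO_one_of_continuousOn hK ((ha.continuousOn_fderiv_of_isOpen hO (by norm_num)).mono hKO) hA
  isBigO_waveOp := isBigO_one_of_continuousOn hK
    ((contDiffOn_waveOp (k := 0) hO ha (by norm_num)).continuousOn.mono hKO) hA

theorem IsWaveBounded.mul [FiniteDimensional ℝ V] (hS : IsSymmSharp S)
    (ha : IsWaveBounded S a A) (hb : IsWaveBounded S b A) (ha2 : ∀ q ∈ A, ContDiffAt ℝ 2 a q)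
    (hb2 : ∀ q ∈ A, ContDiffAt ℝ 2 b q) : IsWaveBounded S (fun x => a x * b x) A where
  isBigO := isBigO_one_mul ha.isBigO hb.isBigO
  isBigO_fderiv := by
    refine ((isBigO_one_smul ha.isBigO hb.isBigO_fderiv).add
      (isBigO_one_smul hb.isBigO ha.isBigO_fderiv)).congr' ?_ .rfl
    exact eventually_principal.2 fun q hq => (fderiv_fun_mul
      ((ha2 q hq).differentiableAt two_ne_zero) ((hb2 q hq).differentiableAt two_ne_zero)).symm
  isBigO_waveOp := by
    refine (((isBigO_one_mul ha.isBigO hb.isBigO_waveOp).add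
      ((isBigO_gradPairing (S := S) ha.isBigO_fderiv hb.isBigO_fderiv).const_mul_left 2)).add
        (isBigO_one_mul hb.isBigO ha.isBigO_waveOp)).congr' ?_ .rfl
    exact eventually_principal.2 fun q hq => (waveOp_mul hS (ha2 q hq) (hb2 q hq)).symm

theorem IsWaveBounded.isBigO_current (hψ : IsWaveBounded S ψ A) (hκ : IsWaveBounded S κ A)
    (hw : IsWaveBounded S w A) (lam : ℝ) : current S ψ κ lam w =O[𝓟 A] (1 : V → ℝ) := by
  have hww := isBigO_one_mul hw.isBigO hw.isBigO
  simp only [← pow_two] at hww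
  have hψψ := isBigO_gradPairing (S := S) hψ.isBigO_fderiv hψ.isBigO_fderiv
  have hww' := isBigO_gradPairing (S := S) hw.isBigO_fderiv hw.isBigO_fderiv
  have hψw := isBigO_gradPairing (S := S) hψ.isBigO_fderiv hw.isBigO_fderiv
  exact ((isBigO_one_smul (hψw.add (isBigO_one_mul hκ.isBigO hw.isBigO))
    (isBigO_grad hw.isBigO_fderiv)).add (isBigO_one_smul ((((isBigO_one_mul hψψ hww).const_mul_left
      (lam ^ 2)).sub hww').const_mul_left 2⁻¹) (isBigO_grad hψ.isBigO_fderiv))).sub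
      (isBigO_one_smul (hww.const_mul_left 2⁻¹) (isBigO_grad hκ.isBigO_fderiv))

theorem isBigO_hessian {l : Filter V} (ha : fderiv ℝ (fderiv ℝ a) =O[l] (1 : V → ℝ)) {v : V → V}
    (hv : v =O[l] (1 : V → ℝ)) : (fun x => hessian a x (v x)) =O[l] (1 : V → ℝ) :=
  isBigO_one_clm_apply (isBigO_one_clm_apply ha hv) hv

theorem IsWaveBounded.isBigO_divergence_current [FiniteDimensional ℝ V] (hS : IsSymmSharp S)
    (hψ : IsWaveBounded S ψ A) (hψ' : fderiv ℝ (fderiv ℝ ψ) =O[𝓟 A] (1 : V → ℝ))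
    (hκ : IsWaveBounded S κ A) (hw : IsWaveBounded S w A) (hψ2 : ∀ q ∈ A, ContDiffAt ℝ 2 ψ q)
    (hκ2 : ∀ q ∈ A, ContDiffAt ℝ 2 κ q) (hw2 : ∀ q ∈ A, ContDiffAt ℝ 2 w q) (lam : ℝ) :
    divergence (current S ψ κ lam w) =O[𝓟 A] (1 : V → ℝ) := by
  have hww := isBigO_one_mul hw.isBigO hw.isBigO
  simp only [← pow_two] at hww
  have hψψ := isBigO_gradPairing (S := S) hψ.isBigO_fderiv hψ.isBigO_fderiv
  have hww' := isBigO_gradPairing (S := S) hw.isBigO_fderiv hw.isBigO_fderiv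
  have hψw := isBigO_gradPairing (S := S) hψ.isBigO_fderiv hw.isBigO_fderiv
  have half {f : V → ℝ} (hf : f =O[𝓟 A] (1 : V → ℝ)) : (fun x => f x / 2) =O[𝓟 A] (1 : V → ℝ) := by
    simpa only [div_eq_inv_mul] using hf.const_mul_left 2⁻¹
  have hμ := (half hψ.isBigO_waveOp).sub hκ.isBigO
  refine IsBigO.congr' ?_
    (eventually_principal.2 fun q hq =>
      (divergence_current hS lam (hψ2 q hq) (hκ2 q hq) (hw2 q hq)).symm) .rfl
  exact (((isBigO_one_mul (hw.isBigO_waveOp.add (isBigO_one_mul (hψψ.const_mul_left _) hw.isBigO))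
    (hψw.add (isBigO_one_mul hκ.isBigO hw.isBigO))).add
      (isBigO_hessian hψ' (isBigO_grad hw.isBigO_fderiv))).sub (isBigO_one_mul hμ hww')).sub
      (isBigO_one_mul (half hκ.isBigO_waveOp) hww) |>.add
      (isBigO_one_mul (((isBigO_hessian hψ' (isBigO_grad hψ.isBigO_fderiv)).add
        (isBigO_one_mul hμ hψψ)).const_mul_left _) hww)

theorem contDiffOn_current (hO : IsOpen O) (hψ : ContDiffOn ℝ 2 ψ O) (hκ : ContDiffOn ℝ 2 κ O)
    (hw : ContDiffOn ℝ 2 w O) (lam : ℝ) : ContDiffOn ℝ 1 (current S ψ κ lam w) O := by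
  have h12 : (1 : WithTop ℕ∞) + 1 ≤ 2 := by norm_num
  have hgrad {f : V → ℝ} (hf : ContDiffOn ℝ 2 f O) : ContDiffOn ℝ 1 (grad S f) O :=
    contDiffOn_grad hO hf h12
  have hpair {f g : V → ℝ} (hf : ContDiffOn ℝ 2 f O) (hg : ContDiffOn ℝ 2 g O) :
      ContDiffOn ℝ 1 (gradPairing S f g) O := contDiffOn_gradPairing hO hf hg h12
  have hw1 : ContDiffOn ℝ 1 w O := hw.of_le (by norm_num)
  exact ((((hpair hψ hw).add ((hκ.of_le (by norm_num)).mul hw1)).smul (hgrad hw)).add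
    ((contDiffOn_const.mul ((contDiffOn_const.mul ((hpair hψ hψ).mul (hw1.pow 2))).sub
      (hpair hw hw))).smul (hgrad hψ))).sub ((contDiffOn_const.mul (hw1.pow 2)).smul (hgrad hκ))

theorem isAdmissibleField_current [FiniteDimensional ℝ V] (hS : IsSymmSharp S) (hU : IsOpen U)
    (hK : IsCompact K) (hO : IsOpen O) (hUO : U ⊆ O) (hKO : K ⊆ O) (hψ : ContDiffOn ℝ 2 ψ O)
    (hκ : ContDiffOn ℝ 2 κ O) (hw : ContDiffOn ℝ 2 w U) (hw0 : ∀ x ∈ U \ K, w x = 0)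
    (hwb : IsWaveBounded S w (U ∩ K)) (lam : ℝ) :
    IsAdmissibleField U K (current S ψ κ lam w) := by
  have hzero x (hx : x ∈ U \ K) : current S ψ κ lam w =ᶠ[𝓝 x] 0 := by
    filter_upwards [(hU.sdiff hK.isClosed).mem_nhds hx] with y hy
    exact current_eq_zero
      (eventually_of_mem ((hU.sdiff hK.isClosed).mem_nhds hy) hw0) lam
  have extend {f : V → ℝ} (hf : f =O[𝓟 (U ∩ K)] (1 : V → ℝ)) (hf0 : ∀ x ∈ U \ K, f x = 0) :
      ∃ C, ∀ x ∈ U, |f x| ≤ C := by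
    obtain ⟨C, hC0, hC⟩ := hf.exists_nonneg
    refine ⟨C, fun x hxU => ?_⟩
    by_cases hxK : x ∈ K
    · simpa using eventually_principal.1 hC.bound x ⟨hxU, hxK⟩
    · simpa [hf0 x ⟨hxU, hxK⟩] using hC0
  have hψb := IsWaveBounded.of_contDiffOn (S := S) hO hK hKO hψ (inter_subset_right (s := U))
  have hκb := IsWaveBounded.of_contDiffOn (S := S) hO hK hKO hκ (inter_subset_right (s := U))
  have hψ' : fderiv ℝ (fderiv ℝ ψ) =O[𝓟 (U ∩ K)] (1 : V → ℝ) :=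
    isBigO_one_of_continuousOn hK (((hψ.fderiv_of_isOpen (m := 1) hO
      (by norm_num)).continuousOn_fderiv_of_isOpen hO le_rfl).mono hKO) inter_subset_right
  have hat {f : V → ℝ} (hf : ContDiffOn ℝ 2 f O) : ∀ q ∈ U ∩ K, ContDiffAt ℝ 2 f q :=
    fun q hq => hf.contDiffAt (hO.mem_nhds (hKO hq.2))
  refine ⟨contDiffOn_current hU (hψ.mono hUO) (hκ.mono hUO) hw lam, ?_, ?_,
    fun x hx => (hzero x hx).self_of_nhds⟩
  · simpa only [abs_norm] using extend (hψb.isBigO_current hκb hwb lam).norm_left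
      fun x hx => by simp [(hzero x hx).self_of_nhds]
  · exact extend (hψb.isBigO_divergence_current hS hψ' hκb hwb (hat hψ) (hat hκ)
      (fun q hq => hw.contDiffAt (hU.mem_nhds hq.1)) lam)
      fun x hx => divergence_eq_zero (hzero x hx)

end Bounds

section Region

variable {m n : ℕ} {T : ℝ} {Ω : Set (E n)} {p q y : ST m n} {ε σ c : ℝ}

theorem isBounded_cyl (m : ℕ) (T : ℝ) (hΩb : Bornology.IsBounded Ω) :
    Bornology.IsBounded (cyl m T Ω) := by
  refine Bornology.IsBounded.prod ?_ hΩb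
  refine (PiLp.antilipschitzWith_ofLp 2 fun _ : Fin m => ℝ).isBounded_preimage
    (Metric.isBounded_Icc (fun _ => -T) fun _ => T) |>.subset fun t ht => ?_
  exact ⟨fun i => (ht i).1.le, fun i => (ht i).2.le⟩

theorem isOpen_Dp (p : ST m n) : IsOpen (Dp p) :=
  isOpen_lt continuous_const (contDiff_fp p).continuous

theorem rp_le_Rplus (hΩb : Bornology.IsBounded Ω) (hq : q ∈ closure (cyl m T Ω ∩ Dp p)) :
    rp p q ≤ Rplus T Ω p := by
  have hbdd : BddAbove (rp p '' (cyl m T Ω ∩ Dp p)) :=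
    ((isBounded_cyl m T hΩb).isCompact_closure.bddAbove_image
      (continuous_rp p).continuousOn).mono (image_mono (inter_subset_left.trans subset_closure))
  exact closure_minimal (fun x hx => le_csSup hbdd ⟨x, hx, rfl⟩)
    (isClosed_le (continuous_rp p) continuous_const) hq

theorem mem_regular_of_mem_closure (hΩb : Bornology.IsBounded Ω) (hε : 0 < ε)
    (hεR : ε * Rplus T Ω p < 1) (hq : q ∈ closure (cyl m T Ω ∩ Dp p)) (hf : 0 < fp p q) :
    q ∈ regular ε p :=
  ⟨(norm_nonneg _).trans_lt (norm_time_lt_rp hf),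
    (mul_le_mul_of_nonneg_left (rp_le_Rplus hΩb hq) hε.le).trans_lt hεR⟩

theorem cyl_inter_Dp_subset_regular (hΩb : Bornology.IsBounded Ω) (hε : 0 < ε)
    (hεR : ε * Rplus T Ω p < 1) : cyl m T Ω ∩ Dp p ⊆ regular ε p :=
  fun _ hq => mem_regular_of_mem_closure hΩb hε hεR (subset_closure hq) hq.2

/-- The part of the closure of `𝔘 ∩ 𝔇_p` where `kp ≥ c`. The denominator of `kp` is cleared, so that
the set is visibly closed. -/
def superlevel (T : ℝ) (Ω : Set (E n)) (p : ST m n) (ε c : ℝ) : Set (ST m n) :=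
  closure (cyl m T Ω ∩ Dp p) ∩ {q | c * (1 - ε * rp p q) ≤ fp p q}

theorem isCompact_superlevel (hΩb : Bornology.IsBounded Ω) (p : ST m n) (ε c : ℝ) :
    IsCompact (superlevel T Ω p ε c) := by
  have := continuous_rp p
  exact ((isBounded_cyl m T hΩb).subset inter_subset_left).isCompact_closure.inter_right
    (isClosed_le (by fun_prop) (contDiff_fp p).continuous)

theorem fp_pos_of_mem_superlevel (hΩb : Bornology.IsBounded Ω) (hε : 0 < ε)
    (hεR : ε * Rplus T Ω p < 1) (hc : 0 < c) (hq : q ∈ superlevel T Ω p ε c) : 0 < fp p q :=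
  (mul_pos hc (sub_pos.2 ((mul_le_mul_of_nonneg_left (rp_le_Rplus hΩb hq.1) hε.le).trans_lt
    hεR))).trans_le hq.2

theorem superlevel_subset_regular (hΩb : Bornology.IsBounded Ω) (hε : 0 < ε)
    (hεR : ε * Rplus T Ω p < 1) (hc : 0 < c) : superlevel T Ω p ε c ⊆ regular ε p :=
  fun _ hq => mem_regular_of_mem_closure hΩb hε hεR hq.1
    (fp_pos_of_mem_superlevel hΩb hε hεR hc hq)

theorem superlevel_subset_cube_prod_closure
    (hG : closure (cyl m T Ω ∩ Dp p) ⊆ cube m T ×ˢ univ) :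
    superlevel T Ω p ε c ⊆ cube m T ×ˢ closure Ω := by
  intro q hq
  have hcl : q ∈ closure (cyl m T Ω) := closure_mono inter_subset_left hq.1
  rw [cyl, closure_prod_eq] at hcl
  exact ⟨(hG hq.1).1, hcl.2⟩

theorem kp_lt_of_notMem_superlevel (hreg : q ∈ regular ε p) (hq : q ∈ cyl m T Ω ∩ Dp p)
    (hqK : q ∉ superlevel T Ω p ε c) : kp ε p q < c :=
  (div_lt_iff₀ (sub_pos.2 hreg.2)).2 (not_le.1 fun h => hqK ⟨subset_closure hq, h⟩)

theorem eventually_eq_zero_of_mem_Gam {z : ST m n → ℝ} (hσ : 0 < σ)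
    (hW : ∀ q ∈ Wp T Ω p ε σ, z q = 0) (hy : y ∈ Gam T Ω p ε) (hreg : y ∈ regular ε p) :
    ∀ᶠ q in 𝓝[cyl m T Ω ∩ Dp p] y, z q = 0 := by
  obtain ⟨⟨hlat, hD⟩, ν, hν, hpos⟩ := hy
  -- `q` lies in the ball about `(q.1, y.2)`, so it is enough that the latter stays in `Γ`.
  have hslice : Tendsto (fun q : ST m n => (q.1, y.2)) (𝓝 y) (𝓝 y) :=
    (show Continuous fun q : ST m n => (q.1, y.2) by fun_prop).tendsto y
  have hcont : ContinuousAt (fun q => (1 - ε * rp p q) * fderiv ℝ (fp p) q (0, ν)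
      + ε * fp p q * fderiv ℝ (rp p) q (0, ν)) y := by
    have hr := continuous_rp p
    have hf := (contDiff_fp p).continuous
    have hf' := ((contDiff_fp p).continuous_fderiv (by simp)).clm_apply
      (continuous_const (y := ((0, ν) : ST m n)))
    have hr' := ((contDiffAt_rp hreg).continuousAt_fderiv (by simp)).clm_apply
      (continuousAt_const (y := ((0, ν) : ST m n)))
    fun_prop
  filter_upwards [nhdsWithin_le_nhds (hslice.eventually (hcont.eventually_const_lt hpos)),
    nhdsWithin_le_nhds (hslice.eventually ((isOpen_Dp p).mem_nhds hD)),
    nhdsWithin_le_nhds (continuous_snd.tendsto y (Metric.ball_mem_nhds y.2 hσ)),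
    self_mem_nhdsWithin] with q hqpos hqD hqball hq
  exact hW q ⟨mem_iUnion₂.2 ⟨(q.1, y.2), ⟨⟨⟨hq.1.1, hlat.2⟩, hqD⟩, ν, hν, hqpos⟩, rfl, hqball⟩, hq⟩

theorem fderiv_kp_normal_nonpos (hreg : y ∈ regular ε p) (hlat : y ∈ lateral m T Ω)
    (hf : 0 < fp p y) (hy : y ∉ Gam T Ω p ε) {φ : E n → ℝ} (hφ : IsDefiningAt Ω y.2 φ) :
    fderiv ℝ (kp ε p) y (0, ∇ φ y.2) ≤ 0 := by
  have hr : 0 < 1 - ε * rp p y := sub_pos.2 hreg.2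
  set ν := ‖∇ φ y.2‖⁻¹ • ∇ φ y.2 with hν
  have hGam : (1 - ε * rp p y) * fderiv ℝ (fp p) y (0, ν) + ε * fp p y * fderiv ℝ (rp p) y (0, ν)
      ≤ 0 := not_lt.1 fun h => hy ⟨⟨hlat, hf⟩, ν, ⟨φ, hφ, hν⟩, h⟩
  have hkν : fderiv ℝ (kp ε p) y (0, ν) ≤ 0 := by
    refine nonpos_of_mul_nonpos_right (a := (1 - ε * rp p y) ^ 2) ?_ (by positivity)
    calc (1 - ε * rp p y) ^ 2 * fderiv ℝ (kp ε p) y (0, ν)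
        = (1 - ε * rp p y) * ((1 - ε * rp p y) * fderiv ℝ (kp ε p) y (0, ν)) := by ring
      _ = (1 - ε * rp p y) * fderiv ℝ (fp p) y (0, ν)
          + ε * ((1 - ε * rp p y) * kp ε p y) * fderiv ℝ (rp p) y (0, ν) := by
        rw [fderiv_kp hreg]; ring
      _ ≤ 0 := by rwa [kp_mul hreg]
  have hgrad : ((0, ∇ φ y.2) : ST m n) = ‖∇ φ y.2‖ • (0, ν) := by
    simp [hν, smul_smul, norm_ne_zero_iff.2 hφ.2]
  rw [hgrad, map_smul, smul_eq_mul]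
  exact mul_nonpos_of_nonneg_of_nonpos (norm_nonneg _) hkν

end Region

section Flux

variable {m n : ℕ} {T : ℝ} {Ω : Set (E n)} {X : ST m n → ST m n} {V F z a κ : ST m n → ℝ}
  {p q : ST m n} {ε σ τ c : ℝ}

theorem IsSolution.contDiffAt {H : ST m n → ℝ} (hΩo : IsOpen Ω) (hz : IsSolution T Ω X V F H z)
    (hq : q ∈ cyl m T Ω) : ContDiffAt ℝ 2 z q :=
  hz.contDiffOn_two.contDiffAt ((isOpen_cyl m T hΩo).mem_nhds hq)

theorem gradPairing_weight_comp_snd_nonpos (hτ : 0 ≤ τ) (hreg : q ∈ regular ε p)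
    (hlat : q ∈ lateral m T Ω) (hf : 0 < fp p q) (hq : q ∉ Gam T Ω p ε) {φ : E n → ℝ}
    (hφ : IsDefiningAt Ω q.2 φ) :
    gradPairing (minkowskiSharp m n) (weight τ ε p) (fun x => φ x.2) q ≤ 0 := by
  rw [gradPairing, hφ.grad_comp_snd, show weight τ ε p = fun x => Real.exp (τ * kp ε p x) from rfl,
    fderiv_exp_mul τ ((contDiffAt_kp hreg).differentiableAt (by simp)), smul_apply, smul_eq_mul]
  exact mul_nonpos_of_nonneg_of_nonpos (by positivity) (fderiv_kp_normal_nonpos hreg hlat hf hq hφ)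

theorem IsSolution.fluxNonposAt (hz : IsSolution T Ω X V F 0 z) (hΩo : IsOpen Ω) (hσ : 0 < σ)
    (hτ : 0 ≤ τ) (hW : ∀ x ∈ Wp T Ω p ε σ, z x = 0) (hreg : q ∈ regular ε p)
    (hlat : q ∈ lateral m T Ω) (hf : 0 < fp p q) (hκ : ContDiffAt ℝ 1 κ q)
    (ha : ContDiffAt ℝ 1 a q) {φ : E n → ℝ} (hφ : IsDefiningAt Ω q.2 φ) (lam : ℝ) :
    FluxNonposAt (cyl m T Ω ∩ Dp p) (fun x => φ x.2)
      (current (minkowskiSharp m n) (weight τ ε p) κ lam fun x => a x * z x) q := by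
  have hU : IsOpen (cyl m T Ω ∩ Dp p) := (isOpen_cyl m T hΩo).inter (isOpen_Dp p)
  by_cases hq : q ∈ Gam T Ω p ε
  · refine fluxNonposAt_current_of_eventuallyEq_zero hU ?_ lam
    filter_upwards [eventually_eq_zero_of_mem_Gam hσ hW hq hreg] with x hx
    rw [hx, mul_zero]
  have hmono : 𝓝[cyl m T Ω ∩ Dp p] q ≤ 𝓝[cyl m T Ω] q := nhdsWithin_mono _ inter_subset_left
  have hz0 : Tendsto z (𝓝[cyl m T Ω ∩ Dp p] q) (𝓝 0) := by
    have hcont := hz.contDiffOn_one.continuousOn q ⟨hlat.1, frontier_subset_closure hlat.2⟩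
    rw [ContinuousWithinAt, hz.dirichlet q hlat] at hcont
    exact hcont.mono_left (hmono.trans (nhdsWithin_mono _ cyl_subset_cube_prod_closure))
  obtain ⟨r, hr⟩ := exists_tendsto_fderiv_smul hΩo hz.contDiffOn_one hz.dirichlet hlat hφ
  refine fluxNonposAt_current (r := a q * r) isSymmSharp_minkowskiSharp ?_ hκ
    (hφ.contDiffAt_comp_snd.of_le (by norm_cast)) ?_ ?_ ?_
    (gradPairing_weight_comp_snd_nonpos hτ hreg hlat hf hq hφ) lam
  · exact ((contDiffOn_weight τ ε p).contDiffAt ((isOpen_regular ε p).mem_nhds hreg)).of_le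
      (by norm_cast)
  · simpa using (ha.continuousAt.tendsto.mono_left nhdsWithin_le_nhds).mul hz0
  · rw [mul_smul]
    exact tendsto_fderiv_mul hU ha ((hz.contDiffOn_two.differentiableOn two_ne_zero).mono
      inter_subset_left) hz0 (hr.mono_left hmono)
  · rw [gradPairing, hφ.grad_comp_snd, hφ.fderiv_comp_snd]
    exact real_inner_self_nonneg

theorem IsDefiningAt.exists_nhds_cyl_inter_Dp {φ : E n → ℝ} (hφ : IsDefiningAt Ω q.2 φ)
    (hq : q.1 ∈ cube m T) (hf : 0 < fp p q) :
    ∃ N ∈ 𝓝 q, ContDiffOn ℝ 1 (fun x : ST m n => φ x.2) N ∧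
      (∀ x ∈ N, (x ∈ cyl m T Ω ∩ Dp p ↔ φ x.2 < 0)) ∧
      ∀ x ∈ N, x.1 ∈ cube m T ∧ IsDefiningAt Ω x.2 φ := by
  have hnear : ∀ᶠ x in 𝓝 q, x.1 ∈ cube m T ∧ x ∈ Dp p ∧ IsDefiningAt Ω x.2 φ := by
    filter_upwards [continuous_fst.continuousAt.eventually ((isOpen_cube m T).mem_nhds hq),
      (isOpen_Dp p).mem_nhds hf, continuous_snd.continuousAt.eventually hφ.eventually]
      with x hx hxD hxφ using ⟨hx, hxD, hxφ⟩
  refine ⟨_, hnear, fun x hx => ?_, fun x hx => ?_, fun x hx => ⟨hx.1, hx.2.2⟩⟩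
  · exact (hx.2.2.contDiffAt_comp_snd.of_le (by norm_cast)).contDiffWithinAt
  · rw [← hx.2.2.mem_iff]
    exact ⟨fun h => h.1.2, fun h => ⟨⟨hx.1, h⟩, hx.2.1⟩⟩

end Flux

section LocalizedCurrent

variable {m n : ℕ} {T : ℝ} {Ω : Set (E n)} {z μ : ST m n → ℝ} {p q : ST m n} {ε τ c : ℝ}

/-- A cutoff which vanishes where `kp ≤ c` and equals `1` where `kp ≥ 2c`. -/
noncomputable def cutoff (ε : ℝ) (p : ST m n) (c : ℝ) (q : ST m n) : ℝ :=
  Real.smoothTransition ((kp ε p q - c) / c)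

theorem contDiffOn_cutoff (ε : ℝ) (p : ST m n) (c : ℝ) :
    ContDiffOn ℝ ∞ (cutoff ε p c) (regular ε p) :=
  Real.smoothTransition.contDiff.comp_contDiffOn
    (((contDiffOn_kp ε p).sub contDiffOn_const).div_const c)

theorem cutoff_eq_zero (hc : 0 < c) (hk : kp ε p q ≤ c) : cutoff ε p c q = 0 :=
  Real.smoothTransition.zero_of_nonpos (div_nonpos_of_nonpos_of_nonneg (sub_nonpos.2 hk) hc.le)

theorem cutoff_eventuallyEq_one (hc : 0 < c) (hq : q ∈ regular ε p) (hk : 2 * c < kp ε p q) :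
    cutoff ε p c =ᶠ[𝓝 q] 1 := by
  filter_upwards [(contDiffAt_kp hq).continuousAt.eventually_const_lt hk] with x hx
  exact Real.smoothTransition.one_of_one_le ((one_le_div hc).2 (by linarith))

/-- The current of the conjugated function `exp (lam * ψ) * cutoff * z`, where `ψ` is the Carleman
weight, with the multiplier that the Carleman estimate prescribes for `ψ`. -/
noncomputable def localizedCurrent (τ ε : ℝ) (p : ST m n) (μ : ST m n → ℝ) (c lam : ℝ)
    (z : ST m n → ℝ) : ST m n → ST m n :=
  current (minkowskiSharp m n) (weight τ ε p)
    (fun x => waveOp (minkowskiSharp m n) (weight τ ε p) x / 2 - μ x) lam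
    fun x => Real.exp (lam * weight τ ε p x) * (cutoff ε p c x * z x)

theorem contDiffOn_multiplier (τ : ℝ) (hμ : ContDiffOn ℝ 2 μ (regular ε p)) :
    ContDiffOn ℝ 2 (fun x => waveOp (minkowskiSharp m n) (weight τ ε p) x / 2 - μ x)
      (regular ε p) :=
  ((contDiffOn_waveOp (isOpen_regular ε p) (contDiffOn_weight τ ε p) (by norm_cast)).div_const
    2).sub hμ

theorem isWaveBounded_cutoff_mul (hΩo : IsOpen Ω) (hΩb : Bornology.IsBounded Ω) (hε : 0 < ε)
    (hεR : ε * Rplus T Ω p < 1) (hc : 0 < c) (hz2 : ContDiffOn ℝ 2 z (cyl m T Ω ∩ Dp p))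
    (hzb : IsWaveBounded (minkowskiSharp m n) z (cyl m T Ω ∩ Dp p ∩ superlevel T Ω p ε c)) :
    IsWaveBounded (minkowskiSharp m n) (fun x => cutoff ε p c x * z x)
      (cyl m T Ω ∩ Dp p ∩ superlevel T Ω p ε c) := by
  have hU : IsOpen (cyl m T Ω ∩ Dp p) := (isOpen_cyl m T hΩo).inter (isOpen_Dp p)
  have hKr := superlevel_subset_regular (T := T) hΩb hε hεR hc
  have hζ : ContDiffOn ℝ 2 (cutoff ε p c) (regular ε p) :=
    (contDiffOn_cutoff ε p c).of_le (by norm_cast)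
  exact (IsWaveBounded.of_contDiffOn (isOpen_regular ε p) (isCompact_superlevel hΩb p ε c) hKr hζ
    inter_subset_right).mul isSymmSharp_minkowskiSharp hzb
      (fun x hx => hζ.contDiffAt ((isOpen_regular ε p).mem_nhds (hKr hx.2)))
      fun x hx => hz2.contDiffAt (hU.mem_nhds hx.1)

theorem isAdmissibleField_localizedCurrent (hΩo : IsOpen Ω) (hΩb : Bornology.IsBounded Ω)
    (hε : 0 < ε) (hεR : ε * Rplus T Ω p < 1) (hc : 0 < c) (hμ : ContDiffOn ℝ 2 μ (regular ε p))
    (hz2 : ContDiffOn ℝ 2 z (cyl m T Ω ∩ Dp p))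
    (hzb : IsWaveBounded (minkowskiSharp m n) z (cyl m T Ω ∩ Dp p ∩ superlevel T Ω p ε c))
    (lam : ℝ) :
    IsAdmissibleField (cyl m T Ω ∩ Dp p) (superlevel T Ω p ε c)
      (localizedCurrent τ ε p μ c lam z) := by
  have hO := isOpen_regular ε p
  have hU : IsOpen (cyl m T Ω ∩ Dp p) := (isOpen_cyl m T hΩo).inter (isOpen_Dp p)
  have hUr := cyl_inter_Dp_subset_regular (T := T) hΩb hε hεR
  have hK := isCompact_superlevel (T := T) hΩb p ε c
  have hKr := superlevel_subset_regular (T := T) hΩb hε hεR hc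
  have hψ : ContDiffOn ℝ 2 (weight τ ε p) (regular ε p) :=
    (contDiffOn_weight τ ε p).of_le (by norm_cast)
  have hexp : ContDiffOn ℝ 2 (fun x => Real.exp (lam * weight τ ε p x)) (regular ε p) :=
    (contDiffOn_const.mul hψ).exp
  have hζ : ContDiffOn ℝ 2 (cutoff ε p c) (regular ε p) :=
    (contDiffOn_cutoff ε p c).of_le (by norm_cast)
  have hu : ContDiffOn ℝ 2 (fun x => cutoff ε p c x * z x) (cyl m T Ω ∩ Dp p) :=
    (hζ.mono hUr).mul hz2
  refine isAdmissibleField_current isSymmSharp_minkowskiSharp hU hK hO hUr hKr hψ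
    (contDiffOn_multiplier τ hμ) ((hexp.mono hUr).mul hu) (fun x hx => ?_) ?_ lam
  · rw [cutoff_eq_zero hc (kp_lt_of_notMem_superlevel (hUr hx.1) hx.1 hx.2).le, zero_mul, mul_zero]
  · exact (IsWaveBounded.of_contDiffOn hO hK hKr hexp inter_subset_right).mul
      isSymmSharp_minkowskiSharp (isWaveBounded_cutoff_mul hΩo hΩb hε hεR hc hz2 hzb)
      (fun x hx => hexp.contDiffAt (hO.mem_nhds (hKr hx.2)))
      fun x hx => hu.contDiffAt (hU.mem_nhds hx.1)

theorem exists_carleman_localizedCurrent (hΩb : Bornology.IsBounded Ω) (hε : 0 < ε)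
    (hεR : ε * Rplus T Ω p < 1) (hc : 0 < c) (hμ : ContDiffOn ℝ 2 μ (regular ε p))
    (hψ : IsPseudoconvexOn (minkowskiSharp m n) (weight τ ε p) μ (superlevel T Ω p ε c)) :
    ∃ c₁ > 0, ∃ lam₀ ≥ 1, ∀ lam ≥ lam₀, ∀ q ∈ superlevel T Ω p ε c, ∀ z,
      ContDiffAt ℝ 2 z q → Real.exp (lam * weight τ ε p q) ^ 2 *
        (c₁ * (‖fderiv ℝ (fun x => cutoff ε p c x * z x) q‖ ^ 2
            + lam ^ 2 * (cutoff ε p c q * z q) ^ 2)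
          - waveOp (minkowskiSharp m n) (fun x => cutoff ε p c x * z x) q ^ 2 / lam)
        ≤ divergence (localizedCurrent τ ε p μ c lam z) q := by
  have hKr := superlevel_subset_regular (T := T) hΩb hε hεR hc
  obtain ⟨c₁, hc₁, lam₀, hlam₀, hcarleman⟩ := hψ.exists_carleman isSymmSharp_minkowskiSharp
    (isOpen_regular ε p) (isCompact_superlevel hΩb p ε c) hKr
    ((contDiffOn_weight τ ε p).of_le (by norm_cast)) hμ
  refine ⟨c₁, hc₁, lam₀, hlam₀, fun lam hlam q hq z hz => hcarleman lam hlam q hq _ (.mul ?_ hz)⟩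
  exact ((contDiffOn_cutoff ε p c).contDiffAt ((isOpen_regular ε p).mem_nhds (hKr hq))).of_le
    (by norm_cast)

theorem half_mul_le_of_le_mul {c₁ C lam A P u : ℝ} (hc₁ : 0 < c₁) (hlam : 1 ≤ lam)
    (hC : 2 * C / c₁ ≤ lam) (hA : 0 ≤ A) (hP : P ≤ C * (A + u ^ 2)) :
    c₁ / 2 * (lam ^ 2 * u ^ 2) ≤ c₁ * (A + lam ^ 2 * u ^ 2) - P / lam := by
  have hlam0 : 0 < lam := one_pos.trans_le hlam
  have hC' : C ≤ c₁ / 2 * lam := by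
    rw [div_le_iff₀ hc₁] at hC
    linarith
  have hP' : P / lam ≤ c₁ / 2 * (A + lam ^ 2 * u ^ 2) := by
    rw [div_le_iff₀ hlam0]
    calc P ≤ C * (A + u ^ 2) := hP
      _ ≤ c₁ / 2 * lam * (A + lam ^ 2 * u ^ 2) := by
        gcongr
        exact le_mul_of_one_le_left (sq_nonneg u) (one_le_pow₀ hlam)
      _ = c₁ / 2 * (A + lam ^ 2 * u ^ 2) * lam := by ring
  linarith [mul_nonneg hc₁.le hA]

theorem exists_sq_le_divergence_localizedCurrent (hΩo : IsOpen Ω) (hΩb : Bornology.IsBounded Ω)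
    (hε : 0 < ε) (hεR : ε * Rplus T Ω p < 1) (hc : 0 < c) (hμ : ContDiffOn ℝ 2 μ (regular ε p))
    (hψ : IsPseudoconvexOn (minkowskiSharp m n) (weight τ ε p) μ (superlevel T Ω p ε c))
    (hz2 : ContDiffOn ℝ 2 z (cyl m T Ω ∩ Dp p)) {C : ℝ} (hzC : ∀ q ∈ cyl m T Ω ∩ Dp p,
      waveOp (minkowskiSharp m n) z q ^ 2 ≤ C * (‖fderiv ℝ z q‖ ^ 2 + z q ^ 2)) :
    ∃ c₁ > 0, ∃ lam₀, ∀ lam ≥ lam₀, ∀ q ∈ cyl m T Ω ∩ Dp p, 2 * c < kp ε p q →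
      Real.exp (lam * weight τ ε p q) ^ 2 * (c₁ * (lam ^ 2 * z q ^ 2))
        ≤ divergence (localizedCurrent τ ε p μ c lam z) q := by
  obtain ⟨c₁, hc₁, lam₀, hlam₀, hcarleman⟩ :=
    exists_carleman_localizedCurrent hΩb hε hεR hc hμ hψ
  refine ⟨c₁ / 2, half_pos hc₁, max lam₀ (2 * C / c₁), fun lam hlam q hq hk => ?_⟩
  have hreg := cyl_inter_Dp_subset_regular hΩb hε hεR hq
  have hqK : q ∈ superlevel T Ω p ε c := by
    by_contra hqK
    linarith [kp_lt_of_notMem_superlevel hreg hq hqK]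
  have hu : (fun x => cutoff ε p c x * z x) =ᶠ[𝓝 q] z := by
    filter_upwards [cutoff_eventuallyEq_one hc hreg hk] with x hx
    rw [hx, Pi.one_apply, one_mul]
  have hest := hcarleman lam (le_of_max_le_left hlam) q hqK z
    (hz2.contDiffAt (((isOpen_cyl m T hΩo).inter (isOpen_Dp p)).mem_nhds hq))
  rw [waveOp_congr hu, hu.fderiv_eq,
    show cutoff ε p c q * z q = z q from hu.self_of_nhds] at hest
  exact (mul_le_mul_of_nonneg_left (half_mul_le_of_le_mul hc₁ (hlam₀.trans (le_of_max_le_left hlam))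
    (le_of_max_le_right hlam) (sq_nonneg _) (hzC q hq)) (sq_nonneg _)).trans hest

theorem exists_neg_le_divergence_localizedCurrent (hΩo : IsOpen Ω) (hΩb : Bornology.IsBounded Ω)
    (hε : 0 < ε) (hεR : ε * Rplus T Ω p < 1) (hc : 0 < c) (hτ : 0 ≤ τ)
    (hμ : ContDiffOn ℝ 2 μ (regular ε p))
    (hψ : IsPseudoconvexOn (minkowskiSharp m n) (weight τ ε p) μ (superlevel T Ω p ε c))
    (hz2 : ContDiffOn ℝ 2 z (cyl m T Ω ∩ Dp p))
    (hzb : IsWaveBounded (minkowskiSharp m n) z (cyl m T Ω ∩ Dp p ∩ superlevel T Ω p ε c)) :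
    ∃ C ≥ 0, ∃ lam₀ ≥ 1, ∀ lam ≥ lam₀, ∀ q ∈ cyl m T Ω ∩ Dp p, kp ε p q ≤ 2 * c →
      -(Real.exp (lam * Real.exp (τ * (2 * c))) ^ 2 * C)
        ≤ divergence (localizedCurrent τ ε p μ c lam z) q := by
  obtain ⟨c₁, hc₁, lam₀, hlam₀, hcarleman⟩ :=
    exists_carleman_localizedCurrent hΩb hε hεR hc hμ hψ
  have hU : IsOpen (cyl m T Ω ∩ Dp p) := (isOpen_cyl m T hΩo).inter (isOpen_Dp p)
  obtain ⟨C, hC⟩ := (isWaveBounded_cutoff_mul hΩo hΩb hε hεR hc hz2 hzb).isBigO_waveOp.bound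
  refine ⟨C ^ 2, sq_nonneg C, lam₀, hlam₀, fun lam hlam q hq hk => ?_⟩
  by_cases hqK : q ∈ superlevel T Ω p ε c
  · have hlam1 : 1 ≤ lam := hlam₀.trans hlam
    have hwave := eventually_principal.1 hC q ⟨hq, hqK⟩
    simp only [Real.norm_eq_abs, Pi.one_apply, abs_one, mul_one] at hwave
    refine le_trans ?_ (hcarleman lam hlam q hqK z (hz2.contDiffAt (hU.mem_nhds hq)))
    have hexp : Real.exp (lam * weight τ ε p q) ≤ Real.exp (lam * Real.exp (τ * (2 * c))) := by
      unfold weight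
      gcongr
    calc -(Real.exp (lam * Real.exp (τ * (2 * c))) ^ 2 * C ^ 2)
        ≤ -(Real.exp (lam * weight τ ε p q) ^ 2 * C ^ 2) := by gcongr
      _ = Real.exp (lam * weight τ ε p q) ^ 2 * -C ^ 2 := (mul_neg _ _).symm
      _ ≤ _ := by
        gcongr
        have := (div_le_self (sq_nonneg _) hlam1).trans (sq_le_sq.2 (hwave.trans (le_abs_self C)))
        have : 0 ≤ c₁ * (‖fderiv ℝ (fun x => cutoff ε p c x * z x) q‖ ^ 2
          + lam ^ 2 * (cutoff ε p c q * z q) ^ 2) := by positivity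
        linarith
  · rw [divergence_eq_zero ((isAdmissibleField_localizedCurrent hΩo hΩb hε hεR hc hμ hz2 hzb
      lam).eventuallyEq_zero hU (isCompact_superlevel hΩb p ε c).isClosed ⟨hq, hqK⟩)]
    exact neg_nonpos.2 (by positivity)

end LocalizedCurrent

section Uniqueness

variable {m n : ℕ} {T : ℝ} {Ω : Set (E n)} {X : ST m n → ST m n} {V z μ : ST m n → ℝ}
  {p q : ST m n} {ε σ τ c : ℝ}

theorem IsSolution.waveOp_eq (hΩo : IsOpen Ω) (hz : IsSolution T Ω X V 0 0 z)
    (hq : q ∈ cyl m T Ω) :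
    waveOp (minkowskiSharp m n) z q = -(fderiv ℝ z q (X q) + V q * z q) := by
  have h := hz.equation q hq
  rw [box_eq_waveOp (hz.contDiffAt hΩo hq), add_assoc] at h
  exact eq_neg_of_add_eq_zero_left h

theorem IsSolution.exists_waveOp_sq_le (hΩo : IsOpen Ω) (hΩb : Bornology.IsBounded Ω)
    (hX : ContinuousOn X (closure (cyl m T Ω))) (hV : ContinuousOn V (closure (cyl m T Ω)))
    (hz : IsSolution T Ω X V 0 0 z) :
    ∃ C, ∀ q ∈ cyl m T Ω,
      waveOp (minkowskiSharp m n) z q ^ 2 ≤ C * (‖fderiv ℝ z q‖ ^ 2 + z q ^ 2) := by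
  have hcpt : IsCompact (closure (cyl m T Ω)) := (isBounded_cyl m T hΩb).isCompact_closure
  obtain ⟨A, hA⟩ := hcpt.exists_bound_of_continuousOn hX
  obtain ⟨B, hB⟩ := hcpt.exists_bound_of_continuousOn hV
  refine ⟨2 * (A ^ 2 + B ^ 2), fun q hq => ?_⟩
  have hXq : fderiv ℝ z q (X q) ^ 2 ≤ A ^ 2 * ‖fderiv ℝ z q‖ ^ 2 := by
    rw [← mul_pow, ← sq_abs, mul_comm A]
    gcongr
    exact ((fderiv ℝ z q).le_opNorm _).trans (by gcongr; exact hA q (subset_closure hq))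
  have hVq : (V q * z q) ^ 2 ≤ B ^ 2 * z q ^ 2 := by
    rw [mul_pow, ← sq_abs (V q)]
    gcongr
    exact hB q (subset_closure hq)
  rw [hz.waveOp_eq hΩo hq, neg_sq]
  nlinarith [add_sq_le (a := fderiv ℝ z q (X q)) (b := V q * z q),
    mul_nonneg (sq_nonneg A) (sq_nonneg (z q)),
    mul_nonneg (sq_nonneg B) (sq_nonneg ‖fderiv ℝ z q‖)]

theorem IsSolution.isWaveBounded (hΩo : IsOpen Ω) (hΩb : Bornology.IsBounded Ω)
    (hX : ContinuousOn X (closure (cyl m T Ω))) (hV : ContinuousOn V (closure (cyl m T Ω)))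
    (hz : IsSolution T Ω X V 0 0 z) {K : Set (ST m n)} (hK : IsCompact K)
    (hKs : K ⊆ cube m T ×ˢ closure Ω) :
    IsWaveBounded (minkowskiSharp m n) z (cyl m T Ω ∩ K) := by
  have hcpt : IsCompact (closure (cyl m T Ω)) := (isBounded_cyl m T hΩb).isCompact_closure
  have hsub : cyl m T Ω ∩ K ⊆ closure (cyl m T Ω) := inter_subset_left.trans subset_closure
  have hz0 := isBigO_one_of_forall_exists_tendsto hK fun q hq => ⟨z q,
    (hz.contDiffOn_one.continuousOn q (hKs hq)).mono cyl_subset_cube_prod_closure⟩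
  have hz1 := isBigO_one_of_forall_exists_tendsto hK fun q hq =>
    (exists_tendsto_fderiv hΩo hz.contDiffOn_one (hKs hq)).imp fun _ hL => hL.2
  refine ⟨hz0, hz1, ?_⟩
  refine ((isBigO_one_clm_apply hz1 (isBigO_one_of_continuousOn hcpt hX hsub)).add
    (isBigO_one_mul (isBigO_one_of_continuousOn hcpt hV hsub) hz0)).neg_left.congr' ?_ .rfl
  exact eventually_principal.2 fun q hq => (hz.waveOp_eq hΩo hq.1).symm

instance : (volume : Measure (ST m n)).IsAddHaarMeasure := by
  rw [Measure.volume_eq_prod]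
  infer_instance

theorem IsSolution.setIntegral_divergence_localizedCurrent_nonpos {F : ST m n → ℝ}
    (hΩo : IsOpen Ω) (hΩb : Bornology.IsBounded Ω) (hΩs : HasSmoothBoundary Ω)
    (hG : closure (cyl m T Ω ∩ Dp p) ⊆ cube m T ×ˢ univ) (hε : 0 < ε)
    (hεR : ε * Rplus T Ω p < 1) (hc : 0 < c) (hτ : 0 ≤ τ) (hσ : 0 < σ)
    (hμ : ContDiffOn ℝ 2 μ (regular ε p)) (hz : IsSolution T Ω X V F 0 z)
    (hW : ∀ q ∈ Wp T Ω p ε σ, z q = 0) {lam : ℝ}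
    (hJ : IsAdmissibleField (cyl m T Ω ∩ Dp p) (superlevel T Ω p ε c)
      (localizedCurrent τ ε p μ c lam z)) :
    ∫ q in cyl m T Ω ∩ Dp p, divergence (localizedCurrent τ ε p μ c lam z) q ≤ 0 := by
  have hU : IsOpen (cyl m T Ω ∩ Dp p) := (isOpen_cyl m T hΩo).inter (isOpen_Dp p)
  have hKr := superlevel_subset_regular (T := T) hΩb hε hεR hc
  have hKs := superlevel_subset_cube_prod_closure (ε := ε) (c := c) hG
  have hKf {q} (hq : q ∈ superlevel T Ω p ε c) := fp_pos_of_mem_superlevel hΩb hε hεR hc hq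
  refine setIntegral_divergence_nonpos hU (isCompact_superlevel hΩb p ε c) hJ fun q hq => ?_
  have hqΩ : q.2 ∉ Ω := fun h => hq.2 ⟨⟨(hKs hq.1).1, h⟩, hKf hq.1⟩
  obtain ⟨φ, hφ⟩ := hΩs q.2 (hΩo.frontier_eq ▸ ⟨(hKs hq.1).2, hqΩ⟩)
  obtain ⟨N, hN, hφN, hiff, hdef⟩ := hφ.exists_nhds_cyl_inter_Dp (hKs hq.1).1 (hKf hq.1)
  refine ⟨_, N, hN, hφN, hiff, hφ.fderiv_comp_snd_ne_zero, fun y hyN hyK hy => ?_⟩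
  obtain ⟨hy1, hyφ⟩ := hdef y hyN
  have hyO := (isOpen_regular ε p).mem_nhds (hKr hyK)
  have hκ := ((contDiffOn_multiplier τ hμ).contDiffAt hyO).of_le (m := 1) (by norm_num)
  have ha : ContDiffAt ℝ 1 (fun x => Real.exp (lam * weight τ ε p x) * cutoff ε p c x) y :=
    (((contDiffAt_const.mul ((contDiffOn_weight τ ε p).contDiffAt hyO)).exp).mul
      ((contDiffOn_cutoff ε p c).contDiffAt hyO)).of_le (by norm_cast)
  simpa only [localizedCurrent, mul_assoc] using hz.fluxNonposAt hΩo hσ hτ hW (hKr hyK)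
    ⟨hy1, (hyφ.mem_frontier_iff hΩo).2 hy⟩ (hKf hyK) hκ ha hyφ lam

theorem mul_measureReal_le_of_setIntegral_nonpos {α : Type*} [MeasurableSpace α] {ρ : Measure α}
    {U B : Set α} {D : α → ℝ} {a b : ℝ} (hU : MeasurableSet U) (hUfin : ρ U ≠ ⊤)
    (hB : MeasurableSet B) (hBU : B ⊆ U) (hD : IntegrableOn D U ρ) (hint : ∫ x in U, D x ∂ρ ≤ 0)
    (hle : ∀ x ∈ U, B.indicator (fun _ => a) x - b ≤ D x) : a * ρ.real B ≤ b * ρ.real U := by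
  have ha : IntegrableOn (B.indicator fun _ => a) U ρ := (integrableOn_const hUfin).indicator hB
  have hb : IntegrableOn (fun _ => b) U ρ := integrableOn_const hUfin
  have h := (setIntegral_mono_on (ha.sub hb) hD hU hle).trans hint
  simp only [Pi.sub_apply] at h
  rw [integral_sub ha hb, setIntegral_const, setIntegral_indicator hB,
    inter_eq_self_of_subset_right hBU, setIntegral_const, smul_eq_mul, smul_eq_mul] at h
  linarith

theorem nonpos_of_forall_sq_mul_le {lam₀ D R : ℝ} (h : ∀ lam ≥ lam₀, lam ^ 2 * D ≤ R) : D ≤ 0 := by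
  by_contra! hD
  obtain ⟨lam, hlam, hlt⟩ := (((tendsto_pow_atTop two_ne_zero).atTop_mul_const hD
    |>.eventually_gt_atTop R).and (eventually_ge_atTop lam₀)).exists
  exact (h lam hlt).not_gt hlam

/-- The part of `𝔘 ∩ 𝔇_p` on which `kp > 2c`, so that the cutoff is `1`, and `z² > s`. -/
def largeSet (T : ℝ) (Ω : Set (E n)) (p : ST m n) (ε c : ℝ) (z : ST m n → ℝ) (s : ℝ) :
    Set (ST m n) :=
  cyl m T Ω ∩ Dp p ∩ {q | 2 * c < kp ε p q ∧ s < z q ^ 2}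

theorem isOpen_largeSet (hΩo : IsOpen Ω) (hreg : cyl m T Ω ∩ Dp p ⊆ regular ε p)
    (hz : ContinuousOn z (cyl m T Ω ∩ Dp p)) (c s : ℝ) : IsOpen (largeSet T Ω p ε c z s) :=
  (((contDiffOn_kp ε p).continuousOn.mono hreg).prodMk (hz.pow 2)).isOpen_inter_preimage
    ((isOpen_cyl m T hΩo).inter (isOpen_Dp p)) (isOpen_Ioi.prod isOpen_Ioi)

theorem exists_indicator_sub_le_divergence_localizedCurrent (hΩo : IsOpen Ω)
    (hΩb : Bornology.IsBounded Ω) (hε : 0 < ε) (hεR : ε * Rplus T Ω p < 1) (hc : 0 < c)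
    (hτ : 0 ≤ τ) (hμ : ContDiffOn ℝ 2 μ (regular ε p))
    (hψ : IsPseudoconvexOn (minkowskiSharp m n) (weight τ ε p) μ (superlevel T Ω p ε c))
    (hz2 : ContDiffOn ℝ 2 z (cyl m T Ω ∩ Dp p))
    (hzb : IsWaveBounded (minkowskiSharp m n) z (cyl m T Ω ∩ Dp p ∩ superlevel T Ω p ε c))
    {C : ℝ} (hzC : ∀ q ∈ cyl m T Ω ∩ Dp p,
      waveOp (minkowskiSharp m n) z q ^ 2 ≤ C * (‖fderiv ℝ z q‖ ^ 2 + z q ^ 2))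
    {s : ℝ} (hs : 0 ≤ s) :
    ∃ c₁ > 0, ∃ R, ∃ lam₀, ∀ lam ≥ lam₀, ∃ A > 0, ∀ q ∈ cyl m T Ω ∩ Dp p,
      (largeSet T Ω p ε c z s).indicator (fun _ => A * (c₁ * (lam ^ 2 * s))) q - A * R
        ≤ divergence (localizedCurrent τ ε p μ c lam z) q := by
  obtain ⟨c₁, hc₁, lam₁, hlarge⟩ :=
    exists_sq_le_divergence_localizedCurrent hΩo hΩb hε hεR hc hμ hψ hz2 hzC
  obtain ⟨R, hR, lam₂, hlam₂, hsmall⟩ :=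
    exists_neg_le_divergence_localizedCurrent hΩo hΩb hε hεR hc hτ hμ hψ hz2 hzb
  refine ⟨c₁, hc₁, R, max lam₁ lam₂, fun lam hlam =>
    ⟨Real.exp (lam * Real.exp (τ * (2 * c))) ^ 2, by positivity, fun q hq => ?_⟩⟩
  have hlam0 : 0 ≤ lam := zero_le_one.trans (hlam₂.trans (le_of_max_le_right hlam))
  rcases le_or_gt (kp ε p q) (2 * c) with hk | hk
  · rw [indicator_of_notMem fun h => h.2.1.not_ge hk, zero_sub]
    exact hsmall lam (le_of_max_le_right hlam) q hq hk
  have hdiv := hlarge lam (le_of_max_le_left hlam) q hq hk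
  rw [sub_le_iff_le_add]
  refine le_add_of_le_of_nonneg (le_trans (indicator_apply_le' (fun hqB => ?_) fun _ => ?_) hdiv)
    (by positivity)
  · unfold weight
    gcongr
    exact hqB.2.2.le
  · positivity

theorem IsSolution.volume_largeSet_eq_zero (hΩo : IsOpen Ω) (hΩb : Bornology.IsBounded Ω)
    (hΩs : HasSmoothBoundary Ω) (hG : closure (cyl m T Ω ∩ Dp p) ⊆ cube m T ×ˢ univ) (hε : 0 < ε)
    (hεR : ε * Rplus T Ω p < 1) (hσ : 0 < σ) (hX : ContinuousOn X (closure (cyl m T Ω)))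
    (hV : ContinuousOn V (closure (cyl m T Ω))) (hz : IsSolution T Ω X V 0 0 z)
    (hW : ∀ q ∈ Wp T Ω p ε σ, z q = 0) (hc : 0 < c) {s : ℝ} (hs : 0 < s) :
    volume (largeSet T Ω p ε c z s) = 0 := by
  have hU : IsOpen (cyl m T Ω ∩ Dp p) := (isOpen_cyl m T hΩo).inter (isOpen_Dp p)
  have hUfin : volume (cyl m T Ω ∩ Dp p) < ⊤ :=
    ((isBounded_cyl m T hΩb).subset inter_subset_left).measure_lt_top
  have hz2 : ContDiffOn ℝ 2 z (cyl m T Ω ∩ Dp p) := hz.contDiffOn_two.mono inter_subset_left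
  have hB := isOpen_largeSet hΩo (cyl_inter_Dp_subset_regular hΩb hε hεR) hz2.continuousOn c s
  have hBU : largeSet T Ω p ε c z s ⊆ cyl m T Ω ∩ Dp p := inter_subset_left
  have hK := isCompact_superlevel (T := T) hΩb p ε c
  obtain ⟨τ, hτ, μ, hμ, hψ⟩ := exists_isPseudoconvexOn_weight hε hK
    (superlevel_subset_regular hΩb hε hεR hc) fun q => fp_pos_of_mem_superlevel hΩb hε hεR hc
  have hμ2 : ContDiffOn ℝ 2 μ (regular ε p) := hμ.of_le (by norm_cast)
  have hzb := (hz.isWaveBounded hΩo hΩb hX hV hK (superlevel_subset_cube_prod_closure hG)).mono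
    (inter_subset_inter_left _ (inter_subset_left (t := Dp p)))
  obtain ⟨C, hC⟩ := hz.exists_waveOp_sq_le hΩo hΩb hX hV
  obtain ⟨c₁, hc₁, R, lam₀, hlow⟩ := exists_indicator_sub_le_divergence_localizedCurrent hΩo hΩb hε
    hεR hc hτ.le hμ2 hψ hz2 hzb (fun q hq => hC q hq.1) hs.le
  rw [← measureReal_eq_zero_iff (measure_ne_top_of_subset hBU hUfin.ne)]
  suffices h : ∀ lam ≥ lam₀, lam ^ 2 * (c₁ * s * volume.real (largeSet T Ω p ε c z s))
      ≤ R * volume.real (cyl m T Ω ∩ Dp p) from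
    le_antisymm (nonpos_of_mul_nonpos_right (nonpos_of_forall_sq_mul_le h) (mul_pos hc₁ hs))
      measureReal_nonneg
  intro lam hlam
  obtain ⟨A, hA, hle⟩ := hlow lam hlam
  have hJ := isAdmissibleField_localizedCurrent (τ := τ) hΩo hΩb hε hεR hc hμ2 hz2 hzb lam
  have hint := hz.setIntegral_divergence_localizedCurrent_nonpos hΩo hΩb hΩs hG hε hεR hc hτ.le hσ
    hμ2 hW hJ
  have hmass := mul_measureReal_le_of_setIntegral_nonpos hU.measurableSet hUfin.ne
    hB.measurableSet hBU (hJ.integrableOn_divergence hU hK) hint hle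
  refine le_of_mul_le_mul_left ?_ hA
  linear_combination hmass

theorem IsSolution.eq_zero_of_observation (hΩo : IsOpen Ω) (hΩb : Bornology.IsBounded Ω)
    (hΩs : HasSmoothBoundary Ω) (hG : closure (cyl m T Ω ∩ Dp p) ⊆ cube m T ×ˢ univ) (hε : 0 < ε)
    (hεR : ε * Rplus T Ω p < 1) (hσ : 0 < σ) (hX : ContinuousOn X (closure (cyl m T Ω)))
    (hV : ContinuousOn V (closure (cyl m T Ω))) (hz : IsSolution T Ω X V 0 0 z)
    (hW : ∀ q ∈ Wp T Ω p ε σ, z q = 0) (hq : q ∈ cyl m T Ω ∩ Dp p) : z q = 0 := by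
  by_contra hne
  have hUr := cyl_inter_Dp_subset_regular (T := T) hΩb hε hεR
  have hkq : 0 < kp ε p q := kp_pos (hUr hq) hq.2
  obtain ⟨c, hc, hcq⟩ : ∃ c > 0, 2 * c < kp ε p q := ⟨kp ε p q / 3, by positivity, by linarith⟩
  obtain ⟨s, hs, hsq⟩ : ∃ s > 0, s < z q ^ 2 := exists_between (by positivity)
  have hB := isOpen_largeSet hΩo hUr (hz.contDiffOn_two.continuousOn.mono inter_subset_left) c s
  exact (hB.measure_pos volume ⟨q, hq, hcq, hsq⟩).ne'
    (hz.volume_largeSet_eq_zero hΩo hΩb hΩs hG hε hεR hσ hX hV hW hc hs)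

theorem IsSolution.sub {F H z₁ z₂ : ST m n → ℝ} (hΩo : IsOpen Ω) (hz₁ : IsSolution T Ω X V F H z₁)
    (hz₂ : IsSolution T Ω X V F H z₂) : IsSolution T Ω X V 0 0 (fun q => z₁ q - z₂ q) where
  contDiffOn_two := hz₁.contDiffOn_two.sub hz₂.contDiffOn_two
  contDiffOn_one := hz₁.contDiffOn_one.sub hz₂.contDiffOn_one
  equation q hq := by
    have h₁ := hz₁.contDiffAt hΩo hq
    have h₂ := hz₂.contDiffAt hΩo hq
    have e₁ := hz₁.equation q hq
    have e₂ := hz₂.equation q hq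
    rw [box_eq_waveOp h₁] at e₁
    rw [box_eq_waveOp h₂] at e₂
    rw [box_eq_waveOp (h₁.sub h₂), waveOp_sub h₁ h₂, fderiv_fun_sub
      (h₁.differentiableAt two_ne_zero) (h₂.differentiableAt two_ne_zero), sub_apply,
      Pi.zero_apply]
    linear_combination e₁ - e₂
  dirichlet q hq := by rw [hz₁.dirichlet q hq, hz₂.dirichlet q hq, sub_self, Pi.zero_apply]

end Uniqueness

end Ultrahyperbolic

theorem theorem4p2_general {m n : ℕ} {T : ℝ} {Ω : Set (Ultrahyperbolic.E n)} (hΩo : IsOpen Ω)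
    (hΩb : Bornology.IsBounded Ω) (hΩs : Ultrahyperbolic.HasSmoothBoundary Ω)
    {p : Ultrahyperbolic.ST m n}
    (hG : closure (Ultrahyperbolic.cyl m T Ω ∩ Ultrahyperbolic.Dp p) ⊆
      Ultrahyperbolic.cube m T ×ˢ (univ : Set (Ultrahyperbolic.E n)))
    {X : Ultrahyperbolic.ST m n → Ultrahyperbolic.ST m n} {V F H : Ultrahyperbolic.ST m n → ℝ}
    (hX : ContinuousOn X (closure (Ultrahyperbolic.cyl m T Ω)))
    (hV : ContinuousOn V (closure (Ultrahyperbolic.cyl m T Ω))) {ε σ : ℝ} (hε : 0 < ε)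
    (hεR : ε * Ultrahyperbolic.Rplus T Ω p < 1) (hσ : 0 < σ) {z₁ z₂ : Ultrahyperbolic.ST m n → ℝ}
    (hz₁ : Ultrahyperbolic.IsSolution T Ω X V F H z₁)
    (hz₂ : Ultrahyperbolic.IsSolution T Ω X V F H z₂)
    (hW : ∀ q ∈ Ultrahyperbolic.Wp T Ω p ε σ, z₁ q = z₂ q) :
    ∀ q ∈ Ultrahyperbolic.cyl m T Ω ∩ Ultrahyperbolic.Dp p, z₁ q = z₂ q := fun _ hq =>
  sub_eq_zero.1 <| (hz₁.sub hΩo hz₂).eq_zero_of_observation hΩo hΩb hΩs hG hε hεR hσ hX hV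
    (fun q hqW => sub_eq_zero.2 (hW q hqW)) hq

theorem theorem4p2 (m n : ℕ) (hm : 0 < m) (hn : 0 < n)
    (T : ℝ) (Ω : Set (Ultrahyperbolic.E n))
    (hΩne : Ω.Nonempty) (hΩo : IsOpen Ω) (hΩb : Bornology.IsBounded Ω)
    (hΩs : Ultrahyperbolic.HasSmoothBoundary Ω)
    (p : Ultrahyperbolic.ST m n)
    (hT : Ultrahyperbolic.Rplus T Ω p < T)
    (hG : closure (Ultrahyperbolic.cyl m T Ω ∩ Ultrahyperbolic.Dp p) ⊆
      Ultrahyperbolic.cube m T ×ˢ (univ : Set (Ultrahyperbolic.E n)))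
    (X : Ultrahyperbolic.ST m n → Ultrahyperbolic.ST m n)
    (V F H : Ultrahyperbolic.ST m n → ℝ)
    (hX : ContDiffOn ℝ ∞ X (closure (Ultrahyperbolic.cyl m T Ω)))
    (hX0 : ∀ q ∈ Ultrahyperbolic.cyl m T Ω ∩ frontier (Ultrahyperbolic.Dp p), X q = 0)
    (hV : ContDiffOn ℝ ∞ V (closure (Ultrahyperbolic.cyl m T Ω)))
    (hF : ContDiffOn ℝ ∞ F (closure (Ultrahyperbolic.cyl m T Ω)))
    (ε σ : ℝ) (hε : 0 < ε) (hεR : ε * Ultrahyperbolic.Rplus T Ω p < 1) (hσ : 0 < σ)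
    (z₁ z₂ : Ultrahyperbolic.ST m n → ℝ)
    (hz₁ : Ultrahyperbolic.IsSolution T Ω X V F H z₁)
    (hz₂ : Ultrahyperbolic.IsSolution T Ω X V F H z₂) :
    ((∀ q ∈ Ultrahyperbolic.Wp T Ω p ε σ,
        z₁ q = z₂ q ∧ Ultrahyperbolic.gradT z₁ q = Ultrahyperbolic.gradT z₂ q) →
      ∀ q ∈ Ultrahyperbolic.cyl m T Ω ∩ Ultrahyperbolic.Dp p, z₁ q = z₂ q) ∧
    ((∀ q ∈ Ultrahyperbolic.Wp T Ω p ε σ,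
        z₁ q = z₂ q ∧ Ultrahyperbolic.gradX z₁ q = Ultrahyperbolic.gradX z₂ q) →
      ∀ q ∈ Ultrahyperbolic.cyl m T Ω ∩ Ultrahyperbolic.Dp p, z₁ q = z₂ q) := by
  have huniq := theorem4p2_general hΩo hΩb hΩs hG hX.continuousOn hV.continuousOn hε hεR hσ hz₁ hz₂
  exact ⟨fun h => huniq fun q hq => (h q hq).1, fun h => huniq fun q hq => (h q hq).1⟩
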